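/- **Conventions.** Let $k\ge 1$ and $n>2k$ be integers. For a smooth Riemannian metric $g$ on an $n$-manifold let $A_g=\frac1{n-2}\big(Ric_g-\frac{1}{2(n-1)}R_g\,g\big)$ be the Schouten tensor and let $\sigma_j(g^{-1}A_g)$ be the $j$-th elementary symmetric function of the eigenvalues of $g^{-1}A_g$. The metric $g$ is called $m$-admissible, written $g\in\Gamma_m^+$, if $\sigma_j(g^{-1}A_g)>0$ everywhere for $j=1,\dots,m$. **The connected sum.** Let $(M_1,g_1)$, $(M_2,g_2)$ be compact smooth Riemannian $n$-manifolds without boundary and $p_i\in M_i$. Let $x$ (about $p_1$) and $y$ (about $p_2$) be coordinates, vanishing at $p_i$ and defined on a neighbourhood of the closed unit coordinate ball, which are on that ball either geodesic normal coordinates (given by the exponential map), or coordinates in which $g_i=(1+O(|z|^2))\,\delta$ is conformal to the flat metric $\delta$. Write $B(p_i,r)$ for the coordinate ball of radius $r$. For $\varepsilon\in(0,1)$ let $M_\varepsilon=M_1\sharp_\varepsilon M_2$ be the quotient of $(M_1\setminus B(p_1,\varepsilon))\sqcup(M_2\setminus B(p_2,\varepsilon))$ by the identification of $q_1\in\partial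 B(p_1,\varepsilon)$ with $q_2\in\partial B(p_2,\varepsilon)$ when $x(q_1)/|x(q_1)|=y(q_2)/|y(q_2)|$. The neck, i.e. the part of $M_\varepsilon$ coming from the two unit balls, carries the coordinates $(t,\theta)\in(\log\varepsilon,-\log\varepsilon)\times\mathbb S^{n-1}$ with $t=\log\varepsilon-\log|x|$, $\theta=x/|x|$ on the $M_1$ side and $t=-\log\varepsilon+\log|y|$, $\theta=y/|y|$ on the $M_2$ side; these, with the charts of $M_i$ away from the excised balls, define the smooth structure of $M_\varepsilon$. **The approximate solution.** Fix smooth non-increasing functions $\eta,\chi_0:\mathbb R\to[0,1]$ with $\eta=1$ on $(-\infty,-1]$, $\eta=0$ on $[1,\infty)$, $\chi_0=1$ on $(-\infty,-1]$, $\chi_0=0$ on $[0,\infty)$, and put $\chi(t)=\chi_0(t+\log\varepsilon)$. Let $g_{cyl}=dt^2+g_{\mathbb S^{n-1}}$, $u_1=\varepsilon^{\frac{n-2k}{2k}}e^{-\frac{n-2k}{2k}t}$, $u_2=\varepsilon^{\frac{n-2k}{2k}}e^{\frac{n-2k}{2k}t}$, define $a^{(i)}$ on the neck by $g_i=u_i^{4k/(n-2k)}(g_{cyl}+a^{(i)})$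 (with $g_1$ expressed through $x$ and $g_2$ through $y$), and set $u_\varepsilon=\chi(t)u_1+\chi(-t)u_2$. The approximate solution $g_\varepsilon$ is $g_i$ on $M_i\setminus B(p_i,1)$, and on the neck $$g_\varepsilon=u_\varepsilon^{\frac{4k}{n-2k}}\big(g_{cyl}+\eta\,a^{(1)}+(1-\eta)\,a^{(2)}\big).$$ **Lemma 3.1.** For each $n$, $k$, $\eta$, $\chi_0$ there is a function $\varepsilon_0:(0,\infty)^2\to(0,1)$ with the following property. Let $g_1,g_2$ be $(k-1)$-admissible, with $M_i,p_i,x,y$ as above. Then there are $\Lambda,\delta>0$ such that, for $i=1,2$, on the closed unit coordinate ball about $p_i$ the coefficients of $g_i$ (in the coordinates $x$, respectively $y$) have $C^2$ norm at most $\Lambda$ (that is, the operator norms of the coefficient map and of its first and second derivatives are at most $\Lambda$) and eigenvalues at least $1/\Lambda$, and $\sigma_j(g_i^{-1}A_{g_i})\ge\delta$ for $1\le j\le k-1$. For every such pair $\Lambda,\delta$ and every $\varepsilon\in(0,\varepsilon_0(\Lambda,\delta)]$, $g_\varepsilon$ is a smooth Riemannian metric on $M_\varepsilon$ and lies in $\Gamma^+_{k-1}$.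 -/

import Mathlib

open Set Filter
open scoped Manifold Topology ContDiff

set_option linter.unusedSectionVars false

noncomputable section

/-! ### Unit coordinate balls -/

/-- The model space `ℝⁿ` with its Euclidean norm. -/
abbrev Eucl (n : ℕ) : Type := EuclideanSpace ℝ (Fin n)

/-- A smooth chart of `M` whose image contains the closed unit ball of `ℝⁿ`. Its centre, the point
with coordinate `0`, is the point about which the connected sum is performed. -/
structure UnitBallChart (n : ℕ) (M : Type*) [TopologicalSpace M] [ChartedSpace (Eucl n) M] where
  chart : OpenPartialHomeomorph M (Eucl n)
  mem_maximalAtlas : chart ∈ IsManifold.maximalAtlas (𝓡 n) ∞ M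
  closedBall_subset : Metric.closedBall (0 : Eucl n) 1 ⊆ chart.target

namespace UnitBallChart

variable {n : ℕ} {M : Type*} [TopologicalSpace M] [ChartedSpace (Eucl n) M]

/-- The centre `p`. -/
def center (x : UnitBallChart n M) : M := x.chart.symm 0

/-- The ball `B(p, r)`, for `r ≤ 1`. -/
def ball (x : UnitBallChart n M) (r : ℝ) : Set M := {q | q ∈ x.chart.source ∧ ‖x.chart q‖ < r}

/-- The closed ball of radius `r ≤ 1` about `p`. -/
def closedBall (x : UnitBallChart n M) (r : ℝ) : Set M :=
  {q | q ∈ x.chart.source ∧ ‖x.chart q‖ ≤ r}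

/-- The sphere `∂B(p, r)`, for `r ≤ 1`. -/
def sphere (x : UnitBallChart n M) (r : ℝ) : Set M := {q | q ∈ x.chart.source ∧ ‖x.chart q‖ = r}

/-- `M \ B(p, r)`. -/
def Excised (x : UnitBallChart n M) (r : ℝ) : Type _ := {q : M // q ∉ x.ball r}

theorem mem_target (x : UnitBallChart n M) {z : Eucl n} (hz : ‖z‖ ≤ 1) : z ∈ x.chart.target :=
  x.closedBall_subset (by simpa using hz)

theorem isClosed_closedBall [T2Space M] (x : UnitBallChart n M) {r : ℝ} (hr : r ≤ 1) :
    IsClosed (x.closedBall r) := by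
  have h : x.closedBall r = x.chart.symm '' Metric.closedBall (0 : Eucl n) r := by
    ext q
    constructor
    · rintro ⟨h1, h2⟩
      exact ⟨x.chart q, by simpa using h2, x.chart.left_inv h1⟩
    · rintro ⟨z, hz, rfl⟩
      have hz' : ‖z‖ ≤ r := by simpa using hz
      have ht := x.mem_target (hz'.trans hr)
      exact ⟨x.chart.map_target ht, by rw [x.chart.right_inv ht]; exact hz'⟩
  rw [h]
  refine ((isCompact_closedBall _ _).image_of_continuousOn ?_).isClosed
  exact x.chart.continuousOn_symm.mono
    fun z hz => x.mem_target ((by simpa using hz : ‖z‖ ≤ r).trans hr)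

theorem center_mem (x : UnitBallChart n M) {r : ℝ} (hr : 0 < r) : x.center ∈ x.ball r := by
  have h0 : (0 : Eucl n) ∈ x.chart.target := x.mem_target (by simp)
  exact ⟨x.chart.map_target h0, by
    rw [center, x.chart.right_inv h0]; simpa using hr⟩

theorem ball_subset_closedBall (x : UnitBallChart n M) (r : ℝ) : x.ball r ⊆ x.closedBall r :=
  fun _ h => ⟨h.1, h.2.le⟩

end UnitBallChart

/-! ### The connected sum -/

section ConnectedSum

variable {n : ℕ} {M₁ M₂ : Type*} [TopologicalSpace M₁] [ChartedSpace (Eucl n) M₁]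
  [TopologicalSpace M₂] [ChartedSpace (Eucl n) M₂]

/-- A point `q₁ ∈ ∂B(p₁, ε)` is identified with the point `q₂ ∈ ∂B(p₂, ε)` such that
`x(q₁) / |x(q₁)| = y(q₂) / |y(q₂)|`. -/
def NeckIdentified (x : UnitBallChart n M₁) (y : UnitBallChart n M₂) (ε : ℝ) :
    x.Excised ε ⊕ y.Excised ε → x.Excised ε ⊕ y.Excised ε → Prop
  | .inl q₁, .inr q₂ => q₁.1 ∈ x.sphere ε ∧ q₂.1 ∈ y.sphere ε ∧
      ‖x.chart q₁.1‖⁻¹ • x.chart q₁.1 = ‖y.chart q₂.1‖⁻¹ • y.chart q₂.1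
  | _, _ => False

/-- The connected sum `M₁ ♯_ε M₂`, as the quotient of
`(M₁ \ B(p₁, ε)) ⊔ (M₂ \ B(p₂, ε))` by the identification of the two boundaries. -/
def ConnectedSum (x : UnitBallChart n M₁) (y : UnitBallChart n M₂) (ε : Ioo (0 : ℝ) 1) : Type _ :=
  Quot (NeckIdentified x y ε)

namespace ConnectedSum

variable (x : UnitBallChart n M₁) (y : UnitBallChart n M₂) (ε : Ioo (0 : ℝ) 1)

/-- The map `M₁ \ B(p₁, ε) → M_ε`. -/
def inl (q : x.Excised ε) : ConnectedSum x y ε := Quot.mk _ (Sum.inl q)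

/-- The map `M₂ \ B(p₂, ε) → M_ε`. -/
def inr (q : y.Excised ε) : ConnectedSum x y ε := Quot.mk _ (Sum.inr q)

open Classical in
/-- The inverse of the inclusion of `M₁ \ closedBall(p₁, ε)` (constant elsewhere). -/
def projLeft : ConnectedSum x y ε → M₁ :=
  Quot.lift (Sum.elim (fun q => if q.1 ∈ x.closedBall ε then x.center else q.1)
    (fun _ => x.center)) (by
      rintro (a | a) (b | b) h <;> simp only [NeckIdentified] at h
      have : a.1 ∈ x.closedBall ε := ⟨h.1.1, h.1.2.le⟩
      simp [this])

open Classical in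
/-- The inverse of the inclusion of `M₂ \ closedBall(p₂, ε)` (constant elsewhere). -/
def projRight : ConnectedSum x y ε → M₂ :=
  Quot.lift (Sum.elim (fun _ => y.center)
    (fun q => if q.1 ∈ y.closedBall ε then y.center else q.1)) (by
      rintro (a | a) (b | b) h <;> simp only [NeckIdentified] at h
      have : b.1 ∈ y.closedBall ε := ⟨h.2.1.1, h.2.1.2.le⟩
      simp [this])

/-- The inversion `v ↦ ε² v / |v|²`, which is `y ↦ x` and `x ↦ y` on the neck. -/
def invert (ε : ℝ) (v : Eucl n) : Eucl n := (ε / ‖v‖) ^ 2 • v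

theorem invert_eq (ε : ℝ) : (invert ε : Eucl n → Eucl n) = EuclideanGeometry.inversion 0 ε := by
  ext v : 1
  simp [invert, EuclideanGeometry.inversion]

theorem invert_invert {ε : ℝ} (hε : ε ≠ 0) (v : Eucl n) : invert ε (invert ε v) = v := by
  rw [invert_eq]; exact EuclideanGeometry.inversion_inversion _ hε v

theorem norm_invert (ε : ℝ) (v : Eucl n) : ‖invert ε v‖ = ε ^ 2 / ‖v‖ := by
  rw [invert_eq]; simpa using EuclideanGeometry.dist_inversion_center 0 v ε

theorem invert_of_norm {ε : ℝ} (hε : 0 < ε) {v : Eucl n} (h : ‖v‖ = ε) : invert ε v = v := by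
  simp [invert, h, hε.ne']

theorem contDiffAt_invert (ε : ℝ) {v : Eucl n} (hv : v ≠ 0) : ContDiffAt ℝ ∞ (invert ε) v := by
  rw [invert_eq]
  exact contDiffAt_const.inversion contDiffAt_const contDiffAt_id hv

theorem eq_of_identified {ε : ℝ} (hε : 0 < ε) {v w : Eucl n} (hv : ‖v‖ = ε) (hw : ‖w‖ = ε)
    (h : ‖v‖⁻¹ • v = ‖w‖⁻¹ • w) : v = w := by
  rw [hv, hw] at h
  exact smul_right_injective _ (inv_ne_zero hε.ne') h

/-- The neck coordinate: `z = x` on `M₁` and `z = ε² y / |y|²` on `M₂`. In terms of the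
cylindrical coordinates `(t, θ)` on the neck it is `z = ε e^{-t} θ`. -/
def neckCoord : ConnectedSum x y ε → Eucl n :=
  Quot.lift (Sum.elim (fun q => x.chart q.1) (fun q => invert ε (y.chart q.1))) (by
      rintro (a | a) (b | b) h <;> simp only [NeckIdentified] at h
      obtain ⟨h1, h2, h3⟩ := h
      have h4 := eq_of_identified ε.2.1 h1.2 h2.2 h3
      simp [invert_of_norm ε.2.1 h2.2, h4])

/-- The neck region `[A(p₁, 1, ε) ⊔ A(p₂, 1, ε)] / ∼`. -/
def neck : Set (ConnectedSum x y ε) :=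
  {c | (∃ q : x.Excised ε, q.1 ∈ x.ball 1 ∧ inl x y ε q = c) ∨
    ∃ q : y.Excised ε, q.1 ∈ y.ball 1 ∧ inr x y ε q = c}

/-- The image of the neck under the neck coordinate: `log ε < t < -log ε`. -/
def neckAnnulus (n : ℕ) (ε : ℝ) : Set (Eucl n) := {z | ε ^ 2 < ‖z‖ ∧ ‖z‖ < 1}

theorem projLeft_inl {q : x.Excised ε} (hq : q.1 ∉ x.closedBall ε) :
    projLeft x y ε (inl x y ε q) = q.1 := by
  simp [projLeft, inl, hq]

theorem projLeft_inl' {q : x.Excised ε} (hq : q.1 ∈ x.closedBall ε) :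
    projLeft x y ε (inl x y ε q) = x.center := by
  simp [projLeft, inl, hq]

theorem projLeft_inr (q : y.Excised ε) : projLeft x y ε (inr x y ε q) = x.center := rfl

theorem projRight_inr {q : y.Excised ε} (hq : q.1 ∉ y.closedBall ε) :
    projRight x y ε (inr x y ε q) = q.1 := by
  simp [projRight, inr, hq]

theorem projRight_inr' {q : y.Excised ε} (hq : q.1 ∈ y.closedBall ε) :
    projRight x y ε (inr x y ε q) = y.center := by
  simp [projRight, inr, hq]

theorem projRight_inl (q : x.Excised ε) : projRight x y ε (inl x y ε q) = y.center := rfl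

theorem norm_of_excised {x : UnitBallChart n M₁} {ε : ℝ} (q : x.Excised ε)
    (h : q.1 ∈ x.chart.source) : ε ≤ ‖x.chart q.1‖ := by
  by_contra hlt
  exact q.2 ⟨h, not_le.1 hlt⟩

theorem norm_lt_of_notMem {x : UnitBallChart n M₁} {ε : ℝ} {q : M₁} (h : q ∈ x.chart.source)
    (hq : q ∉ x.closedBall ε) : ε < ‖x.chart q‖ := by
  by_contra hlt
  exact hq ⟨h, not_lt.1 hlt⟩

theorem neckCoord_bijOn : BijOn (neckCoord x y ε) (neck x y ε) (neckAnnulus n ε) := by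
  have hε := ε.2.1
  have hε1 := ε.2.2
  have hsq : (ε : ℝ) ^ 2 < ε := by nlinarith
  refine ⟨?_, ?_, ?_⟩
  · rintro c (⟨q, hq, rfl⟩ | ⟨q, hq, rfl⟩)
    · have := norm_of_excised q hq.1
      exact ⟨hsq.trans_le this, hq.2⟩
    · have h1 := norm_of_excised q hq.1
      have hpos := hε.trans_le h1
      have h2 : ‖y.chart q.1‖ < 1 := hq.2
      change ‖invert (ε : ℝ) (y.chart q.1)‖ > _ ∧ ‖invert (ε : ℝ) (y.chart q.1)‖ < 1
      rw [norm_invert, gt_iff_lt, lt_div_iff₀ hpos, div_lt_one hpos]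
      exact ⟨by nlinarith [sq_nonneg (ε : ℝ), pow_pos hε 2], by nlinarith⟩
  · have aux : ∀ q : x.Excised ε, q.1 ∈ x.ball 1 → ∀ q' : y.Excised ε, q'.1 ∈ y.ball 1 →
        x.chart q.1 = invert ε (y.chart q'.1) → inl x y ε q = inr x y ε q' := by
      intro q hq q' hq' h
      have h1 := norm_of_excised q hq.1
      have h2 := norm_of_excised q' hq'.1
      have h3 : ‖x.chart q.1‖ = (ε : ℝ) ^ 2 / ‖y.chart q'.1‖ := by rw [h, norm_invert]
      have hpos := hε.trans_le h2
      rw [eq_div_iff hpos.ne'] at h3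
      have h4 : ‖y.chart q'.1‖ = ε := by nlinarith
      have h5 : ‖x.chart q.1‖ = ε := by nlinarith
      rw [invert_of_norm hε h4] at h
      exact Quot.sound ⟨⟨hq.1, h5⟩, ⟨hq'.1, h4⟩, by rw [h]⟩
    rintro c (⟨q, hq, rfl⟩ | ⟨q, hq, rfl⟩) c' (⟨q', hq', rfl⟩ | ⟨q', hq', rfl⟩) h
    · have : q = q' := Subtype.ext (x.chart.injOn hq.1 hq'.1 h)
      rw [this]
    · exact aux q hq q' hq' h
    · exact (aux q' hq' q hq h.symm).symm
    · have h' : invert (ε : ℝ) (y.chart q.1) = invert (ε : ℝ) (y.chart q'.1) := h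
      have h2 := congrArg (invert (ε : ℝ)) h'
      rw [invert_invert hε.ne', invert_invert hε.ne'] at h2
      have : q = q' := Subtype.ext (y.chart.injOn hq.1 hq'.1 h2)
      rw [this]
  · rintro z ⟨hz1, hz2⟩
    have hz0 : 0 < ‖z‖ := (pow_pos hε 2).trans hz1
    rcases le_total (ε : ℝ) ‖z‖ with h | h
    · have ht := x.mem_target hz2.le
      refine ⟨inl x y ε ⟨x.chart.symm z, ?_⟩, Or.inl ⟨_, ⟨x.chart.map_target ht, ?_⟩, rfl⟩, ?_⟩
      · rintro ⟨-, h'⟩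
        rw [x.chart.right_inv ht] at h'
        exact absurd h' (not_lt.2 h)
      · rw [x.chart.right_inv ht]; exact hz2
      · exact x.chart.right_inv ht
    · have hn : ‖invert (ε : ℝ) z‖ < 1 := by rw [norm_invert, div_lt_one hz0]; exact hz1
      have ht := y.mem_target hn.le
      refine ⟨inr x y ε ⟨y.chart.symm (invert ε z), ?_⟩,
        Or.inr ⟨_, ⟨y.chart.map_target ht, ?_⟩, rfl⟩, ?_⟩
      · rintro ⟨-, h'⟩
        rw [y.chart.right_inv ht, norm_invert, div_lt_iff₀ hz0] at h'
        nlinarith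
      · rw [y.chart.right_inv ht]; exact hn
      · change invert (ε : ℝ) (y.chart (y.chart.symm (invert ε z))) = z
        rw [y.chart.right_inv ht, invert_invert hε.ne']

theorem leftCoord_bijOn (e : OpenPartialHomeomorph M₁ (Eucl n)) :
    BijOn (fun c => e (projLeft x y ε c))
      {c | ∃ q : x.Excised ε, q.1 ∉ x.closedBall ε ∧ q.1 ∈ e.source ∧ inl x y ε q = c}
      (e '' (e.source \ x.closedBall ε)) := by
  refine ⟨?_, ?_, ?_⟩
  · rintro c ⟨q, hq, hs, rfl⟩
    exact ⟨q.1, ⟨hs, hq⟩, by simp [projLeft_inl x y ε hq]⟩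
  · rintro c ⟨q, hq, hs, rfl⟩ c' ⟨q', hq', hs', rfl⟩ h
    simp only [projLeft_inl x y ε hq, projLeft_inl x y ε hq'] at h
    have : q = q' := Subtype.ext (e.injOn hs hs' h)
    rw [this]
  · rintro z ⟨q, ⟨hs, hq⟩, rfl⟩
    have hb : q ∉ x.ball ε := fun h => hq (x.ball_subset_closedBall _ h)
    exact ⟨inl x y ε ⟨q, hb⟩, ⟨_, hq, hs, rfl⟩, by
      simp only [projLeft_inl x y ε (q := ⟨q, hb⟩) hq]⟩

theorem rightCoord_bijOn (e : OpenPartialHomeomorph M₂ (Eucl n)) :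
    BijOn (fun c => e (projRight x y ε c))
      {c | ∃ q : y.Excised ε, q.1 ∉ y.closedBall ε ∧ q.1 ∈ e.source ∧ inr x y ε q = c}
      (e '' (e.source \ y.closedBall ε)) := by
  refine ⟨?_, ?_, ?_⟩
  · rintro c ⟨q, hq, hs, rfl⟩
    exact ⟨q.1, ⟨hs, hq⟩, by simp [projRight_inr x y ε hq]⟩
  · rintro c ⟨q, hq, hs, rfl⟩ c' ⟨q', hq', hs', rfl⟩ h
    simp only [projRight_inr x y ε hq, projRight_inr x y ε hq'] at h
    have : q = q' := Subtype.ext (e.injOn hs hs' h)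
    rw [this]
  · rintro z ⟨q, ⟨hs, hq⟩, rfl⟩
    have hb : q ∉ y.ball ε := fun h => hq (y.ball_subset_closedBall _ h)
    exact ⟨inr x y ε ⟨q, hb⟩, ⟨_, hq, hs, rfl⟩, by
      simp only [projRight_inr x y ε (q := ⟨q, hb⟩) hq]⟩

instance [NeZero n] : Nonempty (ConnectedSum x y ε) := by
  have hε := ε.2.1
  have hε1 := ε.2.2
  have hz : EuclideanSpace.single (0 : Fin n) (ε : ℝ) ∈ neckAnnulus n ε := by
    constructor
    · simp only [PiLp.norm_single, Real.norm_eq_abs, abs_of_pos hε]; nlinarith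
    · simpa [abs_of_pos hε] using hε1
  obtain ⟨c, -, -⟩ := (neckCoord_bijOn x y ε).surjOn hz
  exact ⟨c⟩

variable [NeZero n]

/-- The chart on the neck region. -/
def neckChart : PartialEquiv (ConnectedSum x y ε) (Eucl n) :=
  (neckCoord_bijOn x y ε).toPartialEquiv _ _ _

/-- A chart of `M₁`, restricted to the complement of the closed ball of radius `ε` about `p₁`. -/
def leftChart (e : OpenPartialHomeomorph M₁ (Eucl n)) : PartialEquiv (ConnectedSum x y ε) (Eucl n) :=
  (leftCoord_bijOn x y ε e).toPartialEquiv _ _ _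

/-- A chart of `M₂`, restricted to the complement of the closed ball of radius `ε` about `p₂`. -/
def rightChart (e : OpenPartialHomeomorph M₂ (Eucl n)) :
    PartialEquiv (ConnectedSum x y ε) (Eucl n) :=
  (rightCoord_bijOn x y ε e).toPartialEquiv _ _ _

/-- The neck chart, together with the charts of `M₁` and `M₂`, away from the excised balls. -/
def chartFamily : Set (PartialEquiv (ConnectedSum x y ε) (Eucl n)) :=
  {e | e = neckChart x y ε ∨ (∃ φ ∈ atlas (Eucl n) M₁, e = leftChart x y ε φ) ∨
    ∃ φ ∈ atlas (Eucl n) M₂, e = rightChart x y ε φ}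

open Classical in
/-- The preferred chart at a point: the neck chart in the neck region, and the preferred chart of
`M₁` or `M₂` elsewhere. -/
def preferredChart (c : ConnectedSum x y ε) : PartialEquiv (ConnectedSum x y ε) (Eucl n) :=
  if c ∈ neck x y ε then neckChart x y ε
  else if c ∈ range (inl x y ε) then leftChart x y ε (chartAt _ (projLeft x y ε c))
  else rightChart x y ε (chartAt _ (projRight x y ε c))

theorem mem_preferredChart (c : ConnectedSum x y ε) : c ∈ (preferredChart x y ε c).source := by
  have hε1 := ε.2.2
  unfold preferredChart
  split_ifs with h1 h2
  · exact h1
  · obtain ⟨q, rfl⟩ := h2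
    have h : q.1 ∉ x.closedBall ε := fun h => h1 (Or.inl ⟨q, ⟨h.1, h.2.trans_lt hε1⟩, rfl⟩)
    rw [projLeft_inl x y ε h]
    exact ⟨q, h, mem_chart_source _ _, rfl⟩
  · obtain ⟨q | q, rfl⟩ := Quot.exists_rep c
    · exact absurd ⟨q, rfl⟩ h2
    have h : q.1 ∉ y.closedBall ε := fun h => h1 (Or.inr ⟨q, ⟨h.1, h.2.trans_lt hε1⟩, rfl⟩)
    have h' : projRight x y ε (Quot.mk _ (Sum.inr q)) = q.1 := projRight_inr x y ε h
    rw [h']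
    exact ⟨q, h, mem_chart_source _ _, rfl⟩

theorem preferredChart_mem (c : ConnectedSum x y ε) :
    preferredChart x y ε c ∈ chartFamily x y ε := by
  unfold preferredChart
  split_ifs with h1 h2
  · exact Or.inl rfl
  · exact Or.inr (Or.inl ⟨_, chart_mem_atlas _ _, rfl⟩)
  · exact Or.inr (Or.inr ⟨_, chart_mem_atlas _ _, rfl⟩)

/-- The change of charts from `e` to `e'` is locally smooth with open domain. -/
def SmoothLink {Q : Type*} (e e' : PartialEquiv Q (Eucl n)) : Prop :=
  ∀ c ∈ e.source, c ∈ e'.source → ∃ F : Eucl n → Eucl n, ContDiffAt ℝ ∞ F (e c) ∧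
    ∀ᶠ w in 𝓝 (e c), ∃ c', c' ∈ e.source ∧ c' ∈ e'.source ∧ e c' = w ∧ e' c' = F w

theorem SmoothLink.isOpen {Q : Type*} {e e' : PartialEquiv Q (Eucl n)} (h : SmoothLink e e') :
    IsOpen (e.symm.trans e').source := by
  rw [isOpen_iff_mem_nhds]
  rintro z ⟨hz1, hz2⟩
  have hz1 : z ∈ e.target := hz1
  have hz2 : e.symm z ∈ e'.source := hz2
  obtain ⟨F, -, hF⟩ := h _ (e.map_target hz1) hz2
  rw [e.right_inv hz1] at hF
  filter_upwards [hF] with w hw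
  obtain ⟨c', h1, h2, rfl, -⟩ := hw
  refine ⟨e.map_source h1, ?_⟩
  change e.symm (e c') ∈ e'.source
  rwa [e.left_inv h1]

theorem SmoothLink.contDiffOn {Q : Type*} {e e' : PartialEquiv Q (Eucl n)} (h : SmoothLink e e') :
    ContDiffOn ℝ ∞ (e.symm.trans e') (e.symm.trans e').source := by
  rintro z ⟨hz1, hz2⟩
  have hz1 : z ∈ e.target := hz1
  have hz2 : e.symm z ∈ e'.source := hz2
  obtain ⟨F, hs, hF⟩ := h _ (e.map_target hz1) hz2
  rw [e.right_inv hz1] at hF hs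
  refine (hs.congr_of_eventuallyEq ?_).contDiffWithinAt
  filter_upwards [hF] with w hw
  obtain ⟨c', h1, h2, rfl, h4⟩ := hw
  change e' (e.symm (e c')) = _
  rw [e.left_inv h1, h4]

variable [IsManifold (𝓡 n) ∞ M₁] [IsManifold (𝓡 n) ∞ M₂]

theorem contDiffAt_transition {M : Type*} [TopologicalSpace M] [ChartedSpace (Eucl n) M]
    [IsManifold (𝓡 n) ∞ M] {e e' : OpenPartialHomeomorph M (Eucl n)}
    (he : e ∈ IsManifold.maximalAtlas (𝓡 n) ∞ M) (he' : e' ∈ IsManifold.maximalAtlas (𝓡 n) ∞ M)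
    {q : M} (hq : q ∈ e.source) (hq' : q ∈ e'.source) :
    ContDiffAt ℝ ∞ (e' ∘ e.symm) (e q) := by
  rw [← contMDiffAt_iff_contDiffAt]
  refine ContMDiffAt.comp (I' := 𝓡 n) (e q) ?_
    (contMDiffAt_symm_of_mem_maximalAtlas he (e.map_source hq))
  rw [e.left_inv hq]
  exact contMDiffAt_of_mem_maximalAtlas he' hq'

theorem eventually_transition {M : Type*} [TopologicalSpace M] [ChartedSpace (Eucl n) M]
    {e : OpenPartialHomeomorph M (Eucl n)} {q : M} (hq : q ∈ e.source) {s : Set M}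
    (hs : IsOpen s) (hqs : q ∈ s) :
    ∀ᶠ w in 𝓝 (e q), ∃ q', q' ∈ e.source ∧ q' ∈ s ∧ e q' = w := by
  have h1 := (e.isOpen_inter_preimage_symm hs).mem_nhds
    (show e q ∈ e.target ∩ e.symm ⁻¹' s from
      ⟨e.map_source hq, by simpa [e.left_inv hq] using hqs⟩)
  filter_upwards [h1] with w hw
  exact ⟨e.symm w, e.map_target hw.1, hw.2, e.right_inv hw.1⟩

variable {x y ε}

theorem isOpen_shell [T2Space M₁] : IsOpen (x.ball 1 \ x.closedBall ε) := by
  have h : IsOpen (x.ball 1) := by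
    have := x.chart.isOpen_inter_preimage (Metric.isOpen_ball (x := (0 : Eucl n)) (ε := 1))
    convert this using 1
    ext q; simp [UnitBallChart.ball]
  exact h.sdiff (x.isClosed_closedBall ε.2.2.le)

theorem mem_neck_inl {q : x.Excised ε} (hq : q.1 ∉ x.closedBall ε)
    (h : inl x y ε q ∈ neck x y ε) : q.1 ∈ x.ball 1 := by
  have hne : q.1 ≠ x.center := fun h' => q.2 (h' ▸ x.center_mem ε.2.1)
  rcases h with ⟨q', hq', h⟩ | ⟨q', hq', h⟩
  · have h2 := congrArg (projLeft x y ε) h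
    rw [projLeft_inl x y ε hq] at h2
    by_cases h3 : q'.1 ∈ x.closedBall ε
    · rw [projLeft_inl' x y ε h3] at h2; exact absurd h2.symm hne
    · rw [projLeft_inl x y ε h3] at h2; exact h2 ▸ hq'
  · have h2 := congrArg (projLeft x y ε) h
    rw [projLeft_inl x y ε hq, projLeft_inr] at h2
    exact absurd h2.symm hne

theorem mem_neck_inr {q : y.Excised ε} (hq : q.1 ∉ y.closedBall ε)
    (h : inr x y ε q ∈ neck x y ε) : q.1 ∈ y.ball 1 := by
  have hne : q.1 ≠ y.center := fun h' => q.2 (h' ▸ y.center_mem ε.2.1)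
  rcases h with ⟨q', hq', h⟩ | ⟨q', hq', h⟩
  · have h2 := congrArg (projRight x y ε) h
    rw [projRight_inr x y ε hq, projRight_inl] at h2
    exact absurd h2.symm hne
  · have h2 := congrArg (projRight x y ε) h
    rw [projRight_inr x y ε hq] at h2
    by_cases h3 : q'.1 ∈ y.closedBall ε
    · rw [projRight_inr' x y ε h3] at h2; exact absurd h2.symm hne
    · rw [projRight_inr x y ε h3] at h2; exact h2 ▸ hq'

theorem inl_ne_inr {q : x.Excised ε} (hq : q.1 ∉ x.closedBall ε) (q' : y.Excised ε) :
    inl x y ε q ≠ inr x y ε q' := by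
  intro h
  have h2 := congrArg (projLeft x y ε) h
  rw [projLeft_inl x y ε hq, projLeft_inr] at h2
  exact q.2 (h2 ▸ x.center_mem ε.2.1)

theorem inl_injective {q q' : x.Excised ε} (hq : q.1 ∉ x.closedBall ε)
    (hq' : q'.1 ∉ x.closedBall ε) (h : inl x y ε q = inl x y ε q') : q = q' := by
  have h2 := congrArg (projLeft x y ε) h
  rw [projLeft_inl x y ε hq, projLeft_inl x y ε hq'] at h2
  exact Subtype.ext h2

theorem inr_injective {q q' : y.Excised ε} (hq : q.1 ∉ y.closedBall ε)
    (hq' : q'.1 ∉ y.closedBall ε) (h : inr x y ε q = inr x y ε q') : q = q' := by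
  have h2 := congrArg (projRight x y ε) h
  rw [projRight_inr x y ε hq, projRight_inr x y ε hq'] at h2
  exact Subtype.ext h2

theorem leftChart_inl (e : OpenPartialHomeomorph M₁ (Eucl n)) {q : x.Excised ε}
    (hq : q.1 ∉ x.closedBall ε) : leftChart x y ε e (inl x y ε q) = e q.1 :=
  congrArg e (projLeft_inl x y ε hq)

theorem rightChart_inr (e : OpenPartialHomeomorph M₂ (Eucl n)) {q : y.Excised ε}
    (hq : q.1 ∉ y.closedBall ε) : rightChart x y ε e (inr x y ε q) = e q.1 :=
  congrArg e (projRight_inr x y ε hq)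

theorem link_left_left [T2Space M₁] {φ φ' : OpenPartialHomeomorph M₁ (Eucl n)}
    (h : φ ∈ IsManifold.maximalAtlas (𝓡 n) ∞ M₁)
    (h' : φ' ∈ IsManifold.maximalAtlas (𝓡 n) ∞ M₁) :
    SmoothLink (leftChart x y ε φ) (leftChart x y ε φ') := by
  rintro c ⟨q, hq, hs, rfl⟩ ⟨q', hq', hs', hc⟩
  obtain rfl := inl_injective hq' hq hc
  rw [leftChart_inl φ hq]
  refine ⟨_, contDiffAt_transition h h' hs hs', ?_⟩
  have ho := φ'.open_source.sdiff (x.isClosed_closedBall ε.2.2.le)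
  filter_upwards [eventually_transition hs ho ⟨hs', hq⟩] with w hw
  obtain ⟨r, h1, h2, rfl⟩ := hw
  have hr : r ∉ x.ball ε := fun h => h2.2 (x.ball_subset_closedBall _ h)
  refine ⟨inl x y ε ⟨r, hr⟩, ⟨_, h2.2, h1, rfl⟩, ⟨_, h2.2, h2.1, rfl⟩, leftChart_inl φ h2.2, ?_⟩
  rw [leftChart_inl φ' (q := ⟨r, hr⟩) h2.2]
  simp [φ.left_inv h1]

theorem link_right_right [T2Space M₂] {φ φ' : OpenPartialHomeomorph M₂ (Eucl n)}
    (h : φ ∈ IsManifold.maximalAtlas (𝓡 n) ∞ M₂)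
    (h' : φ' ∈ IsManifold.maximalAtlas (𝓡 n) ∞ M₂) :
    SmoothLink (rightChart x y ε φ) (rightChart x y ε φ') := by
  rintro c ⟨q, hq, hs, rfl⟩ ⟨q', hq', hs', hc⟩
  obtain rfl := inr_injective hq' hq hc
  rw [rightChart_inr φ hq]
  refine ⟨_, contDiffAt_transition h h' hs hs', ?_⟩
  have ho := φ'.open_source.sdiff (y.isClosed_closedBall ε.2.2.le)
  filter_upwards [eventually_transition hs ho ⟨hs', hq⟩] with w hw
  obtain ⟨r, h1, h2, rfl⟩ := hw
  have hr : r ∉ y.ball ε := fun h => h2.2 (y.ball_subset_closedBall _ h)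
  refine ⟨inr x y ε ⟨r, hr⟩, ⟨_, h2.2, h1, rfl⟩, ⟨_, h2.2, h2.1, rfl⟩, rightChart_inr φ h2.2, ?_⟩
  rw [rightChart_inr φ' (q := ⟨r, hr⟩) h2.2]
  simp [φ.left_inv h1]

theorem link_left_neck [T2Space M₁] {φ : OpenPartialHomeomorph M₁ (Eucl n)}
    (h : φ ∈ IsManifold.maximalAtlas (𝓡 n) ∞ M₁) :
    SmoothLink (leftChart x y ε φ) (neckChart x y ε) := by
  rintro c ⟨q, hq, hs, rfl⟩ hc
  have hb := mem_neck_inl hq hc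
  rw [leftChart_inl φ hq]
  refine ⟨_, contDiffAt_transition h x.mem_maximalAtlas hs hb.1, ?_⟩
  filter_upwards [eventually_transition hs isOpen_shell ⟨hb, hq⟩] with w hw
  obtain ⟨r, h1, h2, rfl⟩ := hw
  have hr : r ∉ x.ball ε := fun h => h2.2 (x.ball_subset_closedBall _ h)
  refine ⟨inl x y ε ⟨r, hr⟩, ⟨_, h2.2, h1, rfl⟩, Or.inl ⟨_, h2.1, rfl⟩, leftChart_inl φ h2.2, ?_⟩
  simp only [Function.comp, φ.left_inv h1]
  rfl

theorem link_neck_left [T2Space M₁] {φ : OpenPartialHomeomorph M₁ (Eucl n)}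
    (h : φ ∈ IsManifold.maximalAtlas (𝓡 n) ∞ M₁) :
    SmoothLink (neckChart x y ε) (leftChart x y ε φ) := by
  rintro c hc ⟨q, hq, hs, rfl⟩
  have hb := mem_neck_inl hq hc
  change ∃ F, ContDiffAt ℝ ∞ F (x.chart q.1) ∧ ∀ᶠ w in 𝓝 (x.chart q.1), _
  refine ⟨_, contDiffAt_transition x.mem_maximalAtlas h hb.1 hs, ?_⟩
  filter_upwards [eventually_transition hb.1 (isOpen_shell.inter φ.open_source)
    ⟨⟨hb, hq⟩, hs⟩] with w hw
  obtain ⟨r, h1, ⟨h2, h3⟩, rfl⟩ := hw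
  have hr : r ∉ x.ball ε := fun h => h2.2 (x.ball_subset_closedBall _ h)
  refine ⟨inl x y ε ⟨r, hr⟩, Or.inl ⟨_, h2.1, rfl⟩, ⟨_, h2.2, h3, rfl⟩, rfl, ?_⟩
  rw [leftChart_inl φ (q := ⟨r, hr⟩) h2.2]
  simp [x.chart.left_inv h1]

theorem link_right_neck [T2Space M₂] {φ : OpenPartialHomeomorph M₂ (Eucl n)}
    (h : φ ∈ IsManifold.maximalAtlas (𝓡 n) ∞ M₂) :
    SmoothLink (rightChart x y ε φ) (neckChart x y ε) := by
  rintro c ⟨q, hq, hs, rfl⟩ hc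
  have hb := mem_neck_inr hq hc
  rw [rightChart_inr φ hq]
  have h0 : (y.chart ∘ φ.symm) (φ q.1) ≠ 0 := by
    simp only [Function.comp, φ.left_inv hs]
    have := norm_lt_of_notMem hb.1 hq
    exact norm_pos_iff.1 (ε.2.1.trans this)
  refine ⟨invert ε ∘ (y.chart ∘ φ.symm), (contDiffAt_invert _ h0).comp _
    (contDiffAt_transition h y.mem_maximalAtlas hs hb.1), ?_⟩
  filter_upwards [eventually_transition hs isOpen_shell ⟨hb, hq⟩] with w hw
  obtain ⟨r, h1, h2, rfl⟩ := hw
  have hr : r ∉ y.ball ε := fun h => h2.2 (y.ball_subset_closedBall _ h)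
  refine ⟨inr x y ε ⟨r, hr⟩, ⟨_, h2.2, h1, rfl⟩, Or.inr ⟨_, h2.1, rfl⟩, rightChart_inr φ h2.2, ?_⟩
  simp only [Function.comp, φ.left_inv h1]
  rfl

theorem link_neck_right [T2Space M₂] {φ : OpenPartialHomeomorph M₂ (Eucl n)}
    (h : φ ∈ IsManifold.maximalAtlas (𝓡 n) ∞ M₂) :
    SmoothLink (neckChart x y ε) (rightChart x y ε φ) := by
  rintro c hc ⟨q, hq, hs, rfl⟩
  have hε := ε.2.1
  have hb := mem_neck_inr hq hc
  have hpos : 0 < ‖y.chart q.1‖ := hε.trans (norm_lt_of_notMem hb.1 hq)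
  have h0 : invert (ε : ℝ) (y.chart q.1) ≠ 0 := by
    rw [← norm_pos_iff, norm_invert]; positivity
  change ∃ F, ContDiffAt ℝ ∞ F (invert (ε : ℝ) (y.chart q.1)) ∧
    ∀ᶠ w in 𝓝 (invert (ε : ℝ) (y.chart q.1)), _
  have hi := contDiffAt_invert (ε : ℝ) h0
  have hii := invert_invert hε.ne' (y.chart q.1)
  refine ⟨(φ ∘ y.chart.symm) ∘ invert ε, ContDiffAt.comp _ ?_ hi, ?_⟩
  · rw [hii]
    exact contDiffAt_transition y.mem_maximalAtlas h hb.1 hs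
  have hev := eventually_transition hb.1 (isOpen_shell.inter φ.open_source) ⟨⟨hb, hq⟩, hs⟩
  have ht := hi.continuousAt.tendsto
  rw [hii] at ht
  filter_upwards [ht.eventually hev] with w hw
  obtain ⟨r, h1, ⟨h2, h3⟩, h4⟩ := hw
  have hr : r ∉ y.ball ε := fun h => h2.2 (y.ball_subset_closedBall _ h)
  refine ⟨inr x y ε ⟨r, hr⟩, Or.inr ⟨_, h2.1, rfl⟩, ⟨_, h2.2, h3, rfl⟩, ?_, ?_⟩
  · change invert (ε : ℝ) (y.chart r) = w
    rw [h4, invert_invert hε.ne']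
  · rw [rightChart_inr φ (q := ⟨r, hr⟩) h2.2]
    simp [← h4, y.chart.left_inv h1]

theorem link_neck_neck : SmoothLink (neckChart x y ε) (neckChart x y ε) := by
  intro c hc _
  refine ⟨id, contDiffAt_id, ?_⟩
  have ho : IsOpen (neckAnnulus n (ε : ℝ)) :=
    (isOpen_lt continuous_const continuous_norm).inter (isOpen_lt continuous_norm continuous_const)
  filter_upwards [ho.mem_nhds ((neckCoord_bijOn x y ε).mapsTo hc)] with w hw
  obtain ⟨c', h1, h2⟩ := (neckCoord_bijOn x y ε).surjOn hw
  exact ⟨c', h1, h1, h2, h2⟩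

theorem smoothLink [T2Space M₁] [T2Space M₂] {e e' : PartialEquiv (ConnectedSum x y ε) (Eucl n)}
    (he : e ∈ chartFamily x y ε) (he' : e' ∈ chartFamily x y ε) : SmoothLink e e' := by
  have h1 {φ : OpenPartialHomeomorph M₁ (Eucl n)} (h : φ ∈ atlas (Eucl n) M₁) :=
    IsManifold.subset_maximalAtlas (I := 𝓡 n) (n := ∞) h
  have h2 {φ : OpenPartialHomeomorph M₂ (Eucl n)} (h : φ ∈ atlas (Eucl n) M₂) :=
    IsManifold.subset_maximalAtlas (I := 𝓡 n) (n := ∞) h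
  rcases he with rfl | ⟨φ, hφ, rfl⟩ | ⟨φ, hφ, rfl⟩ <;>
    rcases he' with rfl | ⟨φ', hφ', rfl⟩ | ⟨φ', hφ', rfl⟩
  · exact link_neck_neck
  · exact link_neck_left (h1 hφ')
  · exact link_neck_right (h2 hφ')
  · exact link_left_neck (h1 hφ)
  · exact link_left_left (h1 hφ) (h1 hφ')
  · rintro c ⟨q, hq, hs, rfl⟩ ⟨q', hq', hs', hc⟩
    exact absurd hc.symm (inl_ne_inr hq q')
  · exact link_right_neck (h2 hφ)
  · rintro c ⟨q, hq, hs, rfl⟩ ⟨q', hq', hs', hc⟩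
    exact absurd hc (inl_ne_inr hq' q)
  · exact link_right_right (h2 hφ) (h2 hφ')

variable (x y ε) [T2Space M₁] [T2Space M₂]

/-- The smooth structure of the connected sum. -/
def core : ChartedSpaceCore (Eucl n) (ConnectedSum x y ε) where
  atlas := chartFamily x y ε
  chartAt := preferredChart x y ε
  mem_chart_source := mem_preferredChart x y ε
  chart_mem_atlas := preferredChart_mem x y ε
  open_source _ _ he he' := (smoothLink he he').isOpen
  continuousOn_toFun _ _ he he' := (smoothLink he he').contDiffOn.continuousOn

instance : TopologicalSpace (ConnectedSum x y ε) := (core x y ε).toTopologicalSpace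

instance : ChartedSpace (Eucl n) (ConnectedSum x y ε) := (core x y ε).toChartedSpace

instance : IsManifold (𝓡 n) ∞ (ConnectedSum x y ε) := by
  refine isManifold_of_contDiffOn _ _ _ ?_
  intro e e' he he'
  obtain ⟨f, hf, rfl⟩ : ∃ f, ∃ hf : f ∈ chartFamily x y ε,
      e = (core x y ε).openPartialHomeomorph f hf := by
    change e ∈ ⋃ (f : _) (hf : f ∈ chartFamily x y ε), {_} at he
    simpa using he
  obtain ⟨f', hf', rfl⟩ : ∃ f, ∃ hf : f ∈ chartFamily x y ε,
      e' = (core x y ε).openPartialHomeomorph f hf := by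
    change e' ∈ ⋃ (f : _) (hf : f ∈ chartFamily x y ε), {_} at he'
    simpa using he'
  have := (smoothLink hf hf').contDiffOn
  simp only [modelWithCornersSelf_coe, modelWithCornersSelf_coe_symm, range_id, inter_univ,
    preimage_id, Function.id_comp, Function.comp_id]
  exact this

end ConnectedSum
end ConnectedSum

/-! ### The Schouten tensor and the cones `Γ⁺ₘ` -/

section Curvature

variable {n : ℕ}

/-- Bilinear forms on `ℝⁿ`. -/
abbrev BilinForm (n : ℕ) : Type := Eucl n →L[ℝ] Eucl n →L[ℝ] ℝ

/-- The Christoffel symbols of the metric `G = G_{ab} dz^a dz^b` on a domain of `ℝⁿ`: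
`G(Γ(u, v), w) = ½ (∂_u G(v, w) + ∂_v G(u, w) - ∂_w G(u, v))`. -/
def christoffel (G : Eucl n → BilinForm n) (z u v : Eucl n) : Eucl n :=
  (G z).inverse ((1 / 2 : ℝ) •
    (fderiv ℝ G z u v + fderiv ℝ G z v u - ((fderiv ℝ G z).flip u).flip v))

/-- The Riemann tensor `R(u, v) w = ∇_u ∇_v w - ∇_v ∇_u w` (constant coordinate fields). -/
def riemann (G : Eucl n → BilinForm n) (z u v w : Eucl n) : Eucl n :=
  fderiv ℝ (fun z' => christoffel G z' v w) z u - fderiv ℝ (fun z' => christoffel G z' u w) z v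
    + christoffel G z u (christoffel G z v w) - christoffel G z v (christoffel G z u w)

/-- The `i`-th coordinate vector. -/
abbrev coordVec (n : ℕ) (i : Fin n) : Eucl n := EuclideanSpace.single i 1

/-- The matrix of the metric. -/
def metricMatrix (G : Eucl n → BilinForm n) (z : Eucl n) : Matrix (Fin n) (Fin n) ℝ :=
  Matrix.of fun a b => G z (coordVec n a) (coordVec n b)

/-- The matrix of the Ricci tensor `Ric(v, w) = tr (u ↦ R(u, v) w)`. -/
def ricciMatrix (G : Eucl n → BilinForm n) (z : Eucl n) : Matrix (Fin n) (Fin n) ℝ :=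
  Matrix.of fun a b => ∑ i, riemann G z (coordVec n i) (coordVec n a) (coordVec n b) i

/-- The scalar curvature. -/
def scalarCurv (G : Eucl n → BilinForm n) (z : Eucl n) : ℝ :=
  ((metricMatrix G z)⁻¹ * ricciMatrix G z).trace

/-- The matrix of the Schouten tensor `A = (Ric - R / (2 (n - 1)) G) / (n - 2)`. -/
def schoutenMatrix (G : Eucl n → BilinForm n) (z : Eucl n) : Matrix (Fin n) (Fin n) ℝ :=
  (1 / ((n : ℝ) - 2)) •
    (ricciMatrix G z - (scalarCurv G z / (2 * ((n : ℝ) - 1))) • metricMatrix G z)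

/-- `σ_j(G⁻¹ A)`: the `j`-th elementary symmetric function of the eigenvalues of `G⁻¹ A`, counted
with multiplicity. -/
def sigmaCoord (G : Eucl n → BilinForm n) (j : ℕ) (z : Eucl n) : ℝ :=
  ((metricMatrix G z)⁻¹ * schoutenMatrix G z).charpoly.roots.esymm j

variable {M : Type*} [TopologicalSpace M] [ChartedSpace (Eucl n) M]

/-- Fields of bilinear forms on the tangent spaces. -/
abbrev TensorField (n : ℕ) (M : Type*) [TopologicalSpace M] [ChartedSpace (Eucl n) M] : Type _ :=
  ∀ q : M, TangentSpace (𝓡 n) q →L[ℝ] TangentSpace (𝓡 n) q →L[ℝ] ℝ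

/-- The pull-back `(f^* g)_c (u, v) = g_{f(c)} (df_c u, df_c v)`. -/
def pullbackForm {N : Type*} [TopologicalSpace N] [ChartedSpace (Eucl n) N] (f : N → M)
    (g : TensorField n M) : TensorField n N := fun c =>
  let B : BilinForm n := g (f c)
  let L : Eucl n →L[ℝ] Eucl n := mfderiv (𝓡 n) (𝓡 n) f c
  B.bilinearComp L L

/-- The coefficients of `g` in the chart `e`. -/
def coordForm (g : TensorField n M) (e : OpenPartialHomeomorph M (Eucl n)) :
    Eucl n → BilinForm n := fun z => pullbackForm e.symm g z

/-- Smooth Riemannian metrics on `M`. -/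
abbrev SmoothMetric (n : ℕ) (M : Type*) [TopologicalSpace M] [ChartedSpace (Eucl n) M]
    [IsManifold (𝓡 n) ∞ M] : Type _ :=
  Bundle.ContMDiffRiemannianMetric (𝓡 n) ∞ (Eucl n) (fun q : M => TangentSpace (𝓡 n) q)

variable [IsManifold (𝓡 n) ∞ M]

/-- The `σ_j`-curvature `σ_j(g⁻¹ A_g)` at the point `q`. -/
def sigmaCurvature (g : SmoothMetric n M) (j : ℕ) (q : M) : ℝ :=
  sigmaCoord (coordForm g.inner (chartAt (Eucl n) q)) j (chartAt (Eucl n) q q)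

/-- `g ∈ Γ⁺ₘ`, that is, `g` is `m`-admissible. -/
def IsAdmissible (m : ℕ) (g : SmoothMetric n M) : Prop :=
  ∀ j, 1 ≤ j → j ≤ m → ∀ q : M, 0 < sigmaCurvature g j q

end Curvature

/-! ### The approximate solution -/

section ApproximateSolution

variable {n : ℕ}

/-- The Euclidean metric. -/
def euclForm (n : ℕ) : BilinForm n := innerSL ℝ

/-- `G` is the coordinate expression of a metric in geodesic normal coordinates on the unit ball:
orthonormal at the origin, and every radial line `s ↦ s v` is a geodesic. These are exactly the
coordinates given by the exponential map and an identification of the tangent space with `ℝⁿ`. -/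
def IsNormalForm (G : Eucl n → BilinForm n) : Prop :=
  G 0 = euclForm n ∧
    ∀ v : Eucl n, ‖v‖ = 1 → ∀ s ∈ Icc (0 : ℝ) 1, christoffel G (s • v) v v = 0

/-- `G` is the coordinate expression of a metric which is conformally flat on the unit ball, in
coordinates in which `G = (1 + O(|z|²)) dz²`. -/
def IsConformallyFlatForm (G : Eucl n → BilinForm n) : Prop :=
  ∃ c : Eucl n → ℝ, (∀ z ∈ Metric.closedBall (0 : Eucl n) 1, G z = (1 + c z) • euclForm n) ∧
    c =O[𝓝 0] fun z => ‖z‖ ^ 2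

/-- Smooth non-increasing `f : ℝ → [0, 1]` which is `1` on `(-∞, -1]` and `0` on `[b, ∞)`. -/
def IsCutoff (f : ℝ → ℝ) (b : ℝ) : Prop :=
  ContDiff ℝ ∞ f ∧ Antitone f ∧ (∀ t, f t ∈ Icc (0 : ℝ) 1) ∧ (∀ t ≤ -1, f t = 1) ∧
    ∀ t, b ≤ t → f t = 0

variable (n) (k : ℕ) (η χ₀ : ℝ → ℝ) (ε : ℝ)

/-- `(n - 2k) / (2k)`. -/
def weight : ℝ := ((n : ℝ) - 2 * k) / (2 * k)

/-- The exponent `4k / (n - 2k)` of the conformal factors. -/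
def confExp : ℝ := 4 * k / ((n : ℝ) - 2 * k)

/-- `u₁ = ε^{(n-2k)/(2k)} e^{-(n-2k)/(2k) t}`. -/
def u₁ (t : ℝ) : ℝ := ε ^ weight n k * Real.exp (-(weight n k * t))

/-- `u₂ = ε^{(n-2k)/(2k)} e^{(n-2k)/(2k) t}`. -/
def u₂ (t : ℝ) : ℝ := ε ^ weight n k * Real.exp (weight n k * t)

/-- The cut-off `χ`, which is `1` for `t ≤ -log ε - 1` and vanishes from `t = -log ε` on. -/
def cutChi (t : ℝ) : ℝ := χ₀ (t + Real.log ε)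

/-- `u_ε = χ(t) u₁ + χ(-t) u₂`. -/
def uApprox (t : ℝ) : ℝ := cutChi χ₀ ε t * u₁ n k ε t + cutChi χ₀ ε (-t) * u₂ n k ε t

variable {n}

/-- The cylindrical coordinate `t = log ε - log |z|`. -/
def neckTime (z : Eucl n) : ℝ := Real.log ε - Real.log ‖z‖

/-- The cylindrical metric `g_cyl = dt² + dθ² = |z|⁻² dz²`. -/
def cylForm (z : Eucl n) : BilinForm n := (‖z‖ ^ 2)⁻¹ • euclForm n

/-- The remainder `a⁽¹⁾`, defined by `g₁ = u₁^{4k/(n-2k)} (g_cyl + a⁽¹⁾)`; here `G₁` is the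
expression of `g₁` in the coordinates `x = z`. -/
def remainder₁ (G₁ : Eucl n → BilinForm n) (z : Eucl n) : BilinForm n :=
  (u₁ n k ε (neckTime ε z) ^ confExp n k)⁻¹ • G₁ z - cylForm z

/-- The remainder `a⁽²⁾`, defined by `g₂ = u₂^{4k/(n-2k)} (g_cyl + a⁽²⁾)`; here `G₂` is the
expression of `g₂` in the coordinates `y = ε² z / |z|²`. -/
def remainder₂ (G₂ : Eucl n → BilinForm n) (z : Eucl n) : BilinForm n :=
  (u₂ n k ε (neckTime ε z) ^ confExp n k)⁻¹ •
    (G₂ (ConnectedSum.invert ε z)).bilinearComp (fderiv ℝ (ConnectedSum.invert ε) z)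
      (fderiv ℝ (ConnectedSum.invert ε) z) - cylForm z

/-- The approximate solution on the neck, in the neck coordinate `z`:
`u_ε^{4k/(n-2k)} (g_cyl + η a⁽¹⁾ + (1 - η) a⁽²⁾)`. -/
def neckForm (G₁ G₂ : Eucl n → BilinForm n) (z : Eucl n) : BilinForm n :=
  uApprox n k χ₀ ε (neckTime ε z) ^ confExp n k •
    (cylForm z + η (neckTime ε z) • remainder₁ k ε G₁ z +
      (1 - η (neckTime ε z)) • remainder₂ k ε G₂ z)

variable {M₁ M₂ : Type*}
  [TopologicalSpace M₁] [T2Space M₁] [ChartedSpace (Eucl n) M₁] [IsManifold (𝓡 n) ∞ M₁]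
  [TopologicalSpace M₂] [T2Space M₂] [ChartedSpace (Eucl n) M₂] [IsManifold (𝓡 n) ∞ M₂]
  [NeZero n]

open Classical in
/-- The approximate solution `g_ε` on `M_ε`: the metric above on the neck, and `g_i` on
`M_i \ B(p_i, 1)`. -/
def approxSolution (g₁ : SmoothMetric n M₁) (g₂ : SmoothMetric n M₂) (x : UnitBallChart n M₁)
    (y : UnitBallChart n M₂) (ε : Ioo (0 : ℝ) 1) : TensorField n (ConnectedSum x y ε) := fun c =>
  if c ∈ ConnectedSum.neck x y ε then
    pullbackForm (M := Eucl n) (ConnectedSum.neckCoord x y ε)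
      (neckForm k η χ₀ ε (coordForm g₁.inner x.chart) (coordForm g₂.inner y.chart)) c
  else if c ∈ range (ConnectedSum.inl x y ε) then
    pullbackForm (ConnectedSum.projLeft x y ε) g₁.inner c
  else pullbackForm (ConnectedSum.projRight x y ε) g₂.inner c

variable {M : Type*} [TopologicalSpace M] [ChartedSpace (Eucl n) M] [IsManifold (𝓡 n) ∞ M]

/-- Quantitative control of the metric on the closed unit ball: its coefficients are bounded by `Λ`
in `C²`, its eigenvalues are at least `1 / Λ`, and `σ_j ≥ δ` for `1 ≤ j ≤ m`. -/
structure GeometryBound (m : ℕ) (g : SmoothMetric n M) (x : UnitBallChart n M) (Λ δ : ℝ) :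
    Prop where
  norm_le : ∀ i ≤ 2, ∀ z ∈ Metric.closedBall (0 : Eucl n) 1,
    ‖iteratedFDeriv ℝ i (coordForm g.inner x.chart) z‖ ≤ Λ
  elliptic : ∀ z ∈ Metric.closedBall (0 : Eucl n) 1, ∀ v : Eucl n,
    ‖v‖ ^ 2 ≤ Λ * coordForm g.inner x.chart z v v
  sigma_ge : ∀ j, 1 ≤ j → j ≤ m → ∀ q ∈ x.closedBall 1, δ ≤ sigmaCurvature g j q

/-- The coordinates in which the connected sum is performed: geodesic normal coordinates or, where
`g` is conformally flat, coordinates in which it is `(1 + O(|z|²)) dz²`. -/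
def IsGluingChart (g : SmoothMetric n M) (x : UnitBallChart n M) : Prop :=
  IsNormalForm (coordForm g.inner x.chart) ∨ IsConformallyFlatForm (coordForm g.inner x.chart)

end ApproximateSolution

end

/-!
# Admissibility of the approximate solution on a connected sum

Write `m = k - 1` and `w = (n - 2k) / (2k)`. In the coordinate `z = x` on the first half of the neck,
`u₁ ^ {2/w} = |z|²` and `u₂ / u₁ = ρ := (ε / |z|) ^ {2w}`, so that the approximate solution is
`(1 + χ(-t) ρ) ^ {2/w} · G`, where `G = η g₁ + (1 - η) g₂'` and `g₂'` is `g₂` in the inverted coordinate,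
rescaled to be close to the flat metric `δ` (`neckForm_eq`). Since `1 + ρ` is the solution of
Schwarzschild type, the Schouten tensor of `(1 + ρ) ^ {2/w} δ` is `s (δ - (n / k) dr²)` with `s > 0`: its
`σ_k` vanishes, and it lies in the open cone `Γ⁺ₘ`.

The algebraic heart is the stability of the cone (`esymm_pos_add`): if `A ∈ Γ⁺ₘ` and
`B ≥ c (g - (n / m) ℓ ⊗ ℓ)` with `|ℓ| ≤ 1` and `c ≥ 0`, then `A + B ∈ Γ⁺ₘ`. Indeed `σ_j` does not decrease
along the segment from `A` to `A + B`, because by Newton's inequalities no `∂σ_j / ∂λ_i` exceeds `m / n`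
times the sum of all of them. As `n / k < n / m`, the tensor `s (δ - (n / k) dr²)` satisfies the
hypothesis on `B` with room to spare, and the room absorbs the deviation of `G` from the flat metric,
which is `O(|z|²)` in a gluing chart, with derivative `O(|z|)`.

By the conformal change of the Schouten tensor (`MetricNear.schoutenMatrix_conf`), positivity on the
first half of the neck (`exists_neckForm_pos`) then holds in each of three regions: near `|z| = 1` the
factor is `C²`-close to `1`, and a compactness argument on the space of `2`-jets applies
(`exists_conf_perturb`); for `ε e < |z|` small, `G = g₁` and the stability of the cone applies to the
Schouten tensor of `g₁`; for `|z|` comparable to `ε`, where the two metrics are glued, the Schouten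
tensor of `G` is merely bounded, but `s` is of order `ε⁻²` and dominates it. The compactness
arguments use only `Λ` and `δ`, so the bound on `ε` depends on nothing else. The inversion
`z ↦ ε² z / |z|²` exchanges the two halves of the neck (`neckForm_mirror`).

It remains to pass to the manifold: the `σ_j` do not depend on the coordinates
(`LocalDiffeo.sigmaCoord_pullMetric`), and along the unit spheres the approximate solution is smooth
because the formula on the neck gives back `g_i` there (`neckForm_of_one_le`).
-/

/-! ### Newton's inequalities -/

section NewtonInequality

set_option maxSynthPendingDepth 3

open Polynomial

/-- The Cauchy–Schwarz inequality for a sum over a multiset. -/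
theorem Multiset.sq_sum_le (s : Multiset ℝ) : s.sum ^ 2 ≤ card s * (s.map fun a => a ^ 2).sum := by
  induction s using Multiset.induction with
  | empty => simp
  | cons a s ih =>
    simp only [map_cons, sum_cons, card_cons, Nat.cast_add, Nat.cast_one]
    have hQ : 0 ≤ (s.map fun a => a ^ 2).sum := sum_nonneg fun b hb => by
      obtain ⟨c, -, rfl⟩ := mem_map.1 hb
      positivity
    set S := s.sum
    set Q := (s.map fun a => a ^ 2).sum
    rcases Nat.eq_zero_or_pos (card s) with h | h
    · rw [h, Nat.cast_zero, zero_mul] at ih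
      have hS : S = 0 := by nlinarith
      rw [hS, h]
      nlinarith
    · have hN : (0 : ℝ) < card s := by exact_mod_cast h
      have : 2 * a * S ≤ a ^ 2 * card s + Q := by
        refine le_of_mul_le_mul_left ?_ hN
        nlinarith [sq_nonneg (a * card s - S)]
      nlinarith

theorem Polynomial.Splits.derivative_real {p : ℝ[X]} (hp : p.Splits) : p.derivative.Splits := by
  rcases eq_or_ne p.derivative 0 with h0 | h0
  · rw [h0]; exact Splits.zero
  have hd : p.natDegree ≠ 0 := fun h => h0 (derivative_of_natDegree_zero h)
  rw [splits_iff_card_roots] at hp ⊢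
  have h1 := card_roots_le_derivative p
  have h2 := p.derivative.card_roots'
  have h3 := natDegree_derivative_lt hd
  omega

/-- **Laguerre's inequality** at the origin: a consequence of the Cauchy–Schwarz inequality for the
reciprocals of the roots. -/
theorem Polynomial.Splits.laguerre {p : ℝ[X]} (hp : p.Splits) (hd : 1 ≤ p.natDegree) :
    (p.natDegree : ℝ) * (p.eval 0 * p.derivative.derivative.eval 0) ≤
      (p.natDegree - 1) * p.derivative.eval 0 ^ 2 := by
  have hd' : (1 : ℝ) ≤ p.natDegree := by exact_mod_cast hd
  by_cases h0 : p.eval 0 = 0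
  · rw [h0, zero_mul, mul_zero]
    exact mul_nonneg (by linarith) (sq_nonneg _)
  -- The sum of `s` is `p' / p` at `0`, and minus the sum of the squares of `s` is `(p' / p)'`.
  set s : Multiset ℝ := p.roots.map fun z => 1 / (0 - z) with hs
  have hcard : Multiset.card s = p.natDegree := by
    rw [hs, Multiset.card_map, splits_iff_card_roots.1 hp]
  have hne : ∀ᶠ x in 𝓝 (0 : ℝ), p.eval x ≠ 0 := p.continuous.continuousAt.eventually_ne h0
  have hev : (fun x => p.derivative.eval x) =ᶠ[𝓝 0]
      fun x => p.eval x * (p.roots.map fun z => 1 / (x - z)).sum :=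
    hne.mono fun x hx => hp.eval_derivative_eq_eval_mul_sum hx
  have hroot : ∀ z ∈ p.roots, z ≠ 0 := by
    rintro z hz rfl
    exact h0 (isRoot_of_mem_roots hz)
  have hsum : HasDerivAt (fun x => (p.roots.map fun z => 1 / (x - z)).sum)
      (-(s.map fun a => a ^ 2).sum) 0 := by
    have key : ∀ r : Multiset ℝ, (∀ z ∈ r, z ≠ 0) →
        HasDerivAt (fun x : ℝ => (r.map fun z => 1 / (x - z)).sum)
          (-((r.map fun z => 1 / (0 - z)).map fun a => a ^ 2).sum) 0 := by
      intro r
      induction r using Multiset.induction with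
      | empty => intro _; simpa using hasDerivAt_const (0 : ℝ) (0 : ℝ)
      | cons a r ih =>
        intro h
        have ha : a ≠ 0 := h a (by simp)
        have h1 := ih fun z hz => h z (by simp [hz])
        have h2 : HasDerivAt (fun x : ℝ => 1 / (x - a)) (-(1 / (0 - a)) ^ 2) 0 := by
          have := ((hasDerivAt_id (0 : ℝ)).sub_const a).inv (by simpa using ha)
          refine (this.congr_deriv ?_).congr_of_eventuallyEq (Eventually.of_forall fun x => ?_)
          · simp only [id]; field_simp
          · simp
        simp only [Multiset.map_cons, Multiset.sum_cons, neg_add]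
        simpa using h2.fun_add h1
    exact key _ hroot
  have hder : p.derivative.derivative.eval 0 =
      p.derivative.eval 0 * s.sum + p.eval 0 * -(s.map fun a => a ^ 2).sum :=
    (p.derivative.hasDerivAt 0).unique
      (((p.hasDerivAt 0).mul hsum).congr_of_eventuallyEq hev)
  have hfst : p.derivative.eval 0 = p.eval 0 * s.sum := hev.self_of_nhds
  have hcs : s.sum ^ 2 ≤ p.natDegree * (s.map fun a => a ^ 2).sum := by
    rw [← hcard]
    exact s.sq_sum_le
  rw [hder, hfst]
  have := mul_le_mul_of_nonneg_left hcs (sq_nonneg (p.eval 0))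
  nlinarith

/-- **Newton's inequality** for the elementary symmetric functions of real numbers. -/
theorem Multiset.newton (s : Multiset ℝ) (k : ℕ) (hk : k + 2 ≤ card s) :
    ((k : ℝ) + 2) * (card s - k) * (s.esymm k * s.esymm (k + 2)) ≤
      (k + 1) * (card s - k - 1) * s.esymm (k + 1) ^ 2 := by
  obtain ⟨i, hi⟩ := Nat.exists_eq_add_of_le hk
  set p : ℝ[X] := (s.map fun r => X + C r).prod with hp
  have hmonic : p.Monic := monic_multiset_prod_of_monic _ _ fun a _ => monic_X_add_C a
  have hdeg : p.natDegree = card s := by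
    rw [hp, natDegree_multiset_prod_of_monic]
    · simp
    · intro f hf
      obtain ⟨a, -, rfl⟩ := Multiset.mem_map.1 hf
      exact monic_X_add_C a
  have hspl : p.Splits := by
    refine Splits.multisetProd fun f hf => ?_
    obtain ⟨a, -, rfl⟩ := Multiset.mem_map.1 hf
    exact Splits.X_add_C a
  -- Differentiating `∏ (X + a)` `card s - k - 2` times leaves a real-rooted polynomial of degree
  -- `k + 2`, whose coefficients of lowest degree are multiples of `e_{k+2}`, `e_{k+1}`, `e_k`.
  set q := derivative^[i] p with hq
  have hqs : q.Splits := by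
    rw [hq]
    clear_value q
    clear hq
    induction i generalizing p with
    | zero => exact hspl
    | succ i _ =>
      have : ∀ j, (derivative^[j] p).Splits := by
        intro j
        induction j with
        | zero => exact hspl
        | succ j ih => rw [Function.iterate_succ_apply']; exact ih.derivative_real
      exact this _
  have hqd : q.natDegree = k + 2 := by
    have : ∀ j, (derivative^[j] p).natDegree = card s - j := by
      intro j
      induction j with
      | zero => simpa using hdeg
      | succ j ih => rw [Function.iterate_succ_apply', natDegree_derivative, ih]; omega
    rw [hq, this]; omega
  have hcoe : ∀ j, (derivative^[j] p).eval 0 = j.factorial * p.coeff j := by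
    intro j
    rw [← coeff_zero_eq_eval_zero, coeff_iterate_derivative]
    simp [Nat.descFactorial_self]
  have e0 : q.eval 0 = i.factorial * s.esymm (k + 2) := by
    rw [hq, hcoe, hp, Multiset.prod_X_add_C_coeff _ (by omega)]
    congr 2; omega
  have e1 : q.derivative.eval 0 = (i + 1).factorial * s.esymm (k + 1) := by
    rw [hq, ← Function.iterate_succ_apply' derivative, hcoe, hp, Multiset.prod_X_add_C_coeff _ (by omega)]
    congr 2; omega
  have e2 : q.derivative.derivative.eval 0 = (i + 2).factorial * s.esymm k := by
    rw [hq, ← Function.iterate_succ_apply' derivative, ← Function.iterate_succ_apply' derivative, hcoe, hp,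
      Multiset.prod_X_add_C_coeff _ (by omega)]
    congr 2; omega
  have h := hqs.laguerre (by omega)
  rw [e0, e1, e2, hqd] at h
  have hf : (0 : ℝ) < i.factorial := by exact_mod_cast i.factorial_pos
  simp only [Nat.factorial_succ] at h
  rw [hi]
  push_cast at h ⊢
  have hi0 : (0 : ℝ) ≤ i := i.cast_nonneg
  refine le_of_mul_le_mul_left ?_ (show (0 : ℝ) < i.factorial ^ 2 * (i + 1) by positivity)
  nlinarith

/-- The weak form of Newton's inequality. -/
theorem Multiset.esymm_mul_esymm_le_sq (s : Multiset ℝ) (k : ℕ) :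
    s.esymm k * s.esymm (k + 2) ≤ s.esymm (k + 1) ^ 2 := by
  rcases lt_or_ge (card s) (k + 2) with h | h
  · have : s.esymm (k + 2) = 0 := by
      simp [Multiset.esymm, Multiset.powersetCard_eq_empty _ h]
    rw [this, mul_zero]; positivity
  by_contra! hlt
  have hN := s.newton k h
  have h' : (k : ℝ) + 2 ≤ card s := by exact_mod_cast h
  have hk : (0 : ℝ) ≤ k := k.cast_nonneg
  have h1 : 0 ≤ s.esymm (k + 1) ^ 2 := sq_nonneg _
  have h2 : ((k : ℝ) + 1) * (card s - k - 1) ≤ (k + 2) * (card s - k) := by nlinarith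
  have h3 : 0 < ((k : ℝ) + 2) * (card s - k) := by nlinarith
  have h4 := mul_lt_mul_of_pos_left hlt h3
  have h5 := mul_le_mul_of_nonneg_right h2 h1
  linarith

theorem Multiset.esymm_cons (a : ℝ) (s : Multiset ℝ) (j : ℕ) :
    (a ::ₘ s).esymm (j + 1) = a * s.esymm j + s.esymm (j + 1) := by
  simp [Multiset.esymm, Multiset.powersetCard_cons, Multiset.sum_map_mul_left, add_comm]

theorem Multiset.esymm_zero' (s : Multiset ℝ) : s.esymm 0 = 1 := by
  simp [Multiset.esymm]

/-- Removing an entry from a vector of the cone `Γ_m` leaves a vector of `Γ_{m-1}`. -/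
theorem Multiset.esymm_pos_of_cons {a : ℝ} {s : Multiset ℝ} {m : ℕ}
    (h : ∀ j ≤ m, 0 < (a ::ₘ s).esymm j) : ∀ j, j + 1 ≤ m → 0 < s.esymm j := by
  intro j
  induction j with
  | zero => intro _; rw [esymm_zero']; exact one_pos
  | succ j ih =>
    intro hj
    have h0 := ih (by omega)
    by_contra! hneg
    have h1 := h (j + 1) (by omega)
    have h2 := h (j + 2) hj
    rw [esymm_cons] at h1 h2
    have h3 := s.esymm_mul_esymm_le_sq j
    have ha : 0 < a := by
      by_contra! ha
      nlinarith
    -- Multiplying `e_{j+2} > -a e_{j+1}` by `e_j` and `a e_j > -e_{j+1}` by `-e_{j+1}` gives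
    -- `e_j e_{j+2} > e_{j+1}²`, against Newton's inequality.
    have h4 : 0 < s.esymm (j + 2) := by nlinarith
    nlinarith [mul_pos h0 h4]

/-- The quantitative monotonicity of `σ_j` in the cone `Γ_j`: no partial derivative exceeds `j / n`
times the sum of all of them. -/
theorem Multiset.card_mul_esymm_le {a : ℝ} {s : Multiset ℝ} {j : ℕ} (hjs : j ≤ card s)
    (h : ∀ i ≤ j + 1, 0 < (a ::ₘ s).esymm i) :
    ((card s : ℝ) + 1) * s.esymm j ≤ (j + 1) * ((card s + 1 - j) * (a ::ₘ s).esymm j) := by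
  have hpos := esymm_pos_of_cons h
  cases j with
  | zero => simp [esymm_zero']
  | succ j =>
    have h0 := hpos j (by omega)
    have h1 := hpos (j + 1) le_rfl
    have h2 := h (j + 2) le_rfl
    rw [esymm_cons] at h2 ⊢
    have hN : ((j : ℝ) + 2) * (card s - j) * (s.esymm j * s.esymm (j + 2)) ≤
      (j + 1) * (card s - j - 1) * s.esymm (j + 1) ^ 2 := by
      rcases lt_or_ge (card s) (j + 2) with h | h
      · have : s.esymm (j + 2) = 0 := by
          simp [Multiset.esymm, Multiset.powersetCard_eq_empty _ h]
        have h' : ((j : ℝ) + 1) ≤ card s := by exact_mod_cast hjs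
        have : 0 ≤ (card s : ℝ) - j - 1 := by linarith
        simp only [*, mul_zero]; positivity
      · exact s.newton j h
    have hc : (0 : ℝ) ≤ card s - j := by
      have : ((j : ℝ) + 1) ≤ card s := by exact_mod_cast hjs
      linarith
    refine le_of_mul_le_mul_right ?_ h1
    push_cast
    have h5 : 0 ≤ ((j : ℝ) + 2) * (card s - j) * s.esymm j *
        (a * s.esymm (j + 1) + s.esymm (j + 2)) := by positivity
    nlinarith

end NewtonInequality

/-! ### Sums of principal minors and their derivatives -/

section Minors

set_option maxSynthPendingDepth 3

open Polynomial Matrix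

variable {ι : Type*} [Fintype ι] [DecidableEq ι]

/-- The sum of the principal minors of order `j`, that is, `σ_j` of the eigenvalues. -/
noncomputable def minorSum (j : ℕ) (M : Matrix ι ι ℝ) : ℝ :=
  ∑ s ∈ Finset.univ.powersetCard j, (M.submatrix (Subtype.val : s → ι) Subtype.val).det

theorem minorSum_eq_coeff {j : ℕ} (hj : j ≤ Fintype.card ι) (M : Matrix ι ι ℝ) :
    minorSum j M = (-1) ^ j * M.charpoly.coeff (Fintype.card ι - j) := by
  rw [charpoly_coeff_eq_sum_minors M j hj, ← mul_assoc, ← mul_pow]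
  simp [minorSum]

/-- The elementary symmetric functions of the eigenvalues are the sums of principal minors. Without the
hypothesis that the characteristic polynomial splits, its roots would be too few. -/
theorem esymm_roots_charpoly {j : ℕ} (hj : j ≤ Fintype.card ι) {M : Matrix ι ι ℝ}
    (hM : M.charpoly.Splits) : M.charpoly.roots.esymm j = minorSum j M := by
  rw [minorSum_eq_coeff hj, coeff_eq_esymm_roots_of_splits hM (by simp),
    M.charpoly_monic.leadingCoeff, M.charpoly_natDegree_eq_dim, Nat.sub_sub_self hj, one_mul,
    ← mul_assoc, ← mul_pow]
  simp

theorem continuous_minorSum (j : ℕ) : Continuous (minorSum j : Matrix ι ι ℝ → ℝ) := by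
  unfold minorSum
  fun_prop

theorem minorSum_diagonal (j : ℕ) (d : ι → ℝ) :
    minorSum j (diagonal d) = (Finset.univ.val.map d).esymm j := by
  rw [Finset.esymm_map_val, minorSum]
  refine Finset.sum_congr rfl fun s _ => ?_
  rw [submatrix_diagonal _ _ Subtype.val_injective, det_diagonal]
  exact Finset.prod_coe_sort s d

/-- Jacobi's formula at a diagonal matrix, without assuming it to be invertible. -/
theorem hasDerivAt_det_diagonal {κ : Type*} [Fintype κ] [DecidableEq κ] (d : κ → ℝ)
    (E : Matrix κ κ ℝ) :
    HasDerivAt (fun h : ℝ => (diagonal d + h • E).det)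
      (∑ i, E i i * ∏ l ∈ Finset.univ.erase i, d l) 0 := by
  have h1 : ∀ (σ : Equiv.Perm κ), HasDerivAt
      (fun h : ℝ => ((Equiv.Perm.sign σ : ℤ) : ℝ) * ∏ i, (diagonal d + h • E) (σ i) i)
      (((Equiv.Perm.sign σ : ℤ) : ℝ) * ∑ i, (∏ l ∈ Finset.univ.erase i, diagonal d (σ l) l) *
        E (σ i) i) 0 := by
    intro σ
    have h2 : ∀ i ∈ (Finset.univ : Finset κ), HasDerivAt
        (fun h : ℝ => (diagonal d + h • E) (σ i) i) (E (σ i) i) 0 := by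
      intro i _
      simpa using ((hasDerivAt_id (0 : ℝ)).mul_const (E (σ i) i)).const_add (diagonal d (σ i) i)
    simpa using (HasDerivAt.fun_finsetProd h2).const_mul ((Equiv.Perm.sign σ : ℤ) : ℝ)
  have h3 := HasDerivAt.fun_sum fun σ (_ : σ ∈ (Finset.univ : Finset (Equiv.Perm κ))) => h1 σ
  have h4 : (fun h : ℝ => (diagonal d + h • E).det) = fun h => ∑ σ : Equiv.Perm κ,
      ((Equiv.Perm.sign σ : ℤ) : ℝ) * ∏ i, (diagonal d + h • E) (σ i) i := by
    ext h; rw [det_apply']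
  rw [h4]
  refine h3.congr_deriv (Eq.symm ?_)
  rw [Finset.sum_eq_single (1 : Equiv.Perm κ)]
  · simp only [Equiv.Perm.sign_one, Units.val_one, Int.cast_one, one_mul, Equiv.Perm.one_apply,
      diagonal_apply_eq]
    exact Finset.sum_congr rfl fun i _ => mul_comm _ _
  · intro σ _ hσ
    refine mul_eq_zero_of_right _ (Finset.sum_eq_zero fun i _ => ?_)
    -- A permutation other than the identity moves at least two points.
    obtain ⟨l, hl, hl'⟩ : ∃ l, l ≠ i ∧ σ l ≠ l := by
      by_contra! hcon
      refine hσ (Equiv.ext fun l => ?_)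
      by_cases hl : l = i
      · subst hl
        by_contra hne
        have := hcon (σ l) hne
        exact hne (σ.injective this)
      · exact hcon l hl
    exact mul_eq_zero_of_left (Finset.prod_eq_zero (f := fun l => diagonal d (σ l) l)
      (Finset.mem_erase.2 ⟨hl, Finset.mem_univ l⟩) (diagonal_apply_ne d hl')) _
  · intro h; exact absurd (Finset.mem_univ _) h

/-- At a diagonal matrix only the diagonal entries of the direction `E` matter, and `∂σ_{j+1} / ∂d_i` is
`σ_j` of the other entries. -/
theorem hasDerivAt_minorSum_diagonal (j : ℕ) (d : ι → ℝ) (E : Matrix ι ι ℝ) :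
    HasDerivAt (fun h : ℝ => minorSum (j + 1) (diagonal d + h • E))
      (∑ i, E i i * ((Finset.univ.erase i).val.map d).esymm j) 0 := by
  have h1 : ∀ s ∈ (Finset.univ : Finset ι).powersetCard (j + 1), HasDerivAt
      (fun h : ℝ => ((diagonal d + h • E).submatrix (Subtype.val : s → ι) Subtype.val).det)
      (∑ i ∈ s, E i i * ∏ l ∈ s.erase i, d l) 0 := by
    intro s _
    have h2 := hasDerivAt_det_diagonal (fun i : s => d i) (E.submatrix Subtype.val Subtype.val)
    refine (h2.congr_deriv ?_).congr_of_eventuallyEq (Eventually.of_forall fun h => ?_)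
    rotate_left
    · change Matrix.det _ = Matrix.det _
      congr 1
      ext a b
      by_cases hab : a = b
      · subst hab; simp
      · have : (a : ι) ≠ b := fun h => hab (Subtype.ext h)
        simp [diagonal_apply_ne _ hab, diagonal_apply_ne _ this]
    · rw [← Finset.sum_coe_sort s fun i => E i i * ∏ l ∈ s.erase i, d l]
      refine Finset.sum_congr rfl fun i _ => ?_
      congr 1
      refine Finset.prod_bij' (fun l _ => l.1) (fun l hl => ⟨l, (Finset.mem_erase.1 hl).2⟩)
        ?_ ?_ ?_ ?_ ?_
      · intro l hl
        exact Finset.mem_erase.2 ⟨fun h => (Finset.mem_erase.1 hl).1 (Subtype.ext h), l.2⟩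
      · intro l hl
        exact Finset.mem_erase.2 ⟨fun h => (Finset.mem_erase.1 hl).1 (congrArg Subtype.val h),
          Finset.mem_univ _⟩
      · intro l _; rfl
      · intro l _; rfl
      · intro l _; rfl
  have h3 := HasDerivAt.fun_sum h1
  refine h3.congr_deriv (Eq.symm ?_)
  -- Pairs of an index `i` and a set `t` of `j` other indices, against sets `s = insert i t` of `j + 1`
  -- indices with a marked element.
  simp only [Finset.esymm_map_val, Finset.mul_sum]
  rw [Finset.sum_sigma', Finset.sum_sigma']
  refine Finset.sum_bij' (fun p _ => ⟨insert p.1 p.2, p.1⟩) (fun p _ => ⟨p.2, p.1.erase p.2⟩)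
    ?_ ?_ ?_ ?_ ?_
  · rintro ⟨i, t⟩ h
    simp only [Finset.mem_sigma, Finset.mem_univ, true_and, Finset.mem_powersetCard] at h ⊢
    have hi : i ∉ t := fun hit => (Finset.mem_erase.1 (h.1 hit)).1 rfl
    exact ⟨⟨Finset.subset_univ _, by rw [Finset.card_insert_of_notMem hi, h.2]⟩,
      Finset.mem_insert_self _ _⟩
  · rintro ⟨s, i⟩ h
    simp only [Finset.mem_sigma, Finset.mem_univ, true_and, Finset.mem_powersetCard] at h ⊢
    exact ⟨Finset.erase_subset_erase _ (Finset.subset_univ _), by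
      rw [Finset.card_erase_of_mem h.2, h.1.2, Nat.add_sub_cancel]⟩
  · rintro ⟨i, t⟩ h
    simp only [Finset.mem_sigma, Finset.mem_univ, true_and, Finset.mem_powersetCard] at h
    have hi : i ∉ t := fun hit => (Finset.mem_erase.1 (h.1 hit)).1 rfl
    simp [hi]
  · rintro ⟨s, i⟩ h
    simp only [Finset.mem_sigma] at h
    simp [Finset.insert_erase h.2]
  · rintro ⟨i, t⟩ h
    simp only [Finset.mem_sigma, Finset.mem_univ, true_and, Finset.mem_powersetCard] at h
    have hi : i ∉ t := fun hit => (Finset.mem_erase.1 (h.1 hit)).1 rfl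
    simp [hi]

/-- Comparison of coefficients in the derivative of `∏ (X + d_i)`. -/
theorem sum_esymm_erase (j : ℕ) (hj : j + 1 ≤ Fintype.card ι) (d : ι → ℝ) :
    ∑ i, ((Finset.univ.erase i).val.map d).esymm j =
      ((Fintype.card ι : ℝ) - j) * (Finset.univ.val.map d).esymm j := by
  have h := congrArg (fun p : ℝ[X] => p.coeff (Fintype.card ι - 1 - j))
    (derivative_prod_finset (s := (Finset.univ : Finset ι)) (f := fun i => X + C (d i)))
  simp only [finsetSum_coeff] at h
  rw [coeff_derivative, Finset.prod_X_add_C_coeff _ _ (by simp; omega)] at h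
  simp only [derivative_add, derivative_X, derivative_C, add_zero, mul_one] at h
  have h1 : ∀ i ∈ (Finset.univ : Finset ι),
      (∏ l ∈ Finset.univ.erase i, (X + C (d l))).coeff (Fintype.card ι - 1 - j) =
        ((Finset.univ.erase i).val.map d).esymm j := by
    intro i _
    have hc : (Finset.univ.erase i).card = Fintype.card ι - 1 := by
      rw [Finset.card_erase_of_mem (Finset.mem_univ i), Finset.card_univ]
    rw [Finset.prod_X_add_C_coeff _ _ (by rw [hc]; omega), Finset.esymm_map_val, hc]
    congr 2; omega
  rw [Finset.sum_congr rfl h1] at h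
  rw [← h, Finset.esymm_map_val, Finset.card_univ,
    show Fintype.card ι - (Fintype.card ι - 1 - j + 1) = j by omega, mul_comm]
  congr 1
  have : Fintype.card ι - 1 - j + 1 + j = Fintype.card ι := by omega
  have : ((Fintype.card ι - 1 - j : ℕ) : ℝ) + 1 + j = Fintype.card ι := by exact_mod_cast this
  linarith

end Minors

/-! ### Adding to an element of the cone `Γ_m` -/

section Cone

set_option maxSynthPendingDepth 3

open Matrix

variable {ι : Type*} [Fintype ι] [DecidableEq ι]

theorem minorSum_conj {U V : Matrix ι ι ℝ} (h : V * U = 1) (j : ℕ) (hj : j ≤ Fintype.card ι)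
    (M : Matrix ι ι ℝ) : minorSum j (V * M * U) = minorSum j M := by
  rw [minorSum_eq_coeff hj, minorSum_eq_coeff hj, charpoly_mul_comm, ← mul_assoc,
    mul_eq_one_comm.1 h, one_mul]

/-- The derivative of `σ_j` along a direction `E` with `E ≥ c (1 - (n / m) e ⊗ e)`, `|e| ≤ 1`, is
nonnegative at the points of the cone `Γ_m`. -/
theorem exists_hasDerivAt_minorSum {m : ℕ} (hm : m ≤ Fintype.card ι) {A E : Matrix ι ι ℝ}
    (hA : A.IsHermitian) {c : ℝ} (hc : 0 ≤ c) {e : ι → ℝ}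
    (he : ∀ v : ι → ℝ, (e ⬝ᵥ v) ^ 2 ≤ v ⬝ᵥ v)
    (hE : ∀ v : ι → ℝ, c * (v ⬝ᵥ v - Fintype.card ι / m * (e ⬝ᵥ v) ^ 2) ≤ v ⬝ᵥ E *ᵥ v)
    (hpos : ∀ j ≤ m, 0 < minorSum j A) {j : ℕ} (hj : j + 1 ≤ m) :
    ∃ D, 0 ≤ D ∧ HasDerivAt (fun h : ℝ => minorSum (j + 1) (A + h • E)) D 0 := by
  set U : Matrix ι ι ℝ := hA.eigenvectorUnitary.1 with hU
  have hUU : star U * U = 1 := Unitary.coe_star_mul_self hA.eigenvectorUnitary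
  have hUU' : U * star U = 1 := Unitary.coe_mul_star_self hA.eigenvectorUnitary
  set d := hA.eigenvalues with hd
  have hdiag : star U * A * U = diagonal d := by
    have := hA.conjStarAlgAut_star_eigenvectorUnitary
    rw [Unitary.conjStarAlgAut_apply] at this
    simpa using this
  have hconj : ∀ h : ℝ, minorSum (j + 1) (A + h • E) =
      minorSum (j + 1) (diagonal d + h • (star U * E * U)) := by
    intro h
    rw [← minorSum_conj hUU (j + 1) (hj.trans hm) (A + h • E), ← hdiag]
    congr 1
    simp [mul_add, add_mul]
  have hpos' : ∀ i ≤ m, 0 < (Finset.univ.val.map d).esymm i := by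
    intro i hi
    rw [← minorSum_diagonal, ← hdiag, minorSum_conj hUU _ (hi.trans hm)]
    exact hpos i hi
  refine ⟨_, ?_, (hasDerivAt_minorSum_diagonal j d (star U * E * U)).congr_of_eventuallyEq
    (Eventually.of_forall hconj)⟩
  -- In an orthonormal basis of eigenvectors of `A`, the derivative is `∑ T_i E_{ii}` with
  -- `T_i = ∂σ_{j+1} / ∂d_i > 0`.
  set T : ι → ℝ := fun i => ((Finset.univ.erase i).val.map d).esymm j with hT
  have hcons : ∀ i, (Finset.univ.val.map d) = d i ::ₘ ((Finset.univ.erase i).val.map d) := by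
    intro i
    rw [← Multiset.map_cons, ← Finset.insert_val_of_notMem (Finset.notMem_erase i _),
      Finset.insert_erase (Finset.mem_univ i)]
  have hTpos : ∀ i, 0 < T i := fun i => Multiset.esymm_pos_of_cons (m := m)
    (fun l hl => by rw [← hcons i]; exact hpos' l hl) j hj
  have hn : (0 : ℝ) < Fintype.card ι := by exact_mod_cast (by omega : 0 < Fintype.card ι)
  have hm0 : (0 : ℝ) < m := by exact_mod_cast (by omega : 0 < m)
  have hsum := sum_esymm_erase j (hj.trans hm) d
  -- No `T_i` exceeds `m / n` times the sum, so the negative part of `E` is outweighed.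
  have hTle : ∀ i, (Fintype.card ι : ℝ) * T i ≤ m * ∑ l, T l := by
    intro i
    have hcard : Multiset.card ((Finset.univ.erase i).val.map d) + 1 = Fintype.card ι := by
      rw [← Multiset.card_cons, ← hcons i]; simp
    have h1 := Multiset.card_mul_esymm_le (a := d i) (s := (Finset.univ.erase i).val.map d) (j := j)
      (by omega) (fun l hl => by rw [← hcons i]; exact hpos' l (hl.trans hj))
    rw [← hcons i] at h1
    have hcard' : (Multiset.card ((Finset.univ.erase i).val.map d) : ℝ) + 1 = Fintype.card ι := by
      exact_mod_cast hcard
    rw [hcard', ← hsum] at h1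
    refine h1.trans (mul_le_mul_of_nonneg_right (by exact_mod_cast hj) ?_)
    exact Finset.sum_nonneg fun l _ => (hTpos l).le
  have hent : ∀ i, (star U * E * U) i i = (fun a => U a i) ⬝ᵥ E *ᵥ (fun a => U a i) := by
    intro i
    rw [mul_assoc]
    simp only [mul_apply, dotProduct, mulVec, star_apply, star_trivial]
  have hone : ∀ i, (fun a => U a i) ⬝ᵥ (fun a => U a i) = 1 := by
    intro i
    have := congrFun (congrFun hUU i) i
    simpa [mul_apply, dotProduct, star_apply] using this
  have hbess : ∑ i, (e ⬝ᵥ fun a => U a i) ^ 2 ≤ 1 := by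
    -- The sum is `|Uᵀ e|² = |e|²`, and `|e|² ≤ 1` follows from the hypothesis with `v = e`.
    have h1 : ∀ i, (e ⬝ᵥ fun a => U a i) = (e ᵥ* U) i := fun i => rfl
    have h2 : ∑ i, (e ⬝ᵥ fun a => U a i) ^ 2 = e ⬝ᵥ e := by
      simp_rw [h1, pow_two]
      change (e ᵥ* U) ⬝ᵥ (e ᵥ* U) = _
      have : e ᵥ* U = star U *ᵥ e := by
        rw [star_eq_conjTranspose, conjTranspose_eq_transpose_of_trivial, mulVec_transpose]
      nth_rewrite 2 [this]
      rw [← dotProduct_mulVec, mulVec_mulVec, hUU', one_mulVec]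
    rw [h2]
    have h3 := he e
    have h4 : 0 ≤ e ⬝ᵥ e := Finset.sum_nonneg fun i _ => mul_self_nonneg _
    nlinarith
  have hterm : ∀ i, c * (T i - Fintype.card ι / m * (e ⬝ᵥ fun a => U a i) ^ 2 * T i) ≤
      (star U * E * U) i i * T i := by
    intro i
    have h1 := hE fun a => U a i
    rw [hone, ← hent] at h1
    have := mul_le_mul_of_nonneg_right h1 (hTpos i).le
    linarith
  refine le_trans ?_ (Finset.sum_le_sum fun i _ => hterm i)
  rw [← Finset.mul_sum, Finset.sum_sub_distrib]
  refine mul_nonneg hc (sub_nonneg.2 ?_)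
  have h5 : ∀ i ∈ Finset.univ, Fintype.card ι / m * (e ⬝ᵥ fun a => U a i) ^ 2 * T i ≤
      (e ⬝ᵥ fun a => U a i) ^ 2 * ∑ l, T l := by
    intro i _
    have h6 : (Fintype.card ι : ℝ) / m * T i ≤ ∑ l, T l := by
      rw [div_mul_eq_mul_div, div_le_iff₀ hm0, mul_comm _ (m : ℝ)]; exact hTle i
    have := mul_le_mul_of_nonneg_left h6 (sq_nonneg (e ⬝ᵥ fun a => U a i))
    linarith
  refine (Finset.sum_le_sum h5).trans ?_
  rw [← Finset.sum_mul]
  exact mul_le_of_le_one_left (Finset.sum_nonneg fun l _ => (hTpos l).le) hbess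

/-- If `A ∈ Γ_m` and `E ≥ c (1 - (n / m) e ⊗ e)` with `|e| ≤ 1`, then `A + E ∈ Γ_m`. -/
theorem minorSum_add_pos {m : ℕ} (hm : m ≤ Fintype.card ι) {A E : Matrix ι ι ℝ}
    (hA : A.IsHermitian) (hEh : E.IsHermitian) {c : ℝ} (hc : 0 ≤ c) {e : ι → ℝ}
    (he : ∀ v : ι → ℝ, (e ⬝ᵥ v) ^ 2 ≤ v ⬝ᵥ v)
    (hE : ∀ v : ι → ℝ, c * (v ⬝ᵥ v - Fintype.card ι / m * (e ⬝ᵥ v) ^ 2) ≤ v ⬝ᵥ E *ᵥ v)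
    (hpos : ∀ j ≤ m, 0 < minorSum j A) : ∀ j ≤ m, 0 < minorSum j (A + E) := by
  set f : ℕ → ℝ → ℝ := fun j h => minorSum j (A + h • E) with hf
  have hcont : ∀ j, Continuous (f j) := fun j => (continuous_minorSum j).comp (by fun_prop)
  have hderiv : ∀ h : ℝ, (∀ j ≤ m, 0 < f j h) → ∀ j, j + 1 ≤ m →
      ∃ D, 0 ≤ D ∧ HasDerivAt (f (j + 1)) D h := by
    intro h hh j hj
    obtain ⟨D, hD, hD'⟩ := exists_hasDerivAt_minorSum hm
      (hA.add (hEh.smul (IsSelfAdjoint.all h))) hc he hE hh hj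
    refine ⟨D, hD, ?_⟩
    have h1 : HasDerivAt (fun x => minorSum (j + 1) (A + h • E + (x - h) • E)) D h := by
      have h2 : HasDerivAt (fun x : ℝ => minorSum (j + 1) (A + h • E + x • E)) D (h - h) := by
        rwa [sub_self]
      simpa using h2.comp_sub_const h h
    refine h1.congr_of_eventuallyEq (Eventually.of_forall fun x => ?_)
    change minorSum _ _ = minorSum _ _
    congr 1
    rw [add_assoc, ← add_smul, add_sub_cancel]
  -- Continuous induction: `σ_j (A + h E) ≥ σ_j (A)` for all `h ∈ [0, 1]`.
  have hsub : Icc (0 : ℝ) 1 ⊆ {h | ∀ j ≤ m, f j 0 ≤ f j h} := by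
    have hclosed : IsClosed {h | ∀ j ≤ m, f j 0 ≤ f j h} := by
      simp only [Set.ofPred_forall]
      exact isClosed_iInter fun j => isClosed_iInter fun _ =>
        isClosed_le continuous_const (hcont j)
    refine (hclosed.inter isClosed_Icc).Icc_subset_of_forall_exists_gt (fun j _ => le_rfl) ?_
    rintro x ⟨hx, hx1⟩ y hy
    have hx0 : ∀ j ≤ m, 0 < f j x := fun j hj => by
      refine lt_of_lt_of_le ?_ (hx j hj)
      simpa [hf] using hpos j hj
    have hev : ∀ᶠ z in 𝓝 x, ∀ j ∈ Finset.range (m + 1), 0 < f j z := by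
      rw [Filter.eventually_all_finset]
      intro j hj
      exact (hcont j).continuousAt.eventually_const_lt (hx0 j (by simpa [Nat.lt_succ_iff] using hj))
    obtain ⟨δ, hδ, hball⟩ := Metric.eventually_nhds_iff.1 hev
    set z := min y (x + δ / 2) with hz
    have hxz : x < z := lt_min hy (by linarith)
    refine ⟨z, fun j hj => ?_, hxz, min_le_left _ _⟩
    rcases j with _ | j
    · have h0 : ∀ M : Matrix ι ι ℝ, minorSum 0 M = 1 := fun M => by simp [minorSum]
      simp [hf, h0]
    refine (hx _ hj).trans ?_
    have hin : ∀ t ∈ Icc x z, ∃ D, 0 ≤ D ∧ HasDerivAt (f (j + 1)) D t := by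
      intro t ht
      refine hderiv t (fun i hi => hball ?_ i (by simpa [Nat.lt_succ_iff] using hi)) j hj
      have := ht.2.trans (min_le_right _ _)
      rw [Real.dist_eq, abs_of_nonneg (by linarith [ht.1])]
      linarith
    -- On `[x, z]` the matrix is still in the cone, so the derivative is nonnegative.
    refine monotoneOn_of_deriv_nonneg (convex_Icc x z) (hcont _).continuousOn ?_ ?_
      (left_mem_Icc.2 hxz.le) (right_mem_Icc.2 hxz.le) hxz.le
    · intro t ht
      obtain ⟨D, -, hD⟩ := hin t (interior_subset ht)
      exact hD.differentiableAt.differentiableWithinAt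
    · intro t ht
      obtain ⟨D, hD0, hD⟩ := hin t (interior_subset ht)
      rw [hD.deriv]; exact hD0
  intro j hj
  have h1 := hsub (right_mem_Icc.2 zero_le_one) j hj
  simp only [hf, zero_smul, add_zero, one_smul] at h1
  exact (hpos j hj).trans_le h1

/-- A positive definite form has a basis in which it is the standard inner product. -/
theorem Matrix.PosDef.exists_orthonormalization {G : Matrix ι ι ℝ} (hG : G.PosDef) :
    ∃ Q : Matrix ι ι ℝ, Qᵀ * G * Q = 1 ∧ G⁻¹ = Q * Qᵀ := by
  set U : Matrix ι ι ℝ := hG.1.eigenvectorUnitary.1 with hU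
  set d := hG.1.eigenvalues with hd
  have hdpos : ∀ i, 0 < d i := hG.eigenvalues_pos
  have hdiag : Uᵀ * G * U = diagonal d := by
    have := hG.1.conjStarAlgAut_star_eigenvectorUnitary
    rw [Unitary.conjStarAlgAut_apply] at this
    simpa [star_eq_conjTranspose, conjTranspose_eq_transpose_of_trivial] using this
  set S : Matrix ι ι ℝ := diagonal fun i => (√(d i))⁻¹ with hS
  have h1 : (U * S)ᵀ * G * (U * S) = 1 := by
    calc (U * S)ᵀ * G * (U * S) = S * (Uᵀ * G * U) * S := by
          simp only [transpose_mul, hS, diagonal_transpose, mul_assoc]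
      _ = 1 := by
          rw [hdiag, hS, diagonal_mul_diagonal, diagonal_mul_diagonal, ← diagonal_one]
          congr 1
          ext i
          have h2 := Real.mul_self_sqrt (hdpos i).le
          have h3 := (Real.sqrt_pos.2 (hdpos i)).ne'
          field_simp
          linarith
  refine ⟨U * S, h1, inv_eq_left_inv ?_⟩
  rw [mul_assoc]
  exact mul_eq_one_comm.1 h1

/-- `σ_j` of the eigenvalues of `A` relative to the metric `G`. -/
theorem esymm_roots_charpoly_inv_mul {G A Q : Matrix ι ι ℝ} (hQ : G⁻¹ = Q * Qᵀ)
    (hA : A.IsHermitian) {j : ℕ} (hj : j ≤ Fintype.card ι) :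
    (G⁻¹ * A).charpoly.roots.esymm j = minorSum j (Qᵀ * A * Q) := by
  have h1 : (G⁻¹ * A).charpoly = (Qᵀ * A * Q).charpoly := by
    rw [hQ, mul_assoc, charpoly_mul_comm, mul_assoc]
  have h2 : (Qᵀ * A * Q).IsHermitian := by
    have := Matrix.isHermitian_conjTranspose_mul_mul Q hA
    rwa [conjTranspose_eq_transpose_of_trivial] at this
  rw [h1, esymm_roots_charpoly hj h2.splits_charpoly]

/-- `G⁻¹ A` need not be symmetric, but it has real eigenvalues, being similar to a symmetric matrix. -/
theorem esymm_roots_charpoly_inv_mul' {G A : Matrix ι ι ℝ} (hG : G.PosDef)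
    (hA : A.IsHermitian) {j : ℕ} (hj : j ≤ Fintype.card ι) :
    (G⁻¹ * A).charpoly.roots.esymm j = minorSum j (G⁻¹ * A) := by
  obtain ⟨Q, h1, h2⟩ := hG.exists_orthonormalization
  rw [esymm_roots_charpoly_inv_mul h2 hA hj, minorSum_eq_coeff hj, minorSum_eq_coeff hj, h2,
    mul_assoc, charpoly_mul_comm, mul_assoc, charpoly_mul_comm A]

/-- **Stability of the cone `Γ_m`.** If the eigenvalues of `A` relative to `G` lie in `Γ_m`, and
`B ≥ c (G - (n / m) ℓ ⊗ ℓ)` with `|ℓ|_G ≤ 1`, then the eigenvalues of `A + B` lie in `Γ_m`. -/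
theorem esymm_pos_add {m : ℕ} (hm : m ≤ Fintype.card ι) {G A B : Matrix ι ι ℝ} (hG : G.PosDef)
    (hA : A.IsHermitian) (hB : B.IsHermitian) {c : ℝ} (hc : 0 ≤ c) {l : ι → ℝ}
    (hl : ∀ v : ι → ℝ, (l ⬝ᵥ v) ^ 2 ≤ v ⬝ᵥ G *ᵥ v)
    (hBl : ∀ v : ι → ℝ,
      c * (v ⬝ᵥ G *ᵥ v - Fintype.card ι / m * (l ⬝ᵥ v) ^ 2) ≤ v ⬝ᵥ B *ᵥ v)
    (hpos : ∀ j, 1 ≤ j → j ≤ m → 0 < (G⁻¹ * A).charpoly.roots.esymm j) :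
    ∀ j, 1 ≤ j → j ≤ m → 0 < (G⁻¹ * (A + B)).charpoly.roots.esymm j := by
  obtain ⟨Q, hQ1, hQ2⟩ := hG.exists_orthonormalization
  intro j hj1 hjm
  rw [esymm_roots_charpoly_inv_mul hQ2 (hA.add hB) (hjm.trans hm), mul_add, add_mul]
  have hherm : ∀ {M : Matrix ι ι ℝ}, M.IsHermitian → (Qᵀ * M * Q).IsHermitian := by
    intro M hM
    have := Matrix.isHermitian_conjTranspose_mul_mul Q hM
    rwa [conjTranspose_eq_transpose_of_trivial] at this
  have hquad : ∀ (M : Matrix ι ι ℝ) (v : ι → ℝ),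
      v ⬝ᵥ (Qᵀ * M * Q) *ᵥ v = (Q *ᵥ v) ⬝ᵥ M *ᵥ (Q *ᵥ v) := by
    intro M v
    rw [← mulVec_mulVec, ← mulVec_mulVec, dotProduct_mulVec, vecMul_transpose]
  have hself : ∀ v : ι → ℝ, v ⬝ᵥ v = (Q *ᵥ v) ⬝ᵥ G *ᵥ (Q *ᵥ v) := by
    intro v
    rw [← hquad, hQ1, one_mulVec]
  have hlin : ∀ v : ι → ℝ, (l ᵥ* Q) ⬝ᵥ v = l ⬝ᵥ (Q *ᵥ v) := fun v => (dotProduct_mulVec _ _ _).symm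
  refine minorSum_add_pos hm (hherm hA) (hherm hB) hc (e := l ᵥ* Q) ?_ ?_ ?_ j hjm
  · intro v
    rw [hlin, hself]
    exact hl _
  · intro v
    rw [hlin, hself, hquad]
    exact hBl _
  · intro i hi
    rcases Nat.eq_zero_or_pos i with rfl | hi0
    · simp [minorSum]
    · rw [← esymm_roots_charpoly_inv_mul hQ2 hA (hi.trans hm)]
      exact hpos i hi0 hi

end Cone

/-! ### Inner products and traces in coordinates -/

section Traces

set_option maxSynthPendingDepth 3

variable {n : ℕ}

/-- Symmetric positive definite bilinear forms on `ℝⁿ`. -/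
structure IsInner (B : BilinForm n) : Prop where
  symm : ∀ u v, B u v = B v u
  pos : ∀ v, v ≠ 0 → 0 < B v v

namespace IsInner

variable {B : BilinForm n}

theorem nonneg (hB : IsInner B) (v : Eucl n) : 0 ≤ B v v := by
  rcases eq_or_ne v 0 with rfl | h
  · simp
  · exact (hB.pos v h).le

theorem injective (hB : IsInner B) : Function.Injective B := by
  refine (injective_iff_map_eq_zero B).2 fun v hv => ?_
  by_contra h
  have := hB.pos v h
  rw [hv] at this
  simp at this

theorem isInvertible (hB : IsInner B) : B.IsInvertible := by
  have hd : Module.finrank ℝ (Eucl n) = Module.finrank ℝ (Eucl n →L[ℝ] ℝ) :=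
    (InnerProductSpace.toDual ℝ (Eucl n)).toLinearEquiv.finrank_eq
  exact ⟨(LinearEquiv.ofInjectiveOfFinrankEq B.toLinearMap hB.injective hd).toContinuousLinearEquiv,
    by ext; rfl⟩

theorem apply_inverse (hB : IsInner B) (ξ : Eucl n →L[ℝ] ℝ) : B (B.inverse ξ) = ξ := by
  obtain ⟨e, he⟩ := hB.isInvertible
  rw [← he, ContinuousLinearMap.inverse_equiv]
  exact e.apply_symm_apply ξ

theorem ext (hB : IsInner B) {u v : Eucl n} (h : ∀ w, B u w = B v w) : u = v :=
  hB.injective (ContinuousLinearMap.ext h)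

end IsInner

/-- The trace of an endomorphism of `ℝⁿ`, as the sum of its diagonal entries. -/
theorem trace_eq_sum_coord (f : Eucl n →ₗ[ℝ] Eucl n) :
    LinearMap.trace ℝ (Eucl n) f = ∑ i, f (coordVec n i) i := by
  rw [LinearMap.trace_eq_sum_inner f (EuclideanSpace.basisFun (Fin n) ℝ)]
  simp [EuclideanSpace.inner_single_left]

theorem sum_coord_smul_coordVec (v : Eucl n) : ∑ i, v i • coordVec n i = v := by
  ext j
  simp [Finset.sum_apply, Pi.single_apply]

theorem sum_apply_coordVec_mul (ξ : Eucl n →L[ℝ] ℝ) (a : Eucl n) :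
    ∑ i, ξ (coordVec n i) * a i = ξ a := by
  conv_rhs => rw [← sum_coord_smul_coordVec a, map_sum]
  simp [mul_comm]

/-- The trace in a basis which is orthogonal for `B`. -/
theorem IsInner.exists_trace_eq {B : BilinForm n} (hB : IsInner B) :
    ∃ (b : Fin n → Eucl n) (c : Fin n → ℝ), ∀ f : Eucl n →ₗ[ℝ] Eucl n,
      LinearMap.trace ℝ (Eucl n) f = ∑ i, c i * B (f (b i)) (b i) := by
  set β : LinearMap.BilinForm ℝ (Eucl n) :=
    LinearMap.mk₂ ℝ (fun u v => B u v) (by simp) (by simp) (by simp) (by simp) with hβ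
  have hβ' : ∀ u v, β u v = B u v := fun u v => rfl
  obtain ⟨v, hv⟩ := LinearMap.BilinForm.exists_orthogonal_basis (B := β)
    ⟨fun x y => by simp [hβ', hB.symm x y]⟩
  have hn : Module.finrank ℝ (Eucl n) = n := by simp
  set b := v.reindex (finCongr hn) with hb
  have hortho : ∀ i j, i ≠ j → B (b i) (b j) = 0 := by
    intro i j hij
    have := hv (show (finCongr hn).symm i ≠ (finCongr hn).symm j by simpa using hij)
    simpa [hb, hβ'] using this
  have hpos : ∀ i, B (b i) (b i) ≠ 0 := fun i => (hB.pos _ (b.ne_zero i)).ne'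
  refine ⟨b, fun i => (B (b i) (b i))⁻¹, fun f => ?_⟩
  rw [LinearMap.trace_eq_matrix_trace ℝ b, Matrix.trace]
  refine Finset.sum_congr rfl fun i _ => ?_
  rw [Matrix.diag_apply, LinearMap.toMatrix_apply]
  have h := b.sum_repr (f (b i))
  have h2 : B (f (b i)) (b i) = b.repr (f (b i)) i * B (b i) (b i) := by
    conv_lhs => rw [← h]
    rw [map_sum, _root_.sum_apply, Finset.sum_eq_single i]
    · simp
    · intro j _ hj; simp [hortho j i hj]
    · simp
  rw [h2]
  field_simp [hpos i]

end Traces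

/-! ### The Levi-Civita connection in coordinates -/

section Connection

set_option maxSynthPendingDepth 3

variable {n : ℕ}

/-- `(u, v, w) ↦ ½ (P u v w + P v u w - P w u v)`, for `P` the first derivative of a metric. -/
noncomputable def koszulL (P : Eucl n →L[ℝ] BilinForm n) :
    Eucl n →L[ℝ] Eucl n →L[ℝ] Eucl n →L[ℝ] ℝ :=
  (1 / 2 : ℝ) • (P + P.flip -
    (ContinuousLinearMap.flipₗᵢ ℝ (Eucl n) (Eucl n) ℝ).toContinuousLinearEquiv.toContinuousLinearMap.comp P.flip)

theorem koszulL_apply (P : Eucl n →L[ℝ] BilinForm n) (u v w : Eucl n) :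
    koszulL P u v w = (1 / 2) * (P u v w + P v u w - P w u v) := by
  simp [koszulL]

/-- The Christoffel symbols as a bilinear map. -/
noncomputable def christoffelL (G : Eucl n → BilinForm n) (z : Eucl n) :
    Eucl n →L[ℝ] Eucl n →L[ℝ] Eucl n :=
  (ContinuousLinearMap.compL ℝ (Eucl n) (Eucl n →L[ℝ] ℝ) (Eucl n) (G z).inverse).comp
    (koszulL (fderiv ℝ G z))

theorem christoffelL_apply (G : Eucl n → BilinForm n) (z u v : Eucl n) :
    christoffelL G z u v = christoffel G z u v := by
  have : koszulL (fderiv ℝ G z) u v = (1 / 2 : ℝ) •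
      (fderiv ℝ G z u v + fderiv ℝ G z v u - ((fderiv ℝ G z).flip u).flip v) := by
    ext w; simp [koszulL]
  simp only [christoffelL, christoffel, ContinuousLinearMap.comp_apply,
    ContinuousLinearMap.compL_apply, this]

/-- `G` is a smooth Riemannian metric near `z`. -/
structure MetricNear (G : Eucl n → BilinForm n) (z : Eucl n) : Prop where
  smooth_nhds : ∀ᶠ z' in 𝓝 z, ContDiffAt ℝ ∞ G z'
  inner : ∀ᶠ z' in 𝓝 z, IsInner (G z')

namespace MetricNear

variable {G : Eucl n → BilinForm n} {z : Eucl n}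

theorem smooth (h : MetricNear G z) : ContDiffAt ℝ ∞ G z := h.smooth_nhds.self_of_nhds

theorem self (h : MetricNear G z) : IsInner (G z) := h.inner.self_of_nhds

theorem eventually (h : MetricNear G z) : ∀ᶠ z' in 𝓝 z, MetricNear G z' := by
  filter_upwards [h.smooth_nhds.eventually_nhds, h.inner.eventually_nhds] with z' h1 h2
  exact ⟨h1, h2⟩

theorem smooth_fderiv (h : MetricNear G z) : ContDiffAt ℝ ∞ (fderiv ℝ G) z :=
  h.smooth.fderiv_right (by simp)

theorem differentiableAt (h : MetricNear G z) : DifferentiableAt ℝ G z :=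
  h.smooth.differentiableAt (by simp)

theorem fderiv_symm (h : MetricNear G z) (u v w : Eucl n) :
    fderiv ℝ G z u v w = fderiv ℝ G z u w v := by
  have h1 : ∀ a b, HasFDerivAt (fun z' => G z' a b)
      (((fderiv ℝ G z).flip a).flip b) z := fun a b => by
    have := ((h.differentiableAt.hasFDerivAt.clm_apply (hasFDerivAt_const a z)).clm_apply
      (hasFDerivAt_const b z))
    convert! this using 1
    ext; simp
  have h2 : (fun z' => G z' v w) =ᶠ[𝓝 z] fun z' => G z' w v := h.inner.mono fun z' hz => hz.symm v w
  have := congrArg (fun L => L u) ((h1 v w).unique ((h1 w v).congr_of_eventuallyEq h2))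
  simpa using this

theorem apply_christoffel (h : MetricNear G z) (u v w : Eucl n) :
    G z (christoffel G z u v) w =
      (1 / 2) * (fderiv ℝ G z u v w + fderiv ℝ G z v u w - fderiv ℝ G z w u v) := by
  rw [christoffel, h.self.apply_inverse]
  simp

theorem christoffel_symm (h : MetricNear G z) (u v : Eucl n) :
    christoffel G z u v = christoffel G z v u := by
  refine h.self.ext fun w => ?_
  rw [h.apply_christoffel, h.apply_christoffel, h.fderiv_symm w u v]
  ring

/-- The connection is compatible with the metric. -/
theorem fderiv_eq (h : MetricNear G z) (u v w : Eucl n) :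
    fderiv ℝ G z u v w = G z (christoffel G z u v) w + G z v (christoffel G z u w) := by
  rw [h.self.symm v, h.apply_christoffel, h.apply_christoffel, h.fderiv_symm u w v,
    h.fderiv_symm v u w]
  ring

theorem contDiffAt_inverse (h : MetricNear G z) :
    ContDiffAt ℝ ∞ (fun z' => (G z').inverse) z := by
  obtain ⟨e, he⟩ := h.self.isInvertible
  have := contDiffAt_map_inverse (n := ∞) e
  rw [he] at this
  exact this.comp z h.smooth

theorem contDiffAt_christoffelL (h : MetricNear G z) : ContDiffAt ℝ ∞ (christoffelL G) z := by
  have hk : ContDiffAt ℝ ∞ (fun z' => koszulL (fderiv ℝ G z')) z := by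
    have h1 := h.smooth_fderiv
    have h2 : ContDiffAt ℝ ∞ (fun z' => (fderiv ℝ G z').flip) z :=
      (ContinuousLinearMap.flipₗᵢ ℝ (Eucl n) (Eucl n) (Eucl n →L[ℝ] ℝ)).contDiff.contDiffAt.comp z h1
    have h3 : ContDiffAt ℝ ∞ (fun z' =>
        (ContinuousLinearMap.flipₗᵢ ℝ (Eucl n) (Eucl n) ℝ).toContinuousLinearEquiv.toContinuousLinearMap.comp (fderiv ℝ G z').flip) z :=
      contDiffAt_const.clm_comp h2
    exact ((h1.add h2).sub h3).const_smul (1 / 2 : ℝ)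
  have h4 : ContDiffAt ℝ ∞ (fun z' => ContinuousLinearMap.compL ℝ (Eucl n) (Eucl n →L[ℝ] ℝ) (Eucl n)
      (G z').inverse) z :=
    (ContinuousLinearMap.contDiff _).contDiffAt.comp z h.contDiffAt_inverse
  exact h4.clm_comp hk

theorem hasFDerivAt_christoffel (h : MetricNear G z) (v w : Eucl n) :
    HasFDerivAt (fun z' => christoffel G z' v w)
      (((fderiv ℝ (christoffelL G) z).flip v).flip w) z := by
  have h1 := (h.contDiffAt_christoffelL.differentiableAt (by simp)).hasFDerivAt
  have h2 := (h1.clm_apply (hasFDerivAt_const v z)).clm_apply (hasFDerivAt_const w z)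
  simp only [christoffelL_apply] at h2
  convert! h2 using 1
  ext; simp

theorem fderiv_christoffel (h : MetricNear G z) (u v w : Eucl n) :
    fderiv ℝ (fun z' => christoffel G z' v w) z u = fderiv ℝ (christoffelL G) z u v w := by
  rw [(h.hasFDerivAt_christoffel v w).fderiv]
  simp

theorem riemann_eq (h : MetricNear G z) (u v w : Eucl n) :
    riemann G z u v w = fderiv ℝ (christoffelL G) z u v w - fderiv ℝ (christoffelL G) z v u w
      + christoffelL G z u (christoffelL G z v w) - christoffelL G z v (christoffelL G z u w) := by
  rw [riemann, h.fderiv_christoffel, h.fderiv_christoffel]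
  simp only [christoffelL_apply]

/-- The derivative of the Christoffel symbols in terms of the `2`-jet of the metric. -/
theorem apply_fderiv_christoffelL (h : MetricNear G z) (u v w a : Eucl n) :
    G z (fderiv ℝ (christoffelL G) z u v w) a =
      koszulL (fderiv ℝ (fderiv ℝ G) z u) v w a - fderiv ℝ G z u (christoffel G z v w) a := by
  have h1 : HasFDerivAt (fun z' => G z' (christoffel G z' v w) a) _ z :=
    (h.differentiableAt.hasFDerivAt.clm_apply (h.hasFDerivAt_christoffel v w)).clm_apply
      (hasFDerivAt_const a z)
  have h2 := (h.smooth_fderiv.differentiableAt (by simp)).hasFDerivAt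
  have h3 : ∀ b c d : Eucl n, HasFDerivAt (fun z' => fderiv ℝ G z' b c d)
      ((((fderiv ℝ (fderiv ℝ G) z).flip b).flip c).flip d) z := fun b c d => by
    have := (((h2.clm_apply (hasFDerivAt_const b z)).clm_apply (hasFDerivAt_const c z)).clm_apply
      (hasFDerivAt_const d z))
    convert! this using 1
    ext; simp
  have h4 : HasFDerivAt (fun z' => (1 / 2 : ℝ) *
      (fderiv ℝ G z' v w a + fderiv ℝ G z' w v a - fderiv ℝ G z' a v w)) _ z :=
    (((h3 v w a).add (h3 w v a)).sub (h3 a v w)).const_mul (1 / 2 : ℝ)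
  have h5 : (fun z' => G z' (christoffel G z' v w) a) =ᶠ[𝓝 z] fun z' => (1 / 2 : ℝ) *
      (fderiv ℝ G z' v w a + fderiv ℝ G z' w v a - fderiv ℝ G z' a v w) :=
    h.eventually.mono fun z' hz => hz.apply_christoffel v w a
  have h6 := congrArg (fun L => L u) ((h1.unique (h4.congr_of_eventuallyEq h5)))
  rw [koszulL_apply]
  simp at h6
  linarith

theorem fderiv_fderiv_symm (h : MetricNear G z) (u v : Eucl n) :
    fderiv ℝ (fderiv ℝ G) z u v = fderiv ℝ (fderiv ℝ G) z v u := by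
  have := h.smooth.isSymmSndFDerivAt (by simpa using ENat.LEInfty.out)
  exact this.eq u v

theorem fderiv_christoffelL_symm (h : MetricNear G z) (u v w : Eucl n) :
    fderiv ℝ (christoffelL G) z u v w = fderiv ℝ (christoffelL G) z u w v := by
  rw [← h.fderiv_christoffel, ← h.fderiv_christoffel]
  congr 1
  refine Filter.EventuallyEq.fderiv_eq ?_
  exact h.eventually.mono fun z' hz => hz.christoffel_symm v w

end MetricNear

/-- The Ricci tensor as a function of two vectors. -/
noncomputable def ricci (G : Eucl n → BilinForm n) (z v w : Eucl n) : ℝ :=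
  ∑ i, riemann G z (coordVec n i) v w i

theorem ricciMatrix_apply (G : Eucl n → BilinForm n) (z : Eucl n) (a b : Fin n) :
    ricciMatrix G z a b = ricci G z (coordVec n a) (coordVec n b) := rfl

/-- The trace of `u ↦ D_v Γ(w, u)` is symmetric in `v` and `w`: it is the second derivative of
`log √(det G)`. -/
theorem MetricNear.trace_fderiv_christoffelL {G : Eucl n → BilinForm n} {z : Eucl n}
    (h : MetricNear G z) (v w : Eucl n) :
    LinearMap.trace ℝ (Eucl n) (fderiv ℝ (christoffelL G) z v w).toLinearMap =
      LinearMap.trace ℝ (Eucl n) (fderiv ℝ (christoffelL G) z w v).toLinearMap := by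
  obtain ⟨b, c, hbc⟩ := h.self.exists_trace_eq
  have key : ∀ v w, LinearMap.trace ℝ (Eucl n) (fderiv ℝ (christoffelL G) z v w).toLinearMap =
      (∑ i, c i * ((1 / 2) * fderiv ℝ (fderiv ℝ G) z v w (b i) (b i))) -
      (LinearMap.trace ℝ (Eucl n)
        ((christoffelL G z v).toLinearMap * (christoffelL G z w).toLinearMap) +
      ∑ i, c i * G z (christoffel G z w (b i)) (christoffel G z v (b i))) := by
    intro v w
    rw [hbc, hbc, ← Finset.sum_add_distrib, ← Finset.sum_sub_distrib]
    refine Finset.sum_congr rfl fun i _ => ?_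
    have h1 := h.apply_fderiv_christoffelL v w (b i) (b i)
    rw [koszulL_apply, h.fderiv_eq] at h1
    have h2 : (fderiv ℝ (christoffelL G) z v w).toLinearMap (b i) =
      fderiv ℝ (christoffelL G) z v w (b i) := rfl
    have h3 : ((christoffelL G z v).toLinearMap * (christoffelL G z w).toLinearMap) (b i) =
      christoffel G z v (christoffel G z w (b i)) := by
      simp [christoffelL_apply]
    rw [h2, h1, h3]
    ring
  rw [key, key, LinearMap.trace_mul_comm]
  congr 1
  · simp_rw [h.fderiv_fderiv_symm v w]
  · congr 1
    exact Finset.sum_congr rfl fun i _ => by rw [h.self.symm]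

/-- The Ricci tensor with the traces of the derivatives of the Christoffel symbols written out; each term
is visibly symmetric, apart from the one of `trace_fderiv_christoffelL`. -/
theorem MetricNear.ricci_eq {G : Eucl n → BilinForm n} {z : Eucl n} (h : MetricNear G z)
    (v w : Eucl n) :
    ricci G z v w = ∑ i, fderiv ℝ (christoffelL G) z (coordVec n i) v w i
      - LinearMap.trace ℝ (Eucl n) (fderiv ℝ (christoffelL G) z v w).toLinearMap
      + ∑ i, christoffelL G z (coordVec n i) (christoffelL G z v w) i
      - LinearMap.trace ℝ (Eucl n)
          ((christoffelL G z v).toLinearMap * (christoffelL G z w).toLinearMap) := by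
  rw [trace_eq_sum_coord, trace_eq_sum_coord, ← Finset.sum_sub_distrib, ← Finset.sum_add_distrib,
    ← Finset.sum_sub_distrib]
  refine Finset.sum_congr rfl fun i _ => ?_
  rw [h.riemann_eq, h.fderiv_christoffelL_symm v (coordVec n i) w]
  have : christoffelL G z (coordVec n i) w = christoffelL G z w (coordVec n i) := by
    rw [christoffelL_apply, christoffelL_apply, h.christoffel_symm]
  rw [this]
  rfl

/-- The Ricci tensor is symmetric. -/
theorem MetricNear.ricci_symm {G : Eucl n → BilinForm n} {z : Eucl n} (h : MetricNear G z)
    (v w : Eucl n) : ricci G z v w = ricci G z w v := by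
  have h1 : christoffelL G z v w = christoffelL G z w v := by
    rw [christoffelL_apply, christoffelL_apply, h.christoffel_symm]
  rw [h.ricci_eq, h.ricci_eq, h.trace_fderiv_christoffelL v w, LinearMap.trace_mul_comm, h1]
  congr 3
  exact Finset.sum_congr rfl fun i _ => by rw [h.fderiv_christoffelL_symm _ v w]

end Connection

/-! ### Traces and matrices of bilinear forms -/

section Matrices

set_option maxSynthPendingDepth 3

open Matrix

variable {n : ℕ}

/-- The trace of a continuous endomorphism of `ℝⁿ`. -/
noncomputable def coordTrace (T : Eucl n →L[ℝ] Eucl n) : ℝ := ∑ i, T (coordVec n i) i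

theorem coordTrace_eq_trace (T : Eucl n →L[ℝ] Eucl n) :
    coordTrace T = LinearMap.trace ℝ (Eucl n) T.toLinearMap := (trace_eq_sum_coord _).symm

@[simp] theorem coordTrace_add (S T : Eucl n →L[ℝ] Eucl n) :
    coordTrace (S + T) = coordTrace S + coordTrace T := by
  simp [coordTrace, Finset.sum_add_distrib]

@[simp] theorem coordTrace_sub (S T : Eucl n →L[ℝ] Eucl n) :
    coordTrace (S - T) = coordTrace S - coordTrace T := by
  simp [coordTrace, Finset.sum_sub_distrib]

@[simp] theorem coordTrace_smul (c : ℝ) (T : Eucl n →L[ℝ] Eucl n) :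
    coordTrace (c • T) = c * coordTrace T := by
  simp [coordTrace, Finset.mul_sum]

@[simp] theorem coordTrace_id : coordTrace (ContinuousLinearMap.id ℝ (Eucl n)) = n := by
  simp [coordTrace]

@[simp] theorem coordTrace_smulRight (ξ : Eucl n →L[ℝ] ℝ) (a : Eucl n) :
    coordTrace (ξ.smulRight a) = ξ a := by
  simp [coordTrace, sum_apply_coordVec_mul]

theorem coordTrace_conj {φ ψ S T : Eucl n →L[ℝ] Eucl n} (hψ : ψ.comp φ = .id ℝ _)
    (h : φ.comp S = T.comp φ) : coordTrace S = coordTrace T := by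
  have h1 : S.toLinearMap = ψ.toLinearMap * (T.toLinearMap * φ.toLinearMap) := by
    ext1 v
    have := congrArg (fun L : Eucl n →L[ℝ] Eucl n => ψ (L v)) h
    have h2 : ψ (φ (S v)) = S v := congrArg (fun L : Eucl n →L[ℝ] Eucl n => L (S v)) hψ
    simp only [ContinuousLinearMap.comp_apply, h2] at this
    exact this
  have h3 : φ.toLinearMap * ψ.toLinearMap = 1 := by
    have h4 : ψ.toLinearMap * φ.toLinearMap = 1 := by
      ext1 v
      exact congrArg (fun L : Eucl n →L[ℝ] Eucl n => L v) hψ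
    exact mul_eq_one_comm.1 h4
  rw [coordTrace_eq_trace, coordTrace_eq_trace, h1, LinearMap.trace_mul_comm, mul_assoc, h3, mul_one]

/-- The matrix of a function of two vectors. -/
noncomputable def formMatrix (S : Eucl n → Eucl n → ℝ) : Matrix (Fin n) (Fin n) ℝ :=
  Matrix.of fun a b => S (coordVec n a) (coordVec n b)

theorem ricciMatrix_eq (G : Eucl n → BilinForm n) (z : Eucl n) :
    ricciMatrix G z = formMatrix (ricci G z) := rfl

theorem dotProduct_formMatrix (S : Eucl n →ₗ[ℝ] Eucl n →ₗ[ℝ] ℝ) (x y : Fin n → ℝ) :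
    x ⬝ᵥ formMatrix (fun u v => S u v) *ᵥ y = S (WithLp.toLp 2 x) (WithLp.toLp 2 y) := by
  have h : ∀ v : Fin n → ℝ, (WithLp.toLp 2 v : Eucl n) = ∑ i, v i • coordVec n i := fun v =>
    (sum_coord_smul_coordVec (WithLp.toLp 2 v : Eucl n)).symm
  rw [h x, h y]
  simp [dotProduct, mulVec, formMatrix, Finset.mul_sum, LinearMap.sum_apply]
  rw [Finset.sum_comm]
  refine Finset.sum_congr rfl fun i _ => Finset.sum_congr rfl fun j _ => by ring

/-- A continuous bilinear form, as an algebraic one. -/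
noncomputable def algForm (B : BilinForm n) : Eucl n →ₗ[ℝ] Eucl n →ₗ[ℝ] ℝ :=
  LinearMap.mk₂ ℝ (fun u v => B u v) (by simp) (by simp) (by simp) (by simp)

@[simp] theorem algForm_apply (B : BilinForm n) (u v : Eucl n) : algForm B u v = B u v := rfl

theorem dotProduct_formMatrix' (B : BilinForm n) (x y : Fin n → ℝ) :
    x ⬝ᵥ formMatrix (fun u v => B u v) *ᵥ y = B (WithLp.toLp 2 x) (WithLp.toLp 2 y) :=
  dotProduct_formMatrix (algForm B) x y

theorem formMatrix_isHermitian {S : Eucl n → Eucl n → ℝ} (hS : ∀ u v, S u v = S v u) :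
    (formMatrix S).IsHermitian := by
  ext a b
  simp [formMatrix, hS (coordVec n a)]

theorem IsInner.posDef {B : BilinForm n} (hB : IsInner B) :
    (formMatrix fun u v => B u v).PosDef := by
  refine Matrix.PosDef.of_dotProduct_mulVec_pos (formMatrix_isHermitian hB.symm) fun x hx => ?_
  rw [star_trivial, dotProduct_formMatrix']
  exact hB.pos _ (by simpa using hx)

/-- The matrix of an endomorphism. -/
noncomputable def endMatrix (L : Eucl n →L[ℝ] Eucl n) : Matrix (Fin n) (Fin n) ℝ :=
  Matrix.of fun c a => L (coordVec n a) c

theorem formMatrix_comp (S : Eucl n →ₗ[ℝ] Eucl n →ₗ[ℝ] ℝ) (L : Eucl n →L[ℝ] Eucl n) :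
    formMatrix (fun u v => S (L u) (L v)) =
      (endMatrix L)ᵀ * formMatrix (fun u v => S u v) * endMatrix L := by
  ext a b
  have h : ∀ v, (WithLp.toLp 2 fun c => L v c : Eucl n) = L v := fun v => rfl
  have := dotProduct_formMatrix S (fun c => L (coordVec n a) c) (fun c => L (coordVec n b) c)
  rw [h, h] at this
  rw [mul_assoc]
  simp only [formMatrix, of_apply] at this ⊢
  rw [← this]
  simp only [Matrix.mul_apply, dotProduct, mulVec, endMatrix, transpose_apply, of_apply]

theorem endMatrix_mul {L L' : Eucl n →L[ℝ] Eucl n} (h : L'.comp L = .id ℝ _) :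
    endMatrix L' * endMatrix L = 1 := by
  ext a b
  have h1 := congrArg (fun T : Eucl n →L[ℝ] Eucl n => T (coordVec n b) a) h
  simp only [ContinuousLinearMap.comp_apply, ContinuousLinearMap.id_apply] at h1
  rw [← sum_coord_smul_coordVec (L (coordVec n b)), map_sum] at h1
  simp only [map_smul] at h1
  simp only [Matrix.mul_apply, endMatrix, of_apply, Matrix.one_apply]
  rw [WithLp.ofLp_sum, Finset.sum_apply] at h1
  simp only [PiLp.smul_apply, smul_eq_mul, PiLp.single_apply] at h1
  rw [← h1]
  exact Finset.sum_congr rfl fun c _ => mul_comm _ _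

/-- The trace of a bilinear form with respect to an inner product. -/
theorem IsInner.trace_inv_mul {B : BilinForm n} (hB : IsInner B) (T : Eucl n →L[ℝ] Eucl n) :
    ((formMatrix fun u v => B u v)⁻¹ * formMatrix fun u v => B (T u) v).trace = coordTrace T := by
  have h : (formMatrix fun u v => B (T u) v) = (endMatrix T)ᵀ * formMatrix fun u v => B u v := by
    ext a b
    simp only [formMatrix, Matrix.mul_apply, of_apply, transpose_apply, endMatrix]
    conv_lhs => rw [← sum_coord_smul_coordVec (T (coordVec n a))]
    simp [_root_.sum_apply]
  have hdet : IsUnit (formMatrix fun u v => B u v).det :=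
    (Matrix.isUnit_iff_isUnit_det _).1 hB.posDef.isUnit
  rw [h, Matrix.trace_mul_comm, mul_assoc, mul_nonsing_inv _ hdet, mul_one, trace_transpose]
  rfl

end Matrices

/-! ### Invariance of the curvature under changes of coordinates -/

section Naturality

set_option maxSynthPendingDepth 3

open Matrix

variable {n : ℕ}

theorem christoffel_congr {G G' : Eucl n → BilinForm n} {z : Eucl n} (h : G =ᶠ[𝓝 z] G') :
    christoffel G z = christoffel G' z := by
  funext u v
  rw [christoffel, christoffel, h.self_of_nhds, h.fderiv_eq]

theorem riemann_congr {G G' : Eucl n → BilinForm n} {z : Eucl n} (h : G =ᶠ[𝓝 z] G') :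
    riemann G z = riemann G' z := by
  funext u v w
  have h1 : ∀ a b, (fun z' => christoffel G z' a b) =ᶠ[𝓝 z] fun z' => christoffel G' z' a b :=
    fun a b => h.eventuallyEq_nhds.mono fun z' hz =>
      congrFun (congrFun (christoffel_congr hz) a) b
  rw [riemann, riemann, (h1 v w).fderiv_eq, (h1 u w).fderiv_eq, christoffel_congr h]

theorem schoutenMatrix_congr {G G' : Eucl n → BilinForm n} {z : Eucl n} (h : G =ᶠ[𝓝 z] G') :
    schoutenMatrix G z = schoutenMatrix G' z := by
  have h1 : metricMatrix G z = metricMatrix G' z := by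
    rw [metricMatrix, metricMatrix, h.self_of_nhds]
  have h2 : ricciMatrix G z = ricciMatrix G' z := by
    rw [ricciMatrix, ricciMatrix, riemann_congr h]
  rw [schoutenMatrix, schoutenMatrix, scalarCurv, scalarCurv, h1, h2]

theorem sigmaCoord_congr {G G' : Eucl n → BilinForm n} {z : Eucl n} (h : G =ᶠ[𝓝 z] G') (j : ℕ) :
    sigmaCoord G j z = sigmaCoord G' j z := by
  have h1 : metricMatrix G z = metricMatrix G' z := by
    rw [metricMatrix, metricMatrix, h.self_of_nhds]
  rw [sigmaCoord, sigmaCoord, schoutenMatrix_congr h, h1]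

/-- The operator `u ↦ R(u, v) w`. -/
noncomputable def riemannOp (G : Eucl n → BilinForm n) (z v w : Eucl n) : Eucl n →L[ℝ] Eucl n :=
  ((fderiv ℝ (christoffelL G) z).flip v).flip w - (fderiv ℝ (christoffelL G) z v).flip w
    + (christoffelL G z).flip (christoffelL G z v w)
    - (christoffelL G z v).comp ((christoffelL G z).flip w)

theorem MetricNear.riemannOp_apply {G : Eucl n → BilinForm n} {z : Eucl n} (h : MetricNear G z)
    (u v w : Eucl n) : riemannOp G z v w u = riemann G z u v w := by
  rw [h.riemann_eq]; simp [riemannOp]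

theorem MetricNear.ricci_eq_trace {G : Eucl n → BilinForm n} {z : Eucl n} (h : MetricNear G z)
    (v w : Eucl n) : ricci G z v w = coordTrace (riemannOp G z v w) := by
  simp only [ricci, coordTrace, h.riemannOp_apply]

theorem MetricNear.ricci_add {G : Eucl n → BilinForm n} {z : Eucl n} (h : MetricNear G z)
    (v w w' : Eucl n) : ricci G z v (w + w') = ricci G z v w + ricci G z v w' := by
  simp only [h.ricci_eq_trace, ← coordTrace_add]
  congr 1
  ext1 u
  simp only [_root_.add_apply, h.riemannOp_apply, h.riemann_eq, map_add]
  abel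

theorem MetricNear.ricci_smul {G : Eucl n → BilinForm n} {z : Eucl n} (h : MetricNear G z)
    (c : ℝ) (v w : Eucl n) : ricci G z v (c • w) = c * ricci G z v w := by
  simp only [h.ricci_eq_trace, ← coordTrace_smul]
  congr 1
  ext1 u
  simp only [_root_.smul_apply, h.riemannOp_apply, h.riemann_eq, map_smul]
  module

/-- The Ricci tensor as a bilinear form. -/
noncomputable def MetricNear.ricciForm {G : Eucl n → BilinForm n} {z : Eucl n}
    (h : MetricNear G z) : Eucl n →ₗ[ℝ] Eucl n →ₗ[ℝ] ℝ :=
  LinearMap.mk₂ ℝ (ricci G z)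
    (fun u u' v => by rw [h.ricci_symm, h.ricci_add, h.ricci_symm v, h.ricci_symm v])
    (fun c u v => by rw [h.ricci_symm, h.ricci_smul, h.ricci_symm v]; rfl)
    (fun u v v' => h.ricci_add u v v') (fun c u v => h.ricci_smul c u v)

/-- `φ` is a local diffeomorphism at `z`. -/
structure LocalDiffeo (φ : Eucl n → Eucl n) (z : Eucl n) : Prop where
  smooth_nhds : ∀ᶠ z' in 𝓝 z, ContDiffAt ℝ ∞ φ z'
  invertible : (fderiv ℝ φ z).IsInvertible

/-- The expression of the metric `H` in the coordinates `z` with `φ(z)` the old coordinates. -/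
noncomputable def pullMetric (φ : Eucl n → Eucl n) (H : Eucl n → BilinForm n) (z : Eucl n) :
    BilinForm n :=
  (H (φ z)).bilinearComp (fderiv ℝ φ z) (fderiv ℝ φ z)

theorem pullMetric_apply (φ : Eucl n → Eucl n) (H : Eucl n → BilinForm n) (z u v : Eucl n) :
    pullMetric φ H z u v = H (φ z) (fderiv ℝ φ z u) (fderiv ℝ φ z v) := rfl

theorem pullMetric_eq (φ : Eucl n → Eucl n) (H : Eucl n → BilinForm n) :
    pullMetric φ H = fun z => (ContinuousLinearMap.compL ℝ (Eucl n) (Eucl n) ℝ).flip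
      (fderiv ℝ φ z) ∘L ((H (φ z)).comp (fderiv ℝ φ z)) := by
  funext z
  ext u v
  simp [pullMetric]

namespace LocalDiffeo

variable {φ : Eucl n → Eucl n} {H : Eucl n → BilinForm n} {z : Eucl n}

theorem smooth (h : LocalDiffeo φ z) : ContDiffAt ℝ ∞ φ z := h.smooth_nhds.self_of_nhds

theorem smooth_fderiv (h : LocalDiffeo φ z) : ContDiffAt ℝ ∞ (fderiv ℝ φ) z :=
  h.smooth.fderiv_right (by simp)

theorem eventually (h : LocalDiffeo φ z) : ∀ᶠ z' in 𝓝 z, LocalDiffeo φ z' := by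
  obtain ⟨e, he⟩ := h.invertible
  have h1 : ∀ᶠ z' in 𝓝 z, fderiv ℝ φ z' ∈ range ((↑) : (Eucl n ≃L[ℝ] Eucl n) → _) := by
    refine h.smooth_fderiv.continuousAt.eventually ?_
    rw [← he]
    exact ContinuousLinearEquiv.nhds e
  filter_upwards [h1, h.smooth_nhds.eventually_nhds] with z' h2 h3
  exact ⟨h3, h2⟩

theorem contDiffAt_pullMetric (h : LocalDiffeo φ z) (hH : MetricNear H (φ z)) :
    ContDiffAt ℝ ∞ (pullMetric φ H) z := by
  rw [pullMetric_eq]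
  have h1 := h.smooth_fderiv
  have h2 : ContDiffAt ℝ ∞ (fun z => H (φ z)) z := hH.smooth.comp z h.smooth
  exact ((ContinuousLinearMap.contDiff _).contDiffAt.comp z h1).clm_comp (h2.clm_comp h1)

theorem inner_pullMetric (h : LocalDiffeo φ z) (hH : MetricNear H (φ z)) :
    IsInner (pullMetric φ H z) := by
  obtain ⟨e, he⟩ := h.invertible
  refine ⟨fun u v => hH.self.symm _ _, fun v hv => hH.self.pos _ ?_⟩
  rw [← he]
  simpa using hv

theorem metricNear (h : LocalDiffeo φ z) (hH : MetricNear H (φ z)) :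
    MetricNear (pullMetric φ H) z := by
  have h1 := h.smooth.continuousAt.eventually hH.eventually
  constructor
  · filter_upwards [h.eventually, h1] with z' h2 h3
    exact h2.contDiffAt_pullMetric h3
  · filter_upwards [h.eventually, h1] with z' h2 h3
    exact h2.inner_pullMetric h3

theorem fderiv_pullMetric (h : LocalDiffeo φ z) (hH : MetricNear H (φ z)) (u v w : Eucl n) :
    fderiv ℝ (pullMetric φ H) z u v w =
      fderiv ℝ H (φ z) (fderiv ℝ φ z u) (fderiv ℝ φ z v) (fderiv ℝ φ z w)
      + H (φ z) (fderiv ℝ (fderiv ℝ φ) z u v) (fderiv ℝ φ z w)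
      + H (φ z) (fderiv ℝ φ z v) (fderiv ℝ (fderiv ℝ φ) z u w) := by
  have h1 := ((h.contDiffAt_pullMetric hH).differentiableAt (by simp)).hasFDerivAt
  have h2 := (h1.clm_apply (hasFDerivAt_const v z)).clm_apply (hasFDerivAt_const w z)
  have h3 := (h.smooth.differentiableAt (by simp)).hasFDerivAt
  have h4 := (h.smooth_fderiv.differentiableAt (by simp)).hasFDerivAt
  have h5 : HasFDerivAt (fun z' => H (φ z')) _ z := hH.differentiableAt.hasFDerivAt.comp z h3
  have h6 := (h5.clm_apply (h4.clm_apply (hasFDerivAt_const v z))).clm_apply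
    (h4.clm_apply (hasFDerivAt_const w z))
  have h7 := congrArg (fun L => L u) (h2.unique h6)
  simp at h7
  rw [h7]; ring

/-- The transformation law of the Christoffel symbols. -/
theorem fderiv_christoffel (h : LocalDiffeo φ z) (hH : MetricNear H (φ z)) (u v : Eucl n) :
    fderiv ℝ φ z (christoffel (pullMetric φ H) z u v) =
      christoffel H (φ z) (fderiv ℝ φ z u) (fderiv ℝ φ z v) + fderiv ℝ (fderiv ℝ φ) z u v := by
  obtain ⟨e, he⟩ := h.invertible
  have hG := h.metricNear hH
  set X := christoffel H (φ z) (fderiv ℝ φ z u) (fderiv ℝ φ z v) + fderiv ℝ (fderiv ℝ φ) z u v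
    with hX
  have hsymm : ∀ a b, fderiv ℝ (fderiv ℝ φ) z a b = fderiv ℝ (fderiv ℝ φ) z b a :=
    (h.smooth.isSymmSndFDerivAt (by simpa using ENat.LEInfty.out)).eq
  have h1 : christoffel (pullMetric φ H) z u v = e.symm X := by
    refine hG.self.ext fun w => ?_
    have h2 : fderiv ℝ φ z (e.symm X) = X := by rw [← he]; simp
    rw [hG.apply_christoffel, pullMetric_apply, h2, hX, map_add, _root_.add_apply,
      hH.apply_christoffel, h.fderiv_pullMetric hH, h.fderiv_pullMetric hH, h.fderiv_pullMetric hH,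
      hsymm v u, hsymm w u, hsymm w v, hH.self.symm (fderiv ℝ (fderiv ℝ φ) z u w)]
    ring
  rw [h1, ← he]
  simp

/-- The Riemann tensor transforms as a tensor. -/
theorem fderiv_riemann (h : LocalDiffeo φ z) (hH : MetricNear H (φ z)) (u v w : Eucl n) :
    fderiv ℝ φ z (riemann (pullMetric φ H) z u v w) =
      riemann H (φ z) (fderiv ℝ φ z u) (fderiv ℝ φ z v) (fderiv ℝ φ z w) := by
  have hG := h.metricNear hH
  have h1 := (h.smooth.differentiableAt (by simp)).hasFDerivAt
  have h2 := (h.smooth_fderiv.differentiableAt (by simp)).hasFDerivAt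
  have h2s : ContDiffAt ℝ ∞ (fderiv ℝ (fderiv ℝ φ)) z := h.smooth_fderiv.fderiv_right (by simp)
  have h3 := (h2s.differentiableAt (by simp)).hasFDerivAt
  have hev := h.smooth.continuousAt.eventually hH.eventually
  -- The derivative of the transformation law of the Christoffel symbols in the direction `u`. The third
  -- derivatives of `φ` and the mixed terms cancel upon antisymmetrizing in `u` and `v`.
  have key : ∀ u v w, fderiv ℝ (fderiv ℝ φ) z u (christoffel (pullMetric φ H) z v w) +
      fderiv ℝ φ z (fderiv ℝ (fun z' => christoffel (pullMetric φ H) z' v w) z u) =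
      fderiv ℝ (christoffelL H) (φ z) (fderiv ℝ φ z u) (fderiv ℝ φ z v) (fderiv ℝ φ z w)
      + christoffel H (φ z) (fderiv ℝ (fderiv ℝ φ) z u v) (fderiv ℝ φ z w)
      + christoffel H (φ z) (fderiv ℝ φ z v) (fderiv ℝ (fderiv ℝ φ) z u w)
      + fderiv ℝ (fderiv ℝ (fderiv ℝ φ)) z u v w := by
    intro u v w
    have h4 := h2.clm_apply (hG.hasFDerivAt_christoffel v w)
    have h5 : HasFDerivAt (fun z' => christoffelL H (φ z')) _ z :=
      (hH.contDiffAt_christoffelL.differentiableAt (by simp)).hasFDerivAt.comp z h1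
    have h6 := ((h5.clm_apply (h2.clm_apply (hasFDerivAt_const v z))).clm_apply
      (h2.clm_apply (hasFDerivAt_const w z))).add
      ((h3.clm_apply (hasFDerivAt_const v z)).clm_apply (hasFDerivAt_const w z))
    have h7 : (fun z' => fderiv ℝ φ z' (christoffel (pullMetric φ H) z' v w)) =ᶠ[𝓝 z]
        fun z' => christoffel H (φ z') (fderiv ℝ φ z' v) (fderiv ℝ φ z' w) +
          fderiv ℝ (fderiv ℝ φ) z' v w := by
      filter_upwards [h.eventually, hev] with z' h8 h9
      exact h8.fderiv_christoffel h9 v w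
    simp only [christoffelL_apply] at h6
    have h8 := congrArg (fun L => L u) (h4.unique (h6.congr_of_eventuallyEq h7))
    rw [hG.fderiv_christoffel]
    simp [christoffelL_apply] at h8
    rw [add_comm, h8]
    abel
  have hsymm : ∀ a b, fderiv ℝ (fderiv ℝ φ) z a b = fderiv ℝ (fderiv ℝ φ) z b a :=
    (h.smooth.isSymmSndFDerivAt (by simpa using ENat.LEInfty.out)).eq
  have hsymm3 : ∀ a b, fderiv ℝ (fderiv ℝ (fderiv ℝ φ)) z a b =
      fderiv ℝ (fderiv ℝ (fderiv ℝ φ)) z b a :=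
    (h.smooth_fderiv.isSymmSndFDerivAt (by simpa using ENat.LEInfty.out)).eq
  have k1 := key u v w
  have k2 := key v u w
  rw [hsymm3 v u, hsymm v u] at k2
  rw [riemann, map_sub, map_add, map_sub, eq_sub_of_add_eq' k1, eq_sub_of_add_eq' k2,
    h.fderiv_christoffel hH, h.fderiv_christoffel hH, h.fderiv_christoffel hH,
    h.fderiv_christoffel hH, hH.riemann_eq]
  simp only [← christoffelL_apply, map_add]
  abel

theorem ricci_pullMetric (h : LocalDiffeo φ z) (hH : MetricNear H (φ z)) (v w : Eucl n) :
    ricci (pullMetric φ H) z v w = ricci H (φ z) (fderiv ℝ φ z v) (fderiv ℝ φ z w) := by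
  have hG := h.metricNear hH
  obtain ⟨e, he⟩ := h.invertible
  rw [hG.ricci_eq_trace, hH.ricci_eq_trace]
  refine coordTrace_conj (φ := fderiv ℝ φ z) (ψ := e.symm.toContinuousLinearMap) ?_ ?_
  · rw [← he]; ext1 u; simp
  · ext1 u
    simp only [ContinuousLinearMap.comp_apply, hG.riemannOp_apply, hH.riemannOp_apply,
      h.fderiv_riemann hH]

/-- The functions `σ_j` do not depend on the coordinates. -/
theorem sigmaCoord_pullMetric (h : LocalDiffeo φ z) (hH : MetricNear H (φ z)) (j : ℕ) :
    sigmaCoord (pullMetric φ H) j z = sigmaCoord H j (φ z) := by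
  obtain ⟨e, he⟩ := h.invertible
  set L := fderiv ℝ φ z with hL
  -- With `J` the Jacobian matrix, forms transform by `S ↦ Jᵀ S J`, so that `G⁻¹ A` is conjugated by `J`.
  set J := endMatrix L with hJ
  set J' := endMatrix e.symm.toContinuousLinearMap with hJ'
  have hJJ : J' * J = 1 := endMatrix_mul (by rw [← he]; ext1 u; simp)
  have hJJ' : J * J' = 1 := mul_eq_one_comm.1 hJJ
  have h1 : metricMatrix (pullMetric φ H) z = Jᵀ * metricMatrix H (φ z) * J :=
    formMatrix_comp (algForm (H (φ z))) L
  have h2 : ricciMatrix (pullMetric φ H) z = Jᵀ * ricciMatrix H (φ z) * J := by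
    rw [ricciMatrix_eq, ricciMatrix_eq, funext fun v => funext fun w => h.ricci_pullMetric hH v w]
    exact formMatrix_comp hH.ricciForm L
  have hconj : ∀ S : Matrix (Fin n) (Fin n) ℝ, (metricMatrix (pullMetric φ H) z)⁻¹ * (Jᵀ * S * J) =
      J' * ((metricMatrix H (φ z))⁻¹ * S * J) := by
    intro S
    have hT : J'ᵀ * Jᵀ = 1 := by rw [← transpose_mul, hJJ', transpose_one]
    rw [h1, Matrix.mul_inv_rev, Matrix.mul_inv_rev, inv_eq_left_inv hJJ, inv_eq_left_inv hT]
    calc J' * ((metricMatrix H (φ z))⁻¹ * J'ᵀ) * (Jᵀ * S * J)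
        = J' * ((metricMatrix H (φ z))⁻¹ * ((J'ᵀ * Jᵀ) * (S * J))) := by
          simp only [Matrix.mul_assoc]
      _ = _ := by rw [hT, Matrix.one_mul]; simp only [Matrix.mul_assoc]
  have h3 : scalarCurv (pullMetric φ H) z = scalarCurv H (φ z) := by
    rw [scalarCurv, scalarCurv, h2, hconj, Matrix.trace_mul_comm, Matrix.mul_assoc, hJJ',
      Matrix.mul_one]
  have h4 : schoutenMatrix (pullMetric φ H) z = Jᵀ * schoutenMatrix H (φ z) * J := by
    rw [schoutenMatrix, schoutenMatrix, h1, h2, h3]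
    simp [Matrix.mul_sub, Matrix.sub_mul]
  rw [sigmaCoord, sigmaCoord, h4, hconj, charpoly_mul_comm, Matrix.mul_assoc, hJJ', Matrix.mul_one]

end LocalDiffeo

end Naturality

/-! ### Conformal changes of the metric -/

section Conformal

set_option maxSynthPendingDepth 3

open Matrix

variable {n : ℕ}

/-- The conformal metric `e^{-2f} G`. -/
noncomputable def confMetric (f : Eucl n → ℝ) (G : Eucl n → BilinForm n) (z : Eucl n) :
    BilinForm n := Real.exp (-2 * f z) • G z

/-- The gradient of `f`. -/
noncomputable def gradient' (f : Eucl n → ℝ) (G : Eucl n → BilinForm n) (z : Eucl n) : Eucl n :=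
  (G z).inverse (fderiv ℝ f z)

/-- The tensor `∇²f + df ⊗ df - ½ |df|² G` by which the Schouten tensor changes when `G` is replaced
by `e^{-2f} G`. -/
noncomputable def confSchouten (f : Eucl n → ℝ) (G : Eucl n → BilinForm n) (z v w : Eucl n) : ℝ :=
  fderiv ℝ (fderiv ℝ f) z v w - fderiv ℝ f z (christoffel G z v w)
    + fderiv ℝ f z v * fderiv ℝ f z w - (1 / 2) * fderiv ℝ f z (gradient' f G z) * G z v w

variable {f : Eucl n → ℝ} {G : Eucl n → BilinForm n} {z : Eucl n}

theorem MetricNear.conf (h : MetricNear G z) (hf : ∀ᶠ z' in 𝓝 z, ContDiffAt ℝ ∞ f z') :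
    MetricNear (confMetric f G) z := by
  constructor
  · filter_upwards [h.smooth_nhds, hf] with z' h1 h2
    exact (contDiffAt_const.mul h2).exp.smul h1
  · filter_upwards [h.inner] with z' h1
    refine ⟨fun u v => ?_, fun v hv => ?_⟩
    · simp [confMetric, h1.symm u v]
    · exact mul_pos (Real.exp_pos _) (h1.pos v hv)

theorem MetricNear.apply_gradient (h : MetricNear G z) (w : Eucl n) :
    G z (gradient' f G z) w = fderiv ℝ f z w := by
  rw [gradient', h.self.apply_inverse]

theorem MetricNear.christoffel_conf (h : MetricNear G z) (hf : ∀ᶠ z' in 𝓝 z, ContDiffAt ℝ ∞ f z')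
    (u v : Eucl n) :
    christoffel (confMetric f G) z u v = christoffel G z u v - fderiv ℝ f z u • v
      - fderiv ℝ f z v • u + G z u v • gradient' f G z := by
  have hG := h.conf hf
  have hd : ∀ u v w, fderiv ℝ (confMetric f G) z u v w =
      Real.exp (-2 * f z) * (fderiv ℝ G z u v w - 2 * fderiv ℝ f z u * G z v w) := by
    intro u v w
    have h1 := (hf.self_of_nhds.differentiableAt (by simp)).hasFDerivAt
    have h2 := ((h1.const_mul (-2)).exp.smul h.differentiableAt.hasFDerivAt)
    have h3 : fderiv ℝ (confMetric f G) z = _ := h2.fderiv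
    rw [h3]
    simp
    ring
  refine hG.self.ext fun w => ?_
  rw [hG.apply_christoffel, hd, hd, hd]
  simp only [confMetric, _root_.smul_apply, map_add, map_sub, map_smul, _root_.add_apply,
    _root_.sub_apply, smul_eq_mul, h.apply_christoffel, h.apply_gradient]
  rw [h.self.symm u v]
  ring

theorem MetricNear.contDiffAt_gradient (h : MetricNear G z) (hf : ContDiffAt ℝ ∞ f z) :
    ContDiffAt ℝ ∞ (gradient' f G) z :=
  h.contDiffAt_inverse.clm_apply (hf.fderiv_right (by simp))

/-- The derivative of the gradient in terms of the Hessian. -/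
theorem MetricNear.apply_fderiv_gradient (h : MetricNear G z) (hf : ContDiffAt ℝ ∞ f z)
    (a b : Eucl n) :
    G z (fderiv ℝ (gradient' f G) z a) b = fderiv ℝ (fderiv ℝ f) z a b
      - fderiv ℝ f z (christoffel G z a b) - G z (christoffel G z a (gradient' f G z)) b := by
  have h2 : HasFDerivAt (fderiv ℝ f) (fderiv ℝ (fderiv ℝ f) z) z :=
    ((hf.fderiv_right (m := ∞) (by simp)).differentiableAt (by simp)).hasFDerivAt
  have h3 : HasFDerivAt (gradient' f G) (fderiv ℝ (gradient' f G) z) z :=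
    ((h.contDiffAt_gradient hf).differentiableAt (by simp)).hasFDerivAt
  have h5 := (h.differentiableAt.hasFDerivAt.clm_apply h3).clm_apply (hasFDerivAt_const b z)
  have h6 := h2.clm_apply (hasFDerivAt_const b z)
  have h7 : (fun z' => G z' (gradient' f G z') b) =ᶠ[𝓝 z] fun z' => fderiv ℝ f z' b := by
    filter_upwards [h.eventually] with z' k1
    exact k1.apply_gradient b
  have h8 := congrArg (fun L => L a) (h5.unique (h6.congr_of_eventuallyEq h7))
  simp at h8
  rw [h.fderiv_eq, h.apply_gradient] at h8
  linarith

/-- The change of the Ricci tensor under a conformal change of the metric, with the trace-free part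
of the Hessian and its trace kept apart. -/
theorem MetricNear.ricci_conf (h : MetricNear G z) (hf : ∀ᶠ z' in 𝓝 z, ContDiffAt ℝ ∞ f z')
    (v w : Eucl n) :
    ricci (confMetric f G) z v w = ricci G z v w
      + ((n : ℝ) - 2) * (fderiv ℝ (fderiv ℝ f) z v w - fderiv ℝ f z (christoffel G z v w)
        + fderiv ℝ f z v * fderiv ℝ f z w - fderiv ℝ f z (gradient' f G z) * G z v w)
      + coordTrace (fderiv ℝ (gradient' f G) z + (christoffelL G z).flip (gradient' f G z))
        * G z v w := by
  have hG := h.conf hf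
  set d := fderiv ℝ f z with hd
  set X := gradient' f G z with hX
  set X' := fderiv ℝ (gradient' f G) z with hX'
  set Q := fderiv ℝ (fderiv ℝ f) z with hQ
  set P := fderiv ℝ G z with hP
  set Γ := christoffelL G z with hΓ
  have hfs := hf.self_of_nhds
  have h2 : HasFDerivAt (fderiv ℝ f) Q z :=
    ((hfs.fderiv_right (m := ∞) (by simp)).differentiableAt (by simp)).hasFDerivAt
  have h3 : HasFDerivAt (gradient' f G) X' z :=
    ((h.contDiffAt_gradient hfs).differentiableAt (by simp)).hasFDerivAt
  have h4 := h.differentiableAt.hasFDerivAt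
  -- The Christoffel symbols change by `-df(v) w - df(w) v + G(v, w) ∇f`; this is the derivative.
  have hder : ∀ u v w, fderiv ℝ (fun z' => christoffel (confMetric f G) z' v w) z u =
      fderiv ℝ (fun z' => christoffel G z' v w) z u - Q u v • w - Q u w • v
        + (P u v w • X + G z v w • X' u) := by
    intro u v w
    have h5 := (h2.clm_apply (hasFDerivAt_const v z)).smul (hasFDerivAt_const w z)
    have h6 := (h2.clm_apply (hasFDerivAt_const w z)).smul (hasFDerivAt_const v z)
    have h7 := ((h4.clm_apply (hasFDerivAt_const v z)).clm_apply (hasFDerivAt_const w z)).smul h3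
    have h8 := (((h.hasFDerivAt_christoffel v w).sub h5).sub h6).add h7
    have h9 : (fun z' => christoffel (confMetric f G) z' v w) =ᶠ[𝓝 z] fun z' =>
        christoffel G z' v w - fderiv ℝ f z' v • w
        - fderiv ℝ f z' w • v + G z' v w • gradient' f G z' := by
      filter_upwards [h.eventually, hf.eventually_nhds] with z' k1 k2
      exact k1.christoffel_conf k2 v w
    have h10 := (h8.congr_of_eventuallyEq h9).fderiv
    rw [h10, h.fderiv_christoffel]
    simp
    abel
  have hcs : ∀ a b, Γ a b = christoffel G z a b := fun a b => christoffelL_apply G z a b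
  have hsym : ∀ a b, Γ a b = Γ b a := fun a b => by rw [hcs, hcs, h.christoffel_symm]
  -- The difference of the curvature operators, as a sum of operators with known traces.
  have hop : riemannOp (confMetric f G) z v w = riemannOp G z v w
      - (Q.flip v).smulRight w - (Q.flip w).smulRight v + ((P.flip v).flip w).smulRight X
      + G z v w • X' + (Q v).smulRight w + (Q v w) • ContinuousLinearMap.id ℝ (Eucl n)
      - ((P v).flip w).smulRight X - ((G z).flip w).smulRight (X' v)
      - d v • Γ.flip w - d w • Γ.flip v + G z v w • Γ.flip X
      - d.smulRight (Γ v w - d v • w - d w • v + G z v w • X)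
      - d (Γ v w - d v • w - d w • v + G z v w • X) • ContinuousLinearMap.id ℝ (Eucl n)
      + ((G z).flip (Γ v w - d v • w - d w • v + G z v w • X)).smulRight X
      + d.smulRight (Γ v w) + d w • Γ v - ((G z).flip w).smulRight (Γ v X)
      + d v • (Γ.flip w - d.smulRight w - d w • ContinuousLinearMap.id ℝ (Eucl n)
          + ((G z).flip w).smulRight X)
      + (d.comp (Γ.flip w) - d w • d - d w • d + d X • (G z).flip w).smulRight v
      - ((G z v).comp (Γ.flip w) - (G z v w) • d - d w • G z v
          + (G z v X) • (G z).flip w).smulRight X := by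
    ext1 u
    rw [hG.riemannOp_apply]
    simp only [_root_.add_apply, _root_.sub_apply, h.riemannOp_apply]
    rw [riemann, hder, hder, riemann]
    simp only [h.christoffel_conf hf, ← hcs, ← hd, ← hX, map_add, map_sub, map_smul]
    simp only [_root_.smul_apply, _root_.add_apply, _root_.sub_apply,
      ContinuousLinearMap.smulRight_apply, ContinuousLinearMap.flip_apply,
      ContinuousLinearMap.comp_apply, ContinuousLinearMap.id_apply, smul_eq_mul]
    module
  have htr : coordTrace (Γ.flip v) = coordTrace (Γ v) := by
    congr 1; ext1 a; exact hsym a v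
  have hcomp : ∀ a b c, P a b c = G z (Γ a b) c + G z b (Γ a c) := fun a b c => by
    rw [hcs, hcs]; exact h.fderiv_eq a b c
  have hgr : ∀ a, G z X a = d a := fun a => h.apply_gradient a
  have hgr' : ∀ a, G z a X = d a := fun a => by rw [h.self.symm]; exact hgr a
  have hgrad : ∀ a b, G z (X' a) b = Q a b - d (Γ a b) - G z (Γ a X) b := fun a b => by
    rw [hcs, hcs]; exact h.apply_fderiv_gradient hfs a b
  have hQs : ∀ a b, Q a b = Q b a := fun a b =>
    (hfs.isSymmSndFDerivAt (by simpa using ENat.LEInfty.out)).eq a b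
  rw [hG.ricci_eq_trace, h.ricci_eq_trace, hop]
  simp only [coordTrace_add, coordTrace_sub, coordTrace_smul, coordTrace_smulRight, coordTrace_id,
    ContinuousLinearMap.flip_apply, map_add, map_sub, map_smul, _root_.add_apply, _root_.sub_apply,
    _root_.smul_apply, ContinuousLinearMap.comp_apply, smul_eq_mul, hgr, hgr', htr, hcomp, hgrad,
    ← hcs]
  rw [hQs w v, hsym X v]
  ring

/-- The conformal change of the Schouten tensor. -/
theorem MetricNear.schoutenMatrix_conf (hn : 3 ≤ n) (h : MetricNear G z)
    (hf : ∀ᶠ z' in 𝓝 z, ContDiffAt ℝ ∞ f z') :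
    schoutenMatrix (confMetric f G) z = schoutenMatrix G z + formMatrix (confSchouten f G z) := by
  have hfs := hf.self_of_nhds
  set d := fderiv ℝ f z with hd
  set X := gradient' f G z with hX
  set M := metricMatrix G z with hM
  set T := fderiv ℝ (gradient' f G) z + (christoffelL G z).flip X with hT
  set Hs : Matrix (Fin n) (Fin n) ℝ := formMatrix fun v w => G z (T v) w with hHs
  set D : Matrix (Fin n) (Fin n) ℝ := formMatrix fun v w => G z (d.smulRight X v) w with hD
  have hTv : ∀ v w, G z (T v) w =
      fderiv ℝ (fderiv ℝ f) z v w - d (christoffel G z v w) := by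
    intro v w
    rw [hT, _root_.add_apply, map_add, _root_.add_apply, h.apply_fderiv_gradient hfs,
      ContinuousLinearMap.flip_apply, christoffelL_apply]
    ring
  have hDv : ∀ v w, G z (d.smulRight X v) w = d v * d w := by
    intro v w
    simp [hX, h.apply_gradient, hd]
  have hdet : IsUnit M.det := (Matrix.isUnit_iff_isUnit_det _).1 h.self.posDef.isUnit
  have htr1 : (M⁻¹ * Hs).trace = coordTrace T := h.self.trace_inv_mul T
  have htr2 : (M⁻¹ * D).trace = d X := by
    rw [← coordTrace_smulRight d X]; exact h.self.trace_inv_mul _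
  have htr3 : (M⁻¹ * M).trace = n := by
    rw [nonsing_inv_mul _ hdet, trace_one, Fintype.card_fin]
  set c := Real.exp (-2 * f z) with hc
  have hc0 : c ≠ 0 := (Real.exp_pos _).ne'
  have hM' : metricMatrix (confMetric f G) z = c • M := by
    ext a b; simp [metricMatrix, hM, confMetric, hc]
  -- `Hs` is the Hessian of `f` with respect to `G`, `D = df ⊗ df`, and `coordTrace T` is the Laplacian.
  have hR' : ricciMatrix (confMetric f G) z = ricciMatrix G z
      + ((n : ℝ) - 2) • (Hs + D - d X • M) + coordTrace T • M := by
    ext a b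
    simp only [ricciMatrix_apply, h.ricci_conf hf, Matrix.add_apply, Matrix.smul_apply,
      Matrix.sub_apply, smul_eq_mul]
    simp only [hHs, hD, formMatrix, hTv, hDv, of_apply, hM, metricMatrix]
    ring
  have hS' : scalarCurv (confMetric f G) z = c⁻¹ * (scalarCurv G z
      + ((n : ℝ) - 2) * (coordTrace T + d X - n * d X) + n * coordTrace T) := by
    have : (c • M)⁻¹ = c⁻¹ • M⁻¹ := by
      refine inv_eq_left_inv ?_
      rw [smul_mul_smul_comm, inv_mul_cancel₀ hc0, nonsing_inv_mul _ hdet, one_smul]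
    rw [scalarCurv, hM', hR', this]
    simp only [Matrix.smul_mul, Matrix.mul_add, Matrix.mul_sub, Matrix.mul_smul, trace_smul,
      trace_add, trace_sub, htr1, htr2, htr3, scalarCurv, ← hM, smul_eq_mul]
    ring
  have hn2 : (n : ℝ) - 2 ≠ 0 := by
    have : (3 : ℝ) ≤ n := by exact_mod_cast hn
    linarith
  have hn1 : (n : ℝ) - 1 ≠ 0 := by
    have : (3 : ℝ) ≤ n := by exact_mod_cast hn
    linarith
  rw [schoutenMatrix, schoutenMatrix, hM', hR', hS']
  ext a b
  simp only [Matrix.add_apply, Matrix.smul_apply, Matrix.sub_apply, smul_eq_mul, ← hM]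
  have hconf : formMatrix (confSchouten f G z) a b = Hs a b + D a b - (1 / 2) * d X * M a b := by
    simp only [hHs, hD, formMatrix, hTv, hDv, of_apply, hM, metricMatrix, confSchouten,
      ← hd, ← hX]
  rw [hconf]
  field_simp
  ring

end Conformal

/-! ### The curvature as a continuous function of the `2`-jet of the metric -/

section Jets

set_option maxSynthPendingDepth 3

open Matrix

variable {n : ℕ}

/-- The space of `2`-jets of metrics at a point. -/
abbrev MetricJet (n : ℕ) : Type :=
  BilinForm n × (Eucl n →L[ℝ] BilinForm n) × (Eucl n →L[ℝ] Eucl n →L[ℝ] BilinForm n)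

/-- The `2`-jet of `G` at `z`. -/
noncomputable def metricJet (G : Eucl n → BilinForm n) (z : Eucl n) : MetricJet n :=
  (G z, fderiv ℝ G z, fderiv ℝ (fderiv ℝ G) z)

namespace MetricJet

/-- The Christoffel symbols of a jet. -/
noncomputable def chr (J : MetricJet n) (u v : Eucl n) : Eucl n :=
  J.1.inverse (koszulL J.2.1 u v)

/-- The first derivatives of the Christoffel symbols of a jet. -/
noncomputable def dchr (J : MetricJet n) (u v w : Eucl n) : Eucl n :=
  J.1.inverse (koszulL (J.2.2 u) v w - J.2.1 u (J.chr v w))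

/-- The Riemann tensor of a jet. -/
noncomputable def riem (J : MetricJet n) (u v w : Eucl n) : Eucl n :=
  J.dchr u v w - J.dchr v u w + J.chr u (J.chr v w) - J.chr v (J.chr u w)

/-- The matrix of the metric of a jet. -/
noncomputable def metric (J : MetricJet n) : Matrix (Fin n) (Fin n) ℝ := formMatrix fun u v => J.1 u v

/-- The Ricci matrix of a jet. -/
noncomputable def ric (J : MetricJet n) : Matrix (Fin n) (Fin n) ℝ :=
  formMatrix fun v w => ∑ i, J.riem (coordVec n i) v w i

/-- The Schouten matrix of a jet. -/
noncomputable def schouten (J : MetricJet n) : Matrix (Fin n) (Fin n) ℝ :=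
  (1 / ((n : ℝ) - 2)) • (J.ric - ((J.metric⁻¹ * J.ric).trace / (2 * ((n : ℝ) - 1))) • J.metric)

end MetricJet

theorem MetricNear.schouten_metricJet {G : Eucl n → BilinForm n} {z : Eucl n}
    (h : MetricNear G z) : (metricJet G z).schouten = schoutenMatrix G z := by
  have h1 : ∀ u v, (metricJet G z).chr u v = christoffel G z u v := fun u v => by
    rw [← christoffelL_apply]; rfl
  have h2 : ∀ u v w, (metricJet G z).dchr u v w = fderiv ℝ (christoffelL G) z u v w := by
    intro u v w
    refine h.self.ext fun a => ?_
    rw [h.apply_fderiv_christoffelL, ← h1]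
    have := congrArg (fun ξ : Eucl n →L[ℝ] ℝ => ξ a) (h.self.apply_inverse
      (koszulL ((metricJet G z).2.2 u) v w - (metricJet G z).2.1 u ((metricJet G z).chr v w)))
    exact this
  have h3 : ∀ u v w, (metricJet G z).riem u v w = riemann G z u v w := by
    intro u v w
    rw [h.riemann_eq]
    simp only [MetricJet.riem, h1, h2, christoffelL_apply]
  have h4 : (metricJet G z).ric = ricciMatrix G z := by
    rw [MetricJet.ric, ricciMatrix_eq]
    simp only [h3]
    rfl
  rw [MetricJet.schouten, schoutenMatrix, scalarCurv, h4]
  rfl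

theorem continuous_koszulL : Continuous (koszulL : (Eucl n →L[ℝ] BilinForm n) → _) := by
  have h2 : Continuous (fun P : Eucl n →L[ℝ] BilinForm n => P.flip) :=
    (ContinuousLinearMap.flipₗᵢ ℝ (Eucl n) (Eucl n) (Eucl n →L[ℝ] ℝ)).continuous
  have h3 : Continuous (fun P : Eucl n →L[ℝ] BilinForm n =>
      (ContinuousLinearMap.flipₗᵢ ℝ (Eucl n) (Eucl n) ℝ).toContinuousLinearEquiv.toContinuousLinearMap.comp
        P.flip) := continuous_const.clm_comp h2
  exact ((continuous_id.add h2).sub h3).const_smul (1 / 2 : ℝ)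

section

variable {J : MetricJet n}

theorem continuousAt_inverse (h : IsInner J.1) :
    ContinuousAt (fun J : MetricJet n => J.1.inverse) J := by
  obtain ⟨e, he⟩ := h.isInvertible
  have := (contDiffAt_map_inverse (n := 0) (𝕜 := ℝ) e).continuousAt
  rw [he] at this
  exact ContinuousAt.comp (f := fun J : MetricJet n => J.1) this continuousAt_fst

theorem continuousAt_chr (h : IsInner J.1) {u v : MetricJet n → Eucl n} (hu : ContinuousAt u J)
    (hv : ContinuousAt v J) : ContinuousAt (fun J => J.chr (u J) (v J)) J := by
  have h1 : ContinuousAt (fun J : MetricJet n => koszulL J.2.1) J :=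
    continuous_koszulL.continuousAt.comp (continuous_fst.comp continuous_snd).continuousAt
  exact (continuousAt_inverse h).clm_apply ((h1.clm_apply hu).clm_apply hv)

theorem continuousAt_dchr (h : IsInner J.1) (u v w : Eucl n) :
    ContinuousAt (fun J => J.dchr u v w) J := by
  have h1 : ContinuousAt (fun J : MetricJet n => koszulL (J.2.2 u)) J :=
    continuous_koszulL.continuousAt.comp
      ((continuous_snd.comp continuous_snd).clm_apply continuous_const).continuousAt
  have h2 : ContinuousAt (fun J : MetricJet n => J.2.1) J :=
    (continuous_fst.comp continuous_snd).continuousAt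
  exact (continuousAt_inverse h).clm_apply
    (((h1.clm_apply continuousAt_const).clm_apply continuousAt_const).sub
      ((h2.clm_apply continuousAt_const).clm_apply
        (continuousAt_chr h continuousAt_const continuousAt_const)))

theorem continuousAt_riem (h : IsInner J.1) (u v w : Eucl n) :
    ContinuousAt (fun J => J.riem u v w) J :=
  (((continuousAt_dchr h u v w).sub (continuousAt_dchr h v u w)).add
    (continuousAt_chr h continuousAt_const
      (continuousAt_chr h continuousAt_const continuousAt_const))).sub
    (continuousAt_chr h continuousAt_const
      (continuousAt_chr h continuousAt_const continuousAt_const))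

theorem continuous_metric : Continuous (MetricJet.metric : MetricJet n → _) :=
  continuous_matrix fun _ _ =>
    (continuous_fst.clm_apply continuous_const).clm_apply continuous_const

theorem continuousAt_matrix {X : Type*} [TopologicalSpace X] {x : X}
    {F : X → Matrix (Fin n) (Fin n) ℝ} (h : ∀ a b, ContinuousAt (fun x => F x a b) x) :
    ContinuousAt F x :=
  continuousAt_pi.2 fun a => continuousAt_pi.2 fun b => h a b

theorem continuousAt_ric (h : IsInner J.1) : ContinuousAt (fun J => J.ric) J := by
  refine continuousAt_matrix fun a b => ?_
  have key : ∀ i ∈ (Finset.univ : Finset (Fin n)), ContinuousAt (fun J : MetricJet n =>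
      (J.riem (coordVec n i) (coordVec n a) (coordVec n b) i : ℝ)) J := fun i _ =>
    ContinuousAt.comp (g := fun v : Eucl n => (v i : ℝ))
      (f := fun J : MetricJet n => J.riem (coordVec n i) (coordVec n a) (coordVec n b))
      (EuclideanSpace.proj (𝕜 := ℝ) i).continuous.continuousAt (continuousAt_riem h _ _ _)
  exact tendsto_finsetSum (M := ℝ) _ key

theorem IsInner.isUnit_det (h : IsInner J.1) : IsUnit J.metric.det :=
  (Matrix.isUnit_iff_isUnit_det _).1 h.posDef.isUnit

theorem continuousAt_metric_inv (h : IsInner J.1) : ContinuousAt (fun J => J.metric⁻¹) J := by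
  have h1 : ContinuousAt (fun J : MetricJet n => J.metric.det) J :=
    continuous_metric.matrix_det.continuousAt
  have h2 : ContinuousAt (fun J : MetricJet n => (J.metric.det)⁻¹ • J.metric.adjugate) J :=
    (h1.inv₀ h.isUnit_det.ne_zero).smul continuous_metric.matrix_adjugate.continuousAt
  simpa only [Matrix.inv_def, Ring.inverse_eq_inv'] using h2

theorem continuousAt_schouten (h : IsInner J.1) : ContinuousAt (fun J => J.schouten) J := by
  have h1 : ContinuousAt (fun J : MetricJet n => (J.metric⁻¹ * J.ric).trace) J := by
    have h2 : ContinuousAt (fun J : MetricJet n => J.metric⁻¹ * J.ric) J :=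
      (continuousAt_metric_inv h).mul (continuousAt_ric h)
    exact ContinuousAt.comp (g := Matrix.trace) (continuous_id.matrix_trace).continuousAt h2
  exact ((continuousAt_ric h).sub ((h1.div_const _).smul continuous_metric.continuousAt)).const_smul
    (1 / ((n : ℝ) - 2))

end

/-- `σ_j` is a continuous function of the jet of the metric. -/
theorem MetricNear.sigmaCoord_eq {G : Eucl n → BilinForm n} {z : Eucl n}
    (h : MetricNear G z) {j : ℕ} (hj : j ≤ n) :
    sigmaCoord G j z = minorSum j ((metricJet G z).metric⁻¹ * (metricJet G z).schouten) := by
  have hA : (schoutenMatrix G z).IsHermitian := by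
    rw [schoutenMatrix]
    exact ((formMatrix_isHermitian h.ricci_symm).sub
      ((formMatrix_isHermitian h.self.symm).smul (IsSelfAdjoint.all _))).smul (IsSelfAdjoint.all _)
  rw [sigmaCoord, h.schouten_metricJet]
  exact esymm_roots_charpoly_inv_mul' h.self.posDef hA (by simpa using hj)

theorem MetricNear.schoutenMatrix_isHermitian {G : Eucl n → BilinForm n} {z : Eucl n}
    (h : MetricNear G z) : (schoutenMatrix G z).IsHermitian := by
  rw [schoutenMatrix]
  exact ((formMatrix_isHermitian h.ricci_symm).sub
    ((formMatrix_isHermitian h.self.symm).smul (IsSelfAdjoint.all _))).smul (IsSelfAdjoint.all _)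

theorem MetricNear.continuousAt_metricJet {G : Eucl n → BilinForm n} {z : Eucl n}
    (h : MetricNear G z) : ContinuousAt (metricJet G) z :=
  h.smooth.continuousAt.prodMk (h.smooth_fderiv.continuousAt.prodMk
    (h.smooth_fderiv.fderiv_right (m := ∞) (by simp)).continuousAt)

theorem MetricNear.continuousAt_sigmaCoord {G : Eucl n → BilinForm n} {z : Eucl n}
    (h : MetricNear G z) {j : ℕ} (hj : j ≤ n) : ContinuousAt (sigmaCoord G j) z := by
  have h1 : ContinuousAt (fun J : MetricJet n => minorSum j (J.metric⁻¹ * J.schouten))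
      (metricJet G z) :=
    (continuous_minorSum j).continuousAt.comp
      ((continuousAt_metric_inv h.self).mul (continuousAt_schouten h.self))
  refine (ContinuousAt.comp h1 h.continuousAt_metricJet).congr ?_
  filter_upwards [h.eventually] with z' hz'
  exact (hz'.sigmaCoord_eq hj).symm

/-- The jets of metrics with eigenvalues at least `1 / Λ` and coefficients bounded by `Λ` in
`C²`. -/
def boundedJets (n : ℕ) (Λ : ℝ) : Set (MetricJet n) :=
  {J | (∀ u v, J.1 u v = J.1 v u) ∧ (∀ v, ‖v‖ ^ 2 ≤ Λ * J.1 v v) ∧ ‖J.1‖ ≤ Λ ∧ ‖J.2.1‖ ≤ Λ ∧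
    ‖J.2.2‖ ≤ Λ}

theorem isInner_of_mem_boundedJets {Λ : ℝ} (hΛ : 0 < Λ) {J : MetricJet n}
    (h : J ∈ boundedJets n Λ) : IsInner J.1 := by
  refine ⟨h.1, fun v hv => ?_⟩
  have h1 := h.2.1 v
  have h2 : 0 < ‖v‖ ^ 2 := by positivity
  exact pos_of_mul_pos_right (h2.trans_le h1) hΛ.le

theorem isClosed_boundedJets (n : ℕ) (Λ : ℝ) : IsClosed (boundedJets n Λ) := by
  have happ : ∀ u v, Continuous fun J : MetricJet n => J.1 u v := fun u v =>
    (continuous_fst.clm_apply continuous_const).clm_apply continuous_const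
  have h1 : IsClosed {J : MetricJet n | ∀ u v, J.1 u v = J.1 v u} := by
    simp only [Set.ofPred_forall]
    exact isClosed_iInter fun u => isClosed_iInter fun v => isClosed_eq (happ u v) (happ v u)
  have h2 : IsClosed {J : MetricJet n | ∀ v, ‖v‖ ^ 2 ≤ Λ * J.1 v v} := by
    simp only [Set.ofPred_forall]
    exact isClosed_iInter fun v => isClosed_le continuous_const (continuous_const.mul (happ v v))
  have h3 : IsClosed {J : MetricJet n | ‖J.1‖ ≤ Λ} := isClosed_le continuous_fst.norm continuous_const
  have h4 : IsClosed {J : MetricJet n | ‖J.2.1‖ ≤ Λ} :=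
    isClosed_le (continuous_fst.comp continuous_snd).norm continuous_const
  have h5 : IsClosed {J : MetricJet n | ‖J.2.2‖ ≤ Λ} :=
    isClosed_le (f := fun J : MetricJet n => ‖J.2.2‖) (g := fun _ => Λ)
      (Continuous.norm (E := Eucl n →L[ℝ] Eucl n →L[ℝ] BilinForm n)
        (continuous_snd.comp continuous_snd)) continuous_const
  exact h1.inter (h2.inter (h3.inter (h4.inter h5)))

instance : ProperSpace (BilinForm n) := FiniteDimensional.proper ℝ (BilinForm n)

instance : ProperSpace (Eucl n →L[ℝ] BilinForm n) :=
  FiniteDimensional.proper ℝ (Eucl n →L[ℝ] BilinForm n)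

set_option synthInstance.maxHeartbeats 100000 in
instance : FiniteDimensional ℝ (Eucl n →L[ℝ] Eucl n →L[ℝ] BilinForm n) :=
  ContinuousLinearMap.finiteDimensional (E := Eucl n) (F := Eucl n →L[ℝ] BilinForm n)

instance : ProperSpace (Eucl n →L[ℝ] Eucl n →L[ℝ] BilinForm n) :=
  FiniteDimensional.proper ℝ (Eucl n →L[ℝ] Eucl n →L[ℝ] BilinForm n)

theorem isCompact_prod_norm_le {E F H : Type*} [NormedAddCommGroup E] [ProperSpace E]
    [NormedAddCommGroup F] [ProperSpace F] [NormedAddCommGroup H] [ProperSpace H] (c : ℝ) :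
    IsCompact {p : E × F × H | ‖p.1‖ ≤ c ∧ ‖p.2.1‖ ≤ c ∧ ‖p.2.2‖ ≤ c} := by
  convert (isCompact_closedBall (0 : E) c).prod
    ((isCompact_closedBall (0 : F) c).prod (isCompact_closedBall (0 : H) c)) using 1
  ext p
  simp

theorem isCompact_boundedJets (n : ℕ) (Λ : ℝ) : IsCompact (boundedJets n Λ) :=
  IsCompact.of_isClosed_subset (isCompact_prod_norm_le (E := BilinForm n)
    (F := Eucl n →L[ℝ] BilinForm n) (H := Eucl n →L[ℝ] Eucl n →L[ℝ] BilinForm n) Λ)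
    (isClosed_boundedJets n Λ) fun _ hJ => hJ.2.2

/-- The Schouten tensor is bounded in terms of the `C²` norm of the metric. -/
theorem exists_schouten_bound (n : ℕ) {Λ : ℝ} (hΛ : 0 < Λ) :
    ∃ C, 0 < C ∧ ∀ J ∈ boundedJets n Λ, ∀ x : Fin n → ℝ,
      -(C * ∑ i, x i ^ 2) ≤ x ⬝ᵥ J.schouten *ᵥ x := by
  have hb : ∀ a b : Fin n, ∃ C, ∀ J ∈ boundedJets n Λ, ‖J.schouten a b‖ ≤ C := by
    intro a b
    refine (isCompact_boundedJets n Λ).exists_bound_of_continuousOn fun J hJ => ?_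
    have h1 := continuousAt_schouten (isInner_of_mem_boundedJets hΛ hJ)
    exact ((continuous_apply_apply a b).continuousAt.comp h1).continuousWithinAt
  choose C hC using hb
  refine ⟨1 + ∑ a, ∑ b, |C a b|, by positivity, fun J hJ x => ?_⟩
  have h1 : ∀ a b, -(|C a b| * ∑ i, x i ^ 2) ≤ x a * (J.schouten a b * x b) := by
    intro a b
    have h2 : |J.schouten a b| ≤ |C a b| := (hC a b J hJ).trans (le_abs_self _)
    have h3 : |x a * x b| ≤ ∑ i, x i ^ 2 := by
      have ha := Finset.single_le_sum (f := fun i => x i ^ 2) (fun i _ => sq_nonneg _)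
        (Finset.mem_univ a)
      have hb := Finset.single_le_sum (f := fun i => x i ^ 2) (fun i _ => sq_nonneg _)
        (Finset.mem_univ b)
      rw [abs_mul]
      nlinarith [sq_nonneg (|x a| - |x b|), sq_abs (x a), sq_abs (x b)]
    have h4 : |x a * (J.schouten a b * x b)| ≤ |C a b| * ∑ i, x i ^ 2 := by
      rw [show x a * (J.schouten a b * x b) = J.schouten a b * (x a * x b) by ring, abs_mul]
      exact mul_le_mul h2 h3 (abs_nonneg _) (abs_nonneg _)
    exact (abs_le.1 h4).1
  have h5 : x ⬝ᵥ J.schouten *ᵥ x = ∑ a, ∑ b, x a * (J.schouten a b * x b) := by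
    simp [dotProduct, mulVec, Finset.mul_sum]
  rw [h5]
  have h6 : 0 ≤ ∑ i, x i ^ 2 := Finset.sum_nonneg fun i _ => sq_nonneg _
  calc -((1 + ∑ a, ∑ b, |C a b|) * ∑ i, x i ^ 2)
      ≤ -((∑ a, ∑ b, |C a b|) * ∑ i, x i ^ 2) := by nlinarith
    _ = ∑ a, ∑ b, -(|C a b| * ∑ i, x i ^ 2) := by
        rw [Finset.sum_mul, ← Finset.sum_neg_distrib]
        refine Finset.sum_congr rfl fun a _ => ?_
        rw [Finset.sum_mul, ← Finset.sum_neg_distrib]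
    _ ≤ _ := Finset.sum_le_sum fun a _ => Finset.sum_le_sum fun b _ => h1 a b

/-- A metric with `σ_j ≥ δ` and bounded jets stays in the cone `Γ_m` when a small multiple of the
metric is subtracted from its Schouten tensor. -/
theorem exists_schouten_margin (n m : ℕ) {Λ δ : ℝ} (hΛ : 0 < Λ) (hδ : 0 < δ) :
    ∃ τ : ℝ, 0 < τ ∧ ∀ J ∈ boundedJets n Λ,
      (∀ j, 1 ≤ j → j ≤ m → δ ≤ minorSum j (J.metric⁻¹ * J.schouten)) →
      ∀ j, 1 ≤ j → j ≤ m → 0 < minorSum j (J.metric⁻¹ * (J.schouten - τ • J.metric)) := by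
  set K : Set (MetricJet n) := boundedJets n Λ ∩
    {J | ∀ j, 1 ≤ j → j ≤ m → δ ≤ minorSum j (J.metric⁻¹ * J.schouten)} with hK
  have hcont : ∀ J ∈ boundedJets n Λ, ∀ j,
      ContinuousAt (fun J : MetricJet n => minorSum j (J.metric⁻¹ * J.schouten)) J := by
    intro J hJ j
    have h := isInner_of_mem_boundedJets hΛ hJ
    exact (continuous_minorSum j).continuousAt.comp
      ((continuousAt_metric_inv h).mul (continuousAt_schouten h))
  have hKc : IsCompact K := by
    have h1 : K = boundedJets n Λ ∩ ⋂ j ∈ Finset.Icc 1 m, (boundedJets n Λ ∩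
        (fun J : MetricJet n => minorSum j (J.metric⁻¹ * J.schouten)) ⁻¹' Ici δ) := by
      ext J
      simp only [hK, mem_inter_iff, mem_iInter, Finset.mem_Icc, mem_preimage, mem_Ici]
      constructor
      · rintro ⟨h1, h2⟩
        exact ⟨h1, fun j hj => ⟨h1, h2 j hj.1 hj.2⟩⟩
      · rintro ⟨h1, h2⟩
        exact ⟨h1, fun j hj1 hj2 => (h2 j ⟨hj1, hj2⟩).2⟩
    rw [h1]
    refine (isCompact_boundedJets n Λ).inter_right
      (isClosed_biInter fun j _ => ?_)
    exact ContinuousOn.preimage_isClosed_of_isClosed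
      (fun J hJ => (hcont J hJ j).continuousWithinAt) (isClosed_boundedJets n Λ) isClosed_Ici
  -- The condition is open in `(τ, J)` and holds for `τ = 0` on the compact set `K`.
  have hev : ∀ᶠ τ : ℝ in 𝓝 0, ∀ J ∈ K, ∀ j ∈ Finset.Icc 1 m,
      0 < minorSum j (J.metric⁻¹ * (J.schouten - τ • J.metric)) := by
    refine hKc.eventually_forall_of_forall_eventually fun J hJ => ?_
    rw [Filter.eventually_all_finset]
    intro j hj
    have h := isInner_of_mem_boundedJets hΛ hJ.1
    have hpos : 0 < minorSum j (J.metric⁻¹ * (J.schouten - (0 : ℝ) • J.metric)) := by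
      rw [zero_smul, sub_zero]
      exact hδ.trans_le (hJ.2 j (Finset.mem_Icc.1 hj).1 (Finset.mem_Icc.1 hj).2)
    have hca : ContinuousAt (fun q : ℝ × MetricJet n =>
        minorSum j (q.2.metric⁻¹ * (q.2.schouten - q.1 • q.2.metric))) (0, J) := by
      have c1 : ContinuousAt (fun q : ℝ × MetricJet n => q.2.metric⁻¹) (0, J) :=
        ContinuousAt.comp (f := Prod.snd) (g := fun J : MetricJet n => J.metric⁻¹)
          (continuousAt_metric_inv h) continuousAt_snd
      have c2 : ContinuousAt (fun q : ℝ × MetricJet n => q.2.schouten) (0, J) :=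
        ContinuousAt.comp (f := Prod.snd) (g := fun J : MetricJet n => J.schouten)
          (continuousAt_schouten h) continuousAt_snd
      have c3 : ContinuousAt (fun q : ℝ × MetricJet n => q.2.metric) (0, J) :=
        (continuous_metric.comp continuous_snd).continuousAt
      exact (continuous_minorSum j).continuousAt.comp (c1.mul (c2.sub (continuousAt_fst.smul c3)))
    exact hca.eventually_const_lt hpos
  obtain ⟨τ, hτ, hball⟩ := Metric.eventually_nhds_iff.1 hev
  refine ⟨τ / 2, by positivity, fun J hJ hJ' j hj1 hj2 => ?_⟩
  refine hball ?_ J ⟨hJ, hJ'⟩ j (Finset.mem_Icc.2 ⟨hj1, hj2⟩)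
  rw [Real.dist_eq, sub_zero, abs_of_pos (by positivity)]
  linarith

end Jets

/-! ### Conformal factors on the neck -/

section Factors

set_option maxSynthPendingDepth 3

variable {n : ℕ}

theorem euclForm_apply (u v : Eucl n) : euclForm n u v = inner ℝ u v := rfl

/-- The function `f` for which `e^{-2f} = (1 + σ p)^{2/w}`. -/
noncomputable def logFactor (w σ : ℝ) (p : Eucl n → ℝ) (z : Eucl n) : ℝ :=
  -(1 / w) * Real.log (1 + σ * p z)

/-- The function `|z|^{-2w}`. -/
noncomputable def radialPow (w : ℝ) (z : Eucl n) : ℝ := (‖z‖ ^ 2) ^ (-w)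

variable {w σ : ℝ} {p : Eucl n → ℝ} {z : Eucl n}

theorem contDiffAt_logFactor (hp : ContDiffAt ℝ ∞ p z) (h1 : 0 < 1 + σ * p z) :
    ContDiffAt ℝ ∞ (logFactor w σ p) z :=
  contDiffAt_const.mul ((contDiffAt_const.add (contDiffAt_const.mul hp)).log h1.ne')

theorem fderiv_logFactor (hp : ContDiffAt ℝ ∞ p z) (h1 : 0 < 1 + σ * p z) :
    fderiv ℝ (logFactor w σ p) z = (-(σ / w) * (1 + σ * p z)⁻¹) • fderiv ℝ p z := by
  have h2 := (hp.differentiableAt (by simp)).hasFDerivAt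
  have h3 : HasFDerivAt (logFactor w σ p) _ z :=
    (((h2.const_mul σ).const_add 1).log h1.ne').const_mul (-(1 / w))
  rw [h3.fderiv, smul_smul, smul_smul]
  congr 1
  ring

theorem fderiv_fderiv_logFactor (hp : ∀ᶠ z' in 𝓝 z, ContDiffAt ℝ ∞ p z') (h1 : 0 < 1 + σ * p z)
    (u v : Eucl n) :
    fderiv ℝ (fderiv ℝ (logFactor w σ p)) z u v =
      -(σ / w) * ((1 + σ * p z)⁻¹ * fderiv ℝ (fderiv ℝ p) z u v
        - σ * ((1 + σ * p z)⁻¹) ^ 2 * (fderiv ℝ p z u * fderiv ℝ p z v)) := by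
  have hps := hp.self_of_nhds
  have h2 := (hps.differentiableAt (by simp)).hasFDerivAt
  have h3 : HasFDerivAt (fderiv ℝ p) (fderiv ℝ (fderiv ℝ p) z) z :=
    ((hps.fderiv_right (m := ∞) (by simp)).differentiableAt (by simp)).hasFDerivAt
  have hinv : HasFDerivAt (fun z' => (1 + σ * p z')⁻¹)
      ((-((1 + σ * p z) ^ 2)⁻¹) • (σ • fderiv ℝ p z)) z :=
    (hasDerivAt_inv h1.ne').comp_hasFDerivAt z ((h2.const_mul σ).const_add 1)
  have h4 := (hinv.const_mul (-(σ / w))).smul h3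
  have h5 : fderiv ℝ (logFactor w σ p) =ᶠ[𝓝 z]
      fun z' => (-(σ / w) * (1 + σ * p z')⁻¹) • fderiv ℝ p z' := by
    have hc : ContinuousAt (fun z' => 1 + σ * p z') z :=
      continuousAt_const.add (continuousAt_const.mul hps.continuousAt)
    filter_upwards [hp, hc.eventually_const_lt h1] with z' k1 k2
    exact fderiv_logFactor k1 k2
  rw [h5.fderiv_eq]
  have h6 : fderiv ℝ (fun z' => (-(σ / w) * (1 + σ * p z')⁻¹) • fderiv ℝ p z') z = _ := h4.fderiv
  rw [h6]
  simp
  ring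

theorem contDiffAt_radialPow (hz : z ≠ 0) : ContDiffAt ℝ ∞ (radialPow w) z := by
  have h : ‖z‖ ^ 2 ≠ 0 := by positivity
  exact ContDiffAt.rpow_const_of_ne (contDiffAt_id.norm_sq ℝ) h

theorem fderiv_radialPow (hz : z ≠ 0) :
    fderiv ℝ (radialPow w) z = (-(2 * w) * (‖z‖ ^ 2) ^ (-w - 1)) • euclForm n z := by
  have h : ‖z‖ ^ 2 ≠ 0 := by positivity
  have h1 := (hasStrictFDerivAt_norm_sq (F := Eucl n) z).hasFDerivAt
  have h2 : HasFDerivAt (radialPow w) _ z := h1.rpow_const (p := -w) (Or.inl h)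
  rw [h2.fderiv]
  ext v
  simp [euclForm_apply]
  ring

theorem fderiv_fderiv_radialPow (hz : z ≠ 0) (u v : Eucl n) :
    fderiv ℝ (fderiv ℝ (radialPow w)) z u v =
      -(2 * w) * (‖z‖ ^ 2) ^ (-w - 1) * inner ℝ u v
        + 4 * w * (w + 1) * (‖z‖ ^ 2) ^ (-w - 2) * (inner ℝ z u * inner ℝ z v) := by
  have h : ‖z‖ ^ 2 ≠ 0 := by positivity
  have h1 := (hasStrictFDerivAt_norm_sq (F := Eucl n) z).hasFDerivAt
  have h2 := h1.rpow_const (p := -w - 1) (Or.inl h)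
  have h3 := (h2.const_mul (-(2 * w))).smul (euclForm n).hasFDerivAt (x := z)
  have h4 : fderiv ℝ (radialPow w) =ᶠ[𝓝 z]
      fun z' : Eucl n => (-(2 * w) * (‖z'‖ ^ 2) ^ (-w - 1)) • euclForm n z' := by
    filter_upwards [isOpen_ne.mem_nhds hz] with z' hz'
    exact fderiv_radialPow hz'
  rw [h4.fderiv_eq]
  have h6 : fderiv ℝ (fun z' : Eucl n => (-(2 * w) * (‖z'‖ ^ 2) ^ (-w - 1)) • euclForm n z') z = _ :=
    h3.fderiv
  rw [h6]
  simp only [_root_.add_apply, _root_.smul_apply, ContinuousLinearMap.smulRight_apply, smul_eq_mul,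
    show -w - 1 - 1 = -w - 2 by ring]
  simp [euclForm_apply]
  ring

end Factors

/-! ### Lower bounds for the conformal change of the Schouten tensor -/

section Bounds

set_option maxSynthPendingDepth 3

open Matrix

variable {n : ℕ} {f : Eucl n → ℝ} {G : Eucl n → BilinForm n} {z : Eucl n}

/-- The term of the Hessian of `f` that involves first derivatives of the metric. -/
theorem MetricNear.fderiv_christoffel_le (h : MetricNear G z) (v : Eucl n) :
    |fderiv ℝ f z (christoffel G z v v)| ≤
      3 / 2 * ‖fderiv ℝ G z‖ * ‖gradient' f G z‖ * ‖v‖ ^ 2 := by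
  rw [← h.apply_gradient, h.self.symm, h.apply_christoffel]
  have hb : ∀ a b c : Eucl n, |fderiv ℝ G z a b c| ≤ ‖fderiv ℝ G z‖ * ‖a‖ * ‖b‖ * ‖c‖ := by
    intro a b c
    refine ((fderiv ℝ G z a b).le_opNorm c).trans ?_
    gcongr
    refine ((fderiv ℝ G z a).le_opNorm b).trans ?_
    gcongr
    exact (fderiv ℝ G z).le_opNorm a
  have h1 := abs_le.1 (hb v v (gradient' f G z))
  have h2 := abs_le.1 (hb (gradient' f G z) v v)
  rw [abs_le]
  constructor <;> nlinarith [h1.1, h1.2, h2.1, h2.2]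

/-- A conformal factor with small first and second derivatives changes the Schouten tensor by little. -/
theorem MetricNear.confSchouten_ge (h : MetricNear G z) {Λ : ℝ} (hΛ : 0 < Λ)
    (hJ : metricJet G z ∈ boundedJets n Λ) {c : ℝ} (hc1 : c ≤ 1) (h1 : ‖fderiv ℝ f z‖ ≤ c)
    (h2 : ‖fderiv ℝ (fderiv ℝ f) z‖ ≤ c) (v : Eucl n) :
    -(c * (1 + 2 * Λ ^ 2) * ‖v‖ ^ 2) ≤ confSchouten f G z v v := by
  have hc0 : 0 ≤ c := (norm_nonneg _).trans h1
  set X := gradient' f G z with hX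
  set d := fderiv ℝ f z with hd
  have hdX : d X ≤ c * ‖X‖ :=
    (le_abs_self _).trans ((d.le_opNorm X).trans (by gcongr))
  have hX1 : ‖X‖ ^ 2 ≤ Λ * d X := by
    have := hJ.2.1 X
    rwa [show (metricJet G z).1 X X = d X from h.apply_gradient X] at this
  -- `|X|² ≤ Λ G(X, X) = Λ df(X) ≤ Λ c |X|`
  have hXn : ‖X‖ ≤ Λ * c := by
    by_contra hlt
    push Not at hlt
    have : 0 < ‖X‖ := lt_of_le_of_lt (by positivity) hlt
    nlinarith
  have hG : G z v v ≤ Λ * ‖v‖ ^ 2 := by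
    have : ‖G z‖ ≤ Λ := hJ.2.2.1
    calc G z v v ≤ ‖G z v v‖ := le_abs_self _
      _ ≤ ‖G z‖ * ‖v‖ * ‖v‖ := (G z).le_opNorm₂ v v
      _ ≤ Λ * ‖v‖ * ‖v‖ := by gcongr
      _ = _ := by ring
  have hP : ‖fderiv ℝ G z‖ ≤ Λ := hJ.2.2.2.1
  have hΓ := h.fderiv_christoffel_le (f := f) v
  have hΓ' : d (christoffel G z v v) ≤ 3 / 2 * Λ * (Λ * c) * ‖v‖ ^ 2 :=
    ((le_abs_self _).trans hΓ).trans (by gcongr)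
  have hQ : -(c * ‖v‖ ^ 2) ≤ fderiv ℝ (fderiv ℝ f) z v v := by
    have : |fderiv ℝ (fderiv ℝ f) z v v| ≤ c * ‖v‖ ^ 2 := by
      calc |fderiv ℝ (fderiv ℝ f) z v v| ≤ ‖fderiv ℝ (fderiv ℝ f) z‖ * ‖v‖ * ‖v‖ :=
            (fderiv ℝ (fderiv ℝ f) z).le_opNorm₂ v v
        _ ≤ c * ‖v‖ * ‖v‖ := by gcongr
        _ = _ := by ring
    exact (abs_le.1 this).1
  have hdX0 : 0 ≤ d X := by
    rw [← show G z X X = d X from h.apply_gradient X]; exact h.self.nonneg X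
  have hprod : d X * G z v v ≤ (c * (Λ * c)) * (Λ * ‖v‖ ^ 2) :=
    mul_le_mul (hdX.trans (by gcongr)) hG (h.self.nonneg v) (by positivity)
  have hcc : c * (Λ * c) * (Λ * ‖v‖ ^ 2) ≤ c * (Λ ^ 2 * ‖v‖ ^ 2) := by
    have : 0 ≤ c * (Λ ^ 2 * ‖v‖ ^ 2) := by positivity
    nlinarith
  unfold confSchouten
  rw [← hd, ← hX]
  nlinarith [mul_self_nonneg (d v)]

/-- The conformal change of a nearly flat metric by a factor whose differential is `a ⟨z, ·⟩`,
compared with that of the flat metric. -/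
theorem MetricNear.confSchouten_ge_of_nearly_flat (h : MetricNear G z) {C a : ℝ} (hC : 0 ≤ C)
    (ha : 0 ≤ a) (haz : a * ‖z‖ ^ 2 ≤ 2) (hCz : C * ‖z‖ ^ 2 ≤ 1 / 2)
    (hG : ∀ v, |G z v v - ‖v‖ ^ 2| ≤ C * ‖z‖ ^ 2 * ‖v‖ ^ 2) (hP : ‖fderiv ℝ G z‖ ≤ C * ‖z‖)
    (hf : fderiv ℝ f z = a • euclForm n z) (v : Eucl n) :
    fderiv ℝ (fderiv ℝ f) z v v + (a * Inner.inner ℝ z v) ^ 2 - 1 / 2 * a ^ 2 * ‖z‖ ^ 2 * ‖v‖ ^ 2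
      - 7 * C * ‖z‖ ^ 2 * a * ‖v‖ ^ 2 ≤ confSchouten f G z v v := by
  set X := gradient' f G z with hX
  set r := ‖z‖ with hr
  have hr0 : 0 ≤ r := norm_nonneg _
  have hd : ∀ u, fderiv ℝ f z u = a * Inner.inner ℝ z u := fun u => by rw [hf]; simp [euclForm_apply]
  have hdX : fderiv ℝ f z X ≤ a * r * ‖X‖ := by
    rw [hd, mul_assoc]
    exact mul_le_mul_of_nonneg_left (real_inner_le_norm z X) ha
  have hGX : G z X X = fderiv ℝ f z X := h.apply_gradient X
  have hGX' := abs_le.1 (hG X)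
  have hκ : 0 ≤ C * r ^ 2 := by positivity
  -- `‖X‖ ≤ a r / (1 - κ)` with `κ = C r²`
  have hXn : (1 - C * r ^ 2) * ‖X‖ ≤ a * r := by
    rcases (norm_nonneg X).eq_or_lt with h0 | h0
    · rw [← h0]; simp; positivity
    · have : (1 - C * r ^ 2) * ‖X‖ * ‖X‖ ≤ a * r * ‖X‖ := by nlinarith [hGX'.1]
      exact le_of_mul_le_mul_right this h0
  have hX2 : ‖X‖ ≤ 2 * (a * r) := by nlinarith [norm_nonneg X]
  have hΓ := (le_abs_self _).trans (h.fderiv_christoffel_le (f := f) v)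
  have hΓ' : fderiv ℝ f z (christoffel G z v v) ≤ 3 * C * r ^ 2 * a * ‖v‖ ^ 2 := by
    refine hΓ.trans ?_
    calc 3 / 2 * ‖fderiv ℝ G z‖ * ‖X‖ * ‖v‖ ^ 2 ≤ 3 / 2 * (C * r) * (2 * (a * r)) * ‖v‖ ^ 2 := by
          gcongr
      _ = _ := by ring
  have hdX' : fderiv ℝ f z X ≤ a ^ 2 * r ^ 2 * (1 + 2 * (C * r ^ 2)) := by
    have h1 : a * r * ‖X‖ ≤ (a * r) * (a * r * (1 + 2 * (C * r ^ 2))) := by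
      refine mul_le_mul_of_nonneg_left ?_ (by positivity)
      have har : 0 ≤ a * r := by positivity
      have h3 : (1 - C * r ^ 2) * ‖X‖ ≤ (1 - C * r ^ 2) * (a * r * (1 + 2 * (C * r ^ 2))) := by
        refine hXn.trans ?_
        have : 0 ≤ (a * r) * ((C * r ^ 2) * (1 - 2 * (C * r ^ 2))) :=
          mul_nonneg har (mul_nonneg hκ (by linarith))
        nlinarith
      exact le_of_mul_le_mul_left h3 (by linarith)
    calc _ ≤ _ := hdX
      _ ≤ _ := h1
      _ = _ := by ring
  have hdX0 : 0 ≤ fderiv ℝ f z X := by rw [← hGX]; exact h.self.nonneg X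
  have hv := abs_le.1 (hG v)
  have hprod : fderiv ℝ f z X * G z v v ≤
      (a ^ 2 * r ^ 2 * (1 + 2 * (C * r ^ 2))) * ((1 + C * r ^ 2) * ‖v‖ ^ 2) :=
    mul_le_mul hdX' (by linarith [hv.2]) (h.self.nonneg v) (by positivity)
  have hlast : (a ^ 2 * r ^ 2 * (1 + 2 * (C * r ^ 2))) * ((1 + C * r ^ 2) * ‖v‖ ^ 2) ≤
      a ^ 2 * r ^ 2 * ‖v‖ ^ 2 + 8 * C * r ^ 2 * a * ‖v‖ ^ 2 := by
    have h1 : a ^ 2 * r ^ 2 ≤ 2 * a := by nlinarith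
    have h2 : (1 + 2 * (C * r ^ 2)) * (1 + C * r ^ 2) ≤ 1 + 4 * (C * r ^ 2) := by nlinarith
    have h3 : 0 ≤ a ^ 2 * r ^ 2 * ‖v‖ ^ 2 := by positivity
    calc _ = (a ^ 2 * r ^ 2 * ‖v‖ ^ 2) * ((1 + 2 * (C * r ^ 2)) * (1 + C * r ^ 2)) := by ring
      _ ≤ (a ^ 2 * r ^ 2 * ‖v‖ ^ 2) * (1 + 4 * (C * r ^ 2)) := by gcongr
      _ = a ^ 2 * r ^ 2 * ‖v‖ ^ 2 + (a ^ 2 * r ^ 2) * (4 * (C * r ^ 2) * ‖v‖ ^ 2) := by ring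
      _ ≤ a ^ 2 * r ^ 2 * ‖v‖ ^ 2 + (2 * a) * (4 * (C * r ^ 2) * ‖v‖ ^ 2) := by gcongr
      _ = _ := by ring
  unfold confSchouten
  rw [← hX, hd v]
  nlinarith

end Bounds

/-! ### Positivity of the curvatures of the conformal metrics -/

section Positivity

set_option maxSynthPendingDepth 3

open Matrix

variable {n : ℕ} {f : Eucl n → ℝ} {G : Eucl n → BilinForm n} {z : Eucl n}

theorem minorSum_smul {ι : Type*} [Fintype ι] [DecidableEq ι] (c : ℝ) (j : ℕ) (M : Matrix ι ι ℝ) :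
    minorSum j (c • M) = c ^ j * minorSum j M := by
  unfold minorSum
  rw [Finset.mul_sum]
  refine Finset.sum_congr rfl fun s hs => ?_
  rw [Matrix.submatrix_smul, Pi.smul_apply, Pi.smul_apply, Matrix.det_smul, Fintype.card_coe,
    (Finset.mem_powersetCard.1 hs).2]

theorem minorSum_one_pos {ι : Type*} [Fintype ι] [DecidableEq ι] {j : ℕ}
    (hj : j ≤ Fintype.card ι) : 0 < minorSum j (1 : Matrix ι ι ℝ) := by
  unfold minorSum
  refine Finset.sum_pos (fun s _ => ?_) (Finset.powersetCard_nonempty.2 (by simpa using hj))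
  rw [Matrix.submatrix_one _ Subtype.val_injective, Matrix.det_one]
  exact one_pos

/-- The matrix `A` of a symmetric form lies in the cone `Γ⁺ₘ` of the inner product `B`. -/
def InCone (m : ℕ) (B : BilinForm n) (A : Matrix (Fin n) (Fin n) ℝ) : Prop :=
  ∀ j, 1 ≤ j → j ≤ m → 0 < ((formMatrix fun u v => B u v)⁻¹ * A).charpoly.roots.esymm j

theorem inCone_smul {m : ℕ} (hm : m ≤ n) {B : BilinForm n} (hB : IsInner B) {c : ℝ} (hc : 0 < c) :
    InCone m B (c • formMatrix fun u v => B u v) := by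
  intro j _ hj
  have hdet : IsUnit (formMatrix fun u v => B u v).det :=
    (Matrix.isUnit_iff_isUnit_det _).1 hB.posDef.isUnit
  rw [esymm_roots_charpoly_inv_mul' hB.posDef
    ((formMatrix_isHermitian hB.symm).smul (IsSelfAdjoint.all _)) (by simpa using hj.trans hm),
    Matrix.mul_smul, nonsing_inv_mul _ hdet, minorSum_smul]
  exact mul_pos (pow_pos hc j) (minorSum_one_pos (by simpa using hj.trans hm))

/-- The form `confSchouten`, as an algebraic bilinear form. -/
noncomputable def confLin (f : Eucl n → ℝ) (G : Eucl n → BilinForm n) (z : Eucl n) :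
    Eucl n →ₗ[ℝ] Eucl n →ₗ[ℝ] ℝ :=
  LinearMap.mk₂ ℝ (confSchouten f G z)
    (by intro a b c; simp only [confSchouten, ← christoffelL_apply, map_add, _root_.add_apply]; ring)
    (by intro a b c; simp only [confSchouten, ← christoffelL_apply, map_smul, _root_.smul_apply,
          smul_eq_mul]; ring)
    (by intro a b c; simp only [confSchouten, ← christoffelL_apply, map_add]; ring)
    (by intro a b c; simp only [confSchouten, ← christoffelL_apply, map_smul, smul_eq_mul]; ring)

theorem dotProduct_confSchouten (f : Eucl n → ℝ) (G : Eucl n → BilinForm n) (z : Eucl n)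
    (x y : Fin n → ℝ) : x ⬝ᵥ formMatrix (confSchouten f G z) *ᵥ y =
      confSchouten f G z (WithLp.toLp 2 x) (WithLp.toLp 2 y) :=
  dotProduct_formMatrix (confLin f G z) x y

theorem MetricNear.confSchouten_symm (h : MetricNear G z) (hf : ContDiffAt ℝ ∞ f z)
    (v w : Eucl n) : confSchouten f G z v w = confSchouten f G z w v := by
  unfold confSchouten
  rw [h.christoffel_symm v w, h.self.symm v w,
    (hf.isSymmSndFDerivAt (by simpa using ENat.LEInfty.out)).eq v w]
  ring

/-- The sign of `σ_j` of a conformal metric can be read off the original metric. -/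
theorem MetricNear.sigmaCoord_conf_pos (hn : 3 ≤ n) (h : MetricNear G z)
    (hf : ∀ᶠ z' in 𝓝 z, ContDiffAt ℝ ∞ f z') {m : ℕ} (hm : m ≤ n)
    (hpos : InCone m (G z) (schoutenMatrix G z + formMatrix (confSchouten f G z))) {j : ℕ}
    (hj1 : 1 ≤ j) (hj : j ≤ m) : 0 < sigmaCoord (confMetric f G) j z := by
  have hjn : j ≤ Fintype.card (Fin n) := by simpa using hj.trans hm
  have hc : 0 < Real.exp (-2 * f z) := Real.exp_pos _
  set c := Real.exp (-2 * f z) with hcdef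
  have hM : metricMatrix (confMetric f G) z = c • formMatrix fun u v => G z u v := by
    ext a b; simp [metricMatrix, formMatrix, confMetric, hcdef]
  have hA : (schoutenMatrix G z + formMatrix (confSchouten f G z)).IsHermitian :=
    h.schoutenMatrix_isHermitian.add (formMatrix_isHermitian (h.confSchouten_symm hf.self_of_nhds))
  have hdet : IsUnit (formMatrix fun u v => G z u v).det :=
    (Matrix.isUnit_iff_isUnit_det _).1 h.self.posDef.isUnit
  have hinv : (c • formMatrix fun u v => G z u v)⁻¹ = c⁻¹ • (formMatrix fun u v => G z u v)⁻¹ := by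
    refine inv_eq_left_inv ?_
    rw [smul_mul_smul_comm, inv_mul_cancel₀ hc.ne', nonsing_inv_mul _ hdet, one_smul]
  have h1 := hpos j hj1 hj
  rw [esymm_roots_charpoly_inv_mul' h.self.posDef hA hjn] at h1
  have hM' : metricMatrix (confMetric f G) z = formMatrix fun u v => confMetric f G z u v := rfl
  rw [sigmaCoord, h.schoutenMatrix_conf hn hf, hM',
    esymm_roots_charpoly_inv_mul' (h.conf hf).self.posDef hA hjn, ← hM', hM, hinv,
    Matrix.smul_mul, minorSum_smul]
  exact mul_pos (pow_pos (inv_pos.2 hc) j) h1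

theorem norm_toLp_sq (x : Fin n → ℝ) : ‖(WithLp.toLp 2 x : Eucl n)‖ ^ 2 = ∑ i, x i ^ 2 := by
  rw [EuclideanSpace.norm_sq_eq]; simp

/-- A conformal factor which is `C²`-close to a constant preserves the positivity of `σ_j`. -/
theorem exists_conf_perturb (hn : 3 ≤ n) {m : ℕ} (hm : m ≤ n) {Λ δ : ℝ} (hΛ : 0 < Λ)
    (hδ : 0 < δ) : ∃ c : ℝ, 0 < c ∧ ∀ (G : Eucl n → BilinForm n) (z : Eucl n) (f : Eucl n → ℝ),
      MetricNear G z → metricJet G z ∈ boundedJets n Λ →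
      (∀ j, 1 ≤ j → j ≤ m → δ ≤ sigmaCoord G j z) → (∀ᶠ z' in 𝓝 z, ContDiffAt ℝ ∞ f z') →
      ‖fderiv ℝ f z‖ ≤ c → ‖fderiv ℝ (fderiv ℝ f) z‖ ≤ c →
      ∀ j, 1 ≤ j → j ≤ m → 0 < sigmaCoord (confMetric f G) j z := by
  obtain ⟨τ, hτ, hmargin⟩ := exists_schouten_margin n m hΛ hδ
  refine ⟨min 1 (τ / (Λ * (1 + 2 * Λ ^ 2))), by positivity, ?_⟩
  intro G z f h hJ hσ hf h1 h2 j hj1 hj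
  refine h.sigmaCoord_conf_pos hn hf hm ?_ hj1 hj
  set M := formMatrix fun u v => G z u v with hM
  have hMh : M.IsHermitian := formMatrix_isHermitian h.self.symm
  have hA0 : (schoutenMatrix G z - τ • M).IsHermitian :=
    h.schoutenMatrix_isHermitian.sub (hMh.smul (IsSelfAdjoint.all _))
  have hB : (τ • M + formMatrix (confSchouten f G z)).IsHermitian :=
    (hMh.smul (IsSelfAdjoint.all _)).add
      (formMatrix_isHermitian (h.confSchouten_symm hf.self_of_nhds))
  -- The margin `τ` absorbs the change of the Schouten tensor: `A - τ G` is in the cone, and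
  -- `τ G + confSchouten` is nonnegative, which is the case `c = 0` of the stability lemma.
  have hsplit : schoutenMatrix G z + formMatrix (confSchouten f G z) =
      (schoutenMatrix G z - τ • M) + (τ • M + formMatrix (confSchouten f G z)) := by abel
  rw [InCone, hsplit]
  refine esymm_pos_add (by simpa using hm) h.self.posDef hA0 hB le_rfl (l := 0) ?_ ?_ ?_
  · intro v
    rw [zero_dotProduct, dotProduct_formMatrix']
    simpa using h.self.nonneg (WithLp.toLp 2 v)
  · intro x
    rw [zero_mul, add_mulVec, dotProduct_add, smul_mulVec, dotProduct_smul, hM,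
      dotProduct_formMatrix', dotProduct_confSchouten]
    set v : Eucl n := WithLp.toLp 2 x
    have k1 := h.confSchouten_ge hΛ hJ (min_le_left _ _) h1 h2 v
    have k2 : ‖v‖ ^ 2 ≤ Λ * G z v v := hJ.2.1 v
    have k3 : min 1 (τ / (Λ * (1 + 2 * Λ ^ 2))) * (1 + 2 * Λ ^ 2) ≤ τ / Λ := by
      calc _ ≤ τ / (Λ * (1 + 2 * Λ ^ 2)) * (1 + 2 * Λ ^ 2) := by
            gcongr; exact min_le_right _ _
        _ = _ := by field_simp
    have k4 : min 1 (τ / (Λ * (1 + 2 * Λ ^ 2))) * (1 + 2 * Λ ^ 2) * ‖v‖ ^ 2 ≤ τ * G z v v := by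
      calc _ ≤ τ / Λ * (Λ * G z v v) :=
            mul_le_mul k3 k2 (by positivity) (by positivity)
        _ = _ := by field_simp
    rw [smul_eq_mul]
    linarith
  · intro j hj1 hj
    have hjn : j ≤ Fintype.card (Fin n) := by simpa using hj.trans hm
    rw [esymm_roots_charpoly_inv_mul' h.self.posDef hA0 hjn]
    have := hmargin (metricJet G z) hJ (fun j hj1 hj => by
      rw [← h.sigmaCoord_eq (hj.trans hm)]; exact hσ j hj1 hj) j hj1 hj
    rwa [h.schouten_metricJet] at this

/-- The cone lemma for the tensor `s (δ - (n / k) dr²)`, with `k = m + 1`, and for a metric which is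
nearly flat. -/
theorem inCone_add {m : ℕ} (hm1 : 1 ≤ m) (hm : m ≤ n) {B : BilinForm n} (hB : IsInner B)
    {A S : Matrix (Fin n) (Fin n) ℝ} (hA : A.IsHermitian) (hS : S.IsHermitian) {κ s : ℝ}
    (hκ0 : 0 ≤ κ) (hκ : κ ≤ 1 / (16 * ((m : ℝ) + 1))) (hs : 0 ≤ s) {e : Eucl n} (he : ‖e‖ ≤ 1)
    (hBκ : ∀ v, |B v v - ‖v‖ ^ 2| ≤ κ * ‖v‖ ^ 2)
    (hSe : ∀ x : Fin n → ℝ, s * ((1 - 1 / (4 * ((m : ℝ) + 1))) * ‖(WithLp.toLp 2 x : Eucl n)‖ ^ 2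
      - n / ((m : ℝ) + 1) * (Inner.inner ℝ e (WithLp.toLp 2 x)) ^ 2) ≤ x ⬝ᵥ S *ᵥ x)
    (hpos : InCone m B A) : InCone m B (A + S) := by
  have hm0 : (1 : ℝ) ≤ m := by exact_mod_cast hm1
  have hκ1 : κ ≤ 1 / 16 := hκ.trans (by
    apply one_div_le_one_div_of_le <;> linarith)
  have hκ1' : 0 < 1 - κ := by linarith
  have hsq : Real.sqrt (1 - κ) ^ 2 = 1 - κ := Real.sq_sqrt hκ1'.le
  have hdot : ∀ x : Fin n → ℝ, (Real.sqrt (1 - κ) • (e : Fin n → ℝ)) ⬝ᵥ x =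
      Real.sqrt (1 - κ) * Inner.inner ℝ e (WithLp.toLp 2 x : Eucl n) := by
    intro x
    rw [smul_dotProduct, smul_eq_mul, EuclideanSpace.inner_eq_star_dotProduct, star_trivial,
      dotProduct_comm]
  -- `s (1 - (n / (m + 1)) e ⊗ e) = c ((m + 1) / m - (n / m) e ⊗ e)` with `c = s m / (m + 1)`. The room
  -- between `(m + 1) / m` and `1` pays for replacing the flat metric by `B`, and the factor
  -- `√(1 - κ)` makes `e` a covector of `B`-norm at most `1`.
  refine esymm_pos_add (by simpa using hm) hB.posDef hA hS
    (c := s * (m / ((m : ℝ) + 1)) / (1 - κ)) (by positivity)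
    (l := Real.sqrt (1 - κ) • (e : Fin n → ℝ)) ?_ ?_ hpos
  · intro x
    rw [hdot, dotProduct_formMatrix', mul_pow, hsq]
    set v : Eucl n := WithLp.toLp 2 x
    have h1 := (abs_le.1 (hBκ v)).1
    have h2 : (Inner.inner ℝ e v : ℝ) ^ 2 ≤ ‖v‖ ^ 2 := by
      rw [sq_le_sq, abs_norm]
      refine (abs_real_inner_le_norm e v).trans ?_
      nlinarith [norm_nonneg v]
    nlinarith
  · intro x
    refine le_trans ?_ (hSe x)
    rw [hdot, dotProduct_formMatrix', mul_pow, hsq, Fintype.card_fin]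
    set v : Eucl n := WithLp.toLp 2 x
    set p : ℝ := Inner.inner ℝ e v ^ 2
    have h1 := (abs_le.1 (hBκ v)).2
    have h3 : m / ((m : ℝ) + 1) * (1 + κ) ≤ (1 - 1 / (4 * ((m : ℝ) + 1))) * (1 - κ) := by
      have hmk : m / ((m : ℝ) + 1) = 1 - 1 / ((m : ℝ) + 1) := by field_simp; ring
      have h4k : 1 / (4 * ((m : ℝ) + 1)) = (1 / ((m : ℝ) + 1)) / 4 := by field_simp
      have h16k : 1 / (16 * ((m : ℝ) + 1)) = (1 / ((m : ℝ) + 1)) / 16 := by field_simp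
      rw [h16k] at hκ
      rw [hmk, h4k]
      have : 0 < 1 / ((m : ℝ) + 1) := by positivity
      nlinarith
    have h4 : s * (m / ((m : ℝ) + 1)) / (1 - κ) * (B v v - n / m * ((1 - κ) * p)) =
        s * ((m / ((m : ℝ) + 1)) * B v v / (1 - κ) - n / ((m : ℝ) + 1) * p) := by
      field_simp
    rw [h4]
    refine mul_le_mul_of_nonneg_left ?_ hs
    have h5 : m / ((m : ℝ) + 1) * B v v / (1 - κ) ≤ (1 - 1 / (4 * ((m : ℝ) + 1))) * ‖v‖ ^ 2 := by
      rw [div_le_iff₀ hκ1']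
      have h6 : 0 ≤ m / ((m : ℝ) + 1) := by positivity
      calc m / ((m : ℝ) + 1) * B v v ≤ m / ((m : ℝ) + 1) * ((1 + κ) * ‖v‖ ^ 2) := by
            gcongr; linarith
        _ = (m / ((m : ℝ) + 1) * (1 + κ)) * ‖v‖ ^ 2 := by ring
        _ ≤ ((1 - 1 / (4 * ((m : ℝ) + 1))) * (1 - κ)) * ‖v‖ ^ 2 := by gcongr
        _ = _ := by ring
    linarith

end Positivity

/-! ### The radial conformal factor on nearly flat metrics -/

section Neck

set_option maxSynthPendingDepth 3

open Matrix

variable {n : ℕ} {G : Eucl n → BilinForm n} {z : Eucl n} {w σ : ℝ}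

/-- The coefficient `s` in the Schouten tensor `s (δ - (n / k) dr²)` of the metric
`(1 + ρ)^{2/w} δ`, where `ρ = σ |z|^{-2w}`. -/
noncomputable def neckCoeff (w σ : ℝ) (z : Eucl n) : ℝ :=
  2 * (σ * radialPow w z) / (‖z‖ ^ 2 * (1 + σ * radialPow w z) ^ 2)

theorem radialPow_pos (hz : z ≠ 0) : 0 < radialPow w z := by
  have : 0 < ‖z‖ ^ 2 := by positivity
  exact Real.rpow_pos_of_pos this _

/-- For the flat metric, with `C = 0`, this is an equality: the Schouten tensor of `(1 + ρ)^{2/w} δ`. -/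
theorem MetricNear.confSchouten_ge_of_radial (h : MetricNear G z) (hz : z ≠ 0) (hw : 0 < w)
    (hσ : 0 < σ) {C : ℝ} (hC : 0 ≤ C) (hCz : C * ‖z‖ ^ 2 ≤ 1 / 2)
    (hG : ∀ v, |G z v v - ‖v‖ ^ 2| ≤ C * ‖z‖ ^ 2 * ‖v‖ ^ 2) (hP : ‖fderiv ℝ G z‖ ≤ C * ‖z‖)
    (v : Eucl n) :
    neckCoeff w σ z * ((1 - 7 * C * ‖z‖ ^ 2 * (1 + σ * radialPow w z)) * ‖v‖ ^ 2
      - (2 * w + 2) * (Inner.inner ℝ (‖z‖⁻¹ • z) v) ^ 2) ≤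
      confSchouten (logFactor w σ (radialPow w)) G z v v := by
  have hq : 0 < ‖z‖ ^ 2 := by positivity
  have hp := radialPow_pos (w := w) hz
  set q := ‖z‖ ^ 2 with hqdef
  set ρ := σ * radialPow w z with hρ
  have hρ0 : 0 < ρ := mul_pos hσ hp
  have h1 : 0 < 1 + ρ := by linarith
  have hpe : ∀ᶠ z' in 𝓝 z, ContDiffAt ℝ ∞ (radialPow (n := n) w) z' := by
    filter_upwards [isOpen_ne.mem_nhds hz] with z' hz'
    exact contDiffAt_radialPow hz'
  have hp1 : σ * q ^ (-w - 1) = ρ / q := by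
    rw [Real.rpow_sub_one hq.ne', hρ, radialPow]; ring
  have hp2 : σ * q ^ (-w - 2) = ρ / q ^ 2 := by
    rw [show -w - 2 = -w - 1 - 1 by ring, Real.rpow_sub_one hq.ne', Real.rpow_sub_one hq.ne', hρ,
      radialPow]
    field_simp
    rfl
  set a := 2 * ρ / (q * (1 + ρ)) with ha
  have ha0 : 0 < a := by positivity
  have hf : fderiv ℝ (logFactor w σ (radialPow w)) z = a • euclForm n z := by
    rw [fderiv_logFactor hpe.self_of_nhds h1, fderiv_radialPow hz, smul_smul]
    congr 1
    rw [ha, ← hρ, show -(σ / w) * (1 + ρ)⁻¹ * (-(2 * w) * (‖z‖ ^ 2) ^ (-w - 1)) =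
      (σ * q ^ (-w - 1)) * (1 + ρ)⁻¹ * (w / w) * 2 by rw [← hqdef]; ring, hp1, div_self hw.ne']
    field_simp
  have haz : a * ‖z‖ ^ 2 ≤ 2 := by
    rw [← hqdef, ha]
    have : 2 * ρ / (q * (1 + ρ)) * q = 2 * ρ / (1 + ρ) := by field_simp
    rw [this, div_le_iff₀ h1]
    linarith
  have key := h.confSchouten_ge_of_nearly_flat hC ha0.le haz hCz hG hP hf v
  refine le_trans (le_of_eq ?_) key
  have hin : (Inner.inner ℝ (‖z‖⁻¹ • z) v : ℝ) ^ 2 = (Inner.inner ℝ z v) ^ 2 / q := by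
    rw [real_inner_smul_left, hqdef]
    field_simp
  rw [fderiv_fderiv_logFactor hpe h1, fderiv_fderiv_radialPow hz, fderiv_radialPow hz, hin,
    neckCoeff, ← hρ, ← hqdef, real_inner_self_eq_norm_sq]
  simp only [_root_.smul_apply, euclForm_apply, smul_eq_mul]
  set b : ℝ := Inner.inner ℝ z v
  set V := ‖v‖ ^ 2
  -- The powers of `q` are first collected into `σ q^{-w-1} = ρ / q` and `σ q^{-w-2} = ρ / q²`.
  have e1 : -(σ / w) * ((1 + ρ)⁻¹ * (-(2 * w) * q ^ (-w - 1) * V +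
        4 * w * (w + 1) * q ^ (-w - 2) * (b * b)) -
      σ * (1 + ρ)⁻¹ ^ 2 * (-(2 * w) * q ^ (-w - 1) * b * (-(2 * w) * q ^ (-w - 1) * b))) =
      (w / w) * ((1 + ρ)⁻¹ * (2 * (σ * q ^ (-w - 1)) * V
        - 4 * (w + 1) * (σ * q ^ (-w - 2)) * (b * b))
        + (1 + ρ)⁻¹ ^ 2 * (4 * w * (σ * q ^ (-w - 1)) ^ 2 * b ^ 2)) := by ring
  rw [e1, hp1, hp2, div_self hw.ne', ha]
  field_simp
  ring

variable {m : ℕ}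

/-- On the neck, the conformal factor `(1 + ρ)^{2/w}` preserves the positivity of `σ_j` for a nearly
flat metric. Instead of being positive to begin with, the Schouten tensor may also be bounded below by
a constant much smaller than the coefficient `s`: then the flat model, whose Schouten tensor lies in
the open cone `Γ⁺ₘ`, prevails. -/
theorem MetricNear.sigmaCoord_neck_pos (hn : 3 ≤ n) (hm1 : 1 ≤ m) (hm : m ≤ n)
    (h : MetricNear G z) (hz : z ≠ 0) (hw : 0 < w) (hwm : n / ((m : ℝ) + 1) = 2 * w + 2)
    (hσ : 0 < σ) {C : ℝ} (hC : 0 ≤ C)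
    (hCz : 7 * C * ‖z‖ ^ 2 * (1 + σ * radialPow w z) ≤ 1 / (16 * ((m : ℝ) + 1)))
    (hG : ∀ v, |G z v v - ‖v‖ ^ 2| ≤ C * ‖z‖ ^ 2 * ‖v‖ ^ 2) (hP : ‖fderiv ℝ G z‖ ≤ C * ‖z‖)
    (hA : (∀ j, 1 ≤ j → j ≤ m → 0 < sigmaCoord G j z) ∨
      ∃ C₀, (∀ x : Fin n → ℝ, -(C₀ * ∑ i, x i ^ 2) ≤ x ⬝ᵥ schoutenMatrix G z *ᵥ x) ∧
        C₀ ≤ neckCoeff w σ z / (16 * ((m : ℝ) + 1))) {j : ℕ} (hj1 : 1 ≤ j) (hj : j ≤ m) :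
    0 < sigmaCoord (confMetric (logFactor w σ (radialPow w)) G) j z := by
  have hm0 : (1 : ℝ) ≤ m := by exact_mod_cast hm1
  have hp := radialPow_pos (w := w) hz
  have hρ0 : 0 < σ * radialPow w z := mul_pos hσ hp
  have hq : 0 < ‖z‖ ^ 2 := by positivity
  have hs : 0 < neckCoeff w σ z := by unfold neckCoeff; positivity
  set s := neckCoeff w σ z with hsdef
  have hCz0 : 0 ≤ C * ‖z‖ ^ 2 := by positivity
  have hκ : C * ‖z‖ ^ 2 ≤ 1 / (16 * ((m : ℝ) + 1)) := by nlinarith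
  have h16 : 1 / (16 * ((m : ℝ) + 1)) ≤ 1 / 32 := by
    apply one_div_le_one_div_of_le <;> linarith
  have hfe : ∀ᶠ z' in 𝓝 z, ContDiffAt ℝ ∞ (logFactor w σ (radialPow (n := n) w)) z' := by
    filter_upwards [isOpen_ne.mem_nhds hz] with z' hz'
    exact contDiffAt_logFactor (contDiffAt_radialPow hz')
      (by have := mul_pos hσ (radialPow_pos (w := w) hz'); linarith)
  have hlow := fun v => h.confSchouten_ge_of_radial hz hw hσ hC (hκ.trans (by linarith)) hG hP v
  have hM : (formMatrix fun u v => G z u v).IsHermitian := formMatrix_isHermitian h.self.symm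
  have hH := formMatrix_isHermitian (h.confSchouten_symm hfe.self_of_nhds)
  have he : ‖‖z‖⁻¹ • z‖ ≤ 1 := by
    rw [norm_smul, norm_inv, norm_norm, inv_mul_cancel₀ (norm_ne_zero_iff.2 hz)]
  have hquarter : 1 / (4 * ((m : ℝ) + 1)) = 4 * (1 / (16 * ((m : ℝ) + 1))) := by
    field_simp; norm_num
  refine h.sigmaCoord_conf_pos hn hfe hm ?_ hj1 hj
  rcases hA with hA | ⟨C₀, hC0, hC0s⟩
  · refine inCone_add hm1 hm h.self h.schoutenMatrix_isHermitian hH hCz0 hκ hs.le he hG ?_ hA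
    intro x
    rw [dotProduct_confSchouten]
    refine le_trans ?_ (hlow _)
    rw [hwm, hquarter]
    refine mul_le_mul_of_nonneg_left ?_ hs.le
    have := sq_nonneg ‖(WithLp.toLp 2 x : Eucl n)‖
    nlinarith
  · -- The stability lemma starts from the multiple `c G` of the metric, which lies in the cone; the
    -- lower bound left for the other summand is enough.
    set c := s / (32 * ((m : ℝ) + 1)) with hc
    have hc0 : 0 < c := by positivity
    have hsplit : schoutenMatrix G z + formMatrix (confSchouten (logFactor w σ (radialPow w)) G z) =
        c • (formMatrix fun u v => G z u v) + (schoutenMatrix G z +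
          formMatrix (confSchouten (logFactor w σ (radialPow w)) G z)
          - c • (formMatrix fun u v => G z u v)) := by abel
    rw [hsplit]
    refine inCone_add hm1 hm h.self (hM.smul (IsSelfAdjoint.all _))
      ((h.schoutenMatrix_isHermitian.add hH).sub (hM.smul (IsSelfAdjoint.all _))) hCz0 hκ hs.le he
      hG ?_ (inCone_smul hm h.self hc0)
    intro x
    rw [sub_mulVec, dotProduct_sub, add_mulVec, dotProduct_add, dotProduct_confSchouten,
      smul_mulVec, dotProduct_smul, dotProduct_formMatrix', smul_eq_mul]
    have h1 := hlow (WithLp.toLp 2 x)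
    have h2 := hC0 x
    rw [← norm_toLp_sq] at h2
    set v : Eucl n := WithLp.toLp 2 x
    have hv := sq_nonneg ‖v‖
    have h3 := (abs_le.1 (hG v)).2
    have h4 : c * G z v v ≤ s * (1 / (16 * ((m : ℝ) + 1))) * ‖v‖ ^ 2 := by
      have : G z v v ≤ 2 * ‖v‖ ^ 2 := by nlinarith
      calc c * G z v v ≤ c * (2 * ‖v‖ ^ 2) := by gcongr
        _ = _ := by rw [hc]; field_simp; ring
    have h5 : C₀ * ‖v‖ ^ 2 ≤ s * (1 / (16 * ((m : ℝ) + 1))) * ‖v‖ ^ 2 := by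
      refine mul_le_mul_of_nonneg_right (hC0s.trans (le_of_eq ?_)) hv
      ring
    have h6 : s * (7 * C * ‖z‖ ^ 2 * (1 + σ * radialPow w z)) * ‖v‖ ^ 2 ≤
        s * (1 / (16 * ((m : ℝ) + 1))) * ‖v‖ ^ 2 := by gcongr
    have h7 : 0 ≤ s * (1 / (16 * ((m : ℝ) + 1))) * ‖v‖ ^ 2 := by positivity
    rw [hwm, hquarter]
    rw [← hsdef] at h1
    nlinarith

end Neck

/-! ### Bounds for second order jets -/

section SecondOrder

set_option maxSynthPendingDepth 3

variable {E F H : Type*} [NormedAddCommGroup E] [NormedSpace ℝ E] [NormedAddCommGroup F]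
  [NormedSpace ℝ F] [NormedAddCommGroup H] [NormedSpace ℝ H]

/-- At `z`, the function `f` and its first two derivatives have norm at most `c`. -/
structure C2Le (f : E → F) (z : E) (c : ℝ) : Prop where
  smooth : ContDiffAt ℝ 2 f z
  norm_le : ‖f z‖ ≤ c
  norm_fderiv_le : ‖fderiv ℝ f z‖ ≤ c
  norm_fderiv_fderiv_le : ‖fderiv ℝ (fderiv ℝ f) z‖ ≤ c

namespace C2Le

variable {f : E → F} {z : E} {c d : ℝ}

theorem nonneg (h : C2Le f z c) : 0 ≤ c := (norm_nonneg _).trans h.norm_le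

theorem mono (h : C2Le f z c) (hcd : c ≤ d) : C2Le f z d :=
  ⟨h.smooth, h.norm_le.trans hcd, h.norm_fderiv_le.trans hcd, h.norm_fderiv_fderiv_le.trans hcd⟩

theorem eventually_hasFDerivAt (h : ContDiffAt ℝ 2 f z) :
    ∀ᶠ z' in 𝓝 z, HasFDerivAt f (fderiv ℝ f z') z' := by
  filter_upwards [h.eventually (by simp)] with z' h'
  exact (h'.differentiableAt (by simp)).hasFDerivAt

theorem hasFDerivAt_fderiv (h : ContDiffAt ℝ 2 f z) :
    HasFDerivAt (fderiv ℝ f) (fderiv ℝ (fderiv ℝ f) z) z :=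
  ((h.fderiv_right (m := 1) (by norm_num)).differentiableAt (by simp)).hasFDerivAt

theorem add {g : E → F} (h : C2Le f z c) (hg : C2Le g z d) :
    C2Le (fun x => f x + g x) z (c + d) := by
  have e1 : fderiv ℝ (fun x => f x + g x) =ᶠ[𝓝 z] fun x => fderiv ℝ f x + fderiv ℝ g x := by
    filter_upwards [eventually_hasFDerivAt h.smooth, eventually_hasFDerivAt hg.smooth] with x h1 h2
    exact (h1.add h2).fderiv
  have e2 : fderiv ℝ (fderiv ℝ fun x => f x + g x) z = _ :=
    (((hasFDerivAt_fderiv h.smooth).add (hasFDerivAt_fderiv hg.smooth)).congr_of_eventuallyEq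
      e1).fderiv
  refine ⟨h.smooth.add hg.smooth, norm_add_le_of_le h.norm_le hg.norm_le, ?_, ?_⟩
  · rw [e1.self_of_nhds]
    exact norm_add_le_of_le h.norm_fderiv_le hg.norm_fderiv_le
  · rw [e2]
    exact norm_add_le_of_le h.norm_fderiv_fderiv_le hg.norm_fderiv_fderiv_le

theorem comp {g : F → H} {d : ℝ} (hd : 1 ≤ d) (hg : C2Le g (f z) c) (hf : C2Le f z d) :
    C2Le (fun x => g (f x)) z (2 * c * d ^ 2) := by
  have hc := hg.nonneg
  have e1 : fderiv ℝ (fun x => g (f x)) =ᶠ[𝓝 z]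
      fun x => (fderiv ℝ g (f x)).comp (fderiv ℝ f x) := by
    filter_upwards [eventually_hasFDerivAt hf.smooth,
      hf.smooth.continuousAt.eventually (eventually_hasFDerivAt hg.smooth)] with x h1 h2
    exact (h2.comp x h1).fderiv
  have e3 := ((hasFDerivAt_fderiv hg.smooth).comp z
    (eventually_hasFDerivAt hf.smooth).self_of_nhds).clm_comp (hasFDerivAt_fderiv hf.smooth)
  have e2 : fderiv ℝ (fderiv ℝ fun x => g (f x)) z = _ := (e3.congr_of_eventuallyEq e1).fderiv
  refine ⟨ContDiffAt.comp z hg.smooth hf.smooth, hg.norm_le.trans ?_, ?_, ?_⟩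
  · have : 1 ≤ d ^ 2 := one_le_pow₀ hd
    nlinarith
  · rw [e1.self_of_nhds]
    refine (ContinuousLinearMap.opNorm_comp_le _ _).trans ?_
    calc _ ≤ c * d := mul_le_mul hg.norm_fderiv_le hf.norm_fderiv_le (norm_nonneg _) hc
      _ ≤ _ := by nlinarith [mul_nonneg hc (by linarith : (0:ℝ) ≤ d)]
  · rw [e2]
    refine ContinuousLinearMap.opNorm_le_bound _ (by positivity) fun u => ?_
    simp only [_root_.add_apply, ContinuousLinearMap.comp_apply, ContinuousLinearMap.flip_apply,
      ContinuousLinearMap.compL_apply]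
    have h1 : ‖(fderiv ℝ g (f z)).comp (fderiv ℝ (fderiv ℝ f) z u)‖ ≤ c * (d * ‖u‖) := by
      refine (ContinuousLinearMap.opNorm_comp_le _ _).trans ?_
      exact mul_le_mul hg.norm_fderiv_le (ContinuousLinearMap.le_of_opNorm_le _
        hf.norm_fderiv_fderiv_le u) (norm_nonneg _) hc
    have h2 : ‖(fderiv ℝ (fderiv ℝ g) (f z) (fderiv ℝ f z u)).comp (fderiv ℝ f z)‖ ≤
        c * (d * ‖u‖) * d := by
      refine (ContinuousLinearMap.opNorm_comp_le _ _).trans ?_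
      refine mul_le_mul ?_ hf.norm_fderiv_le (norm_nonneg _) (by positivity)
      refine (ContinuousLinearMap.le_of_opNorm_le _ hg.norm_fderiv_fderiv_le _).trans ?_
      gcongr
      exact ContinuousLinearMap.le_of_opNorm_le _ hf.norm_fderiv_le u
    refine (norm_add_le_of_le h1 h2).trans ?_
    have : 0 ≤ c * ‖u‖ := by positivity
    nlinarith [mul_nonneg this (by nlinarith : 0 ≤ d ^ 2 - d)]

theorem clm_apply {T : E → F →L[ℝ] H} {a b : ℝ} (hT : C2Le T z a) (hf : C2Le f z b) :
    C2Le (fun x => T x (f x)) z (4 * (a * b)) := by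
  have ha := hT.nonneg
  have hb := hf.nonneg
  have hab : 0 ≤ a * b := mul_nonneg ha hb
  have e1 : fderiv ℝ (fun x => T x (f x)) =ᶠ[𝓝 z]
      fun x => (T x).comp (fderiv ℝ f x) + (fderiv ℝ T x).flip (f x) := by
    filter_upwards [eventually_hasFDerivAt hT.smooth, eventually_hasFDerivAt hf.smooth] with x h1 h2
    exact (h1.clm_apply h2).fderiv
  have e3 : HasFDerivAt (fun x => (T x).comp (fderiv ℝ f x)) _ z :=
    (eventually_hasFDerivAt hT.smooth).self_of_nhds.clm_comp (hasFDerivAt_fderiv hf.smooth)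
  have e4 : HasFDerivAt (fun x => (fderiv ℝ T x).flip (f x)) _ z :=
    ((ContinuousLinearMap.flipₗᵢ ℝ E F H).toContinuousLinearEquiv.toContinuousLinearMap.hasFDerivAt.comp z
      (hasFDerivAt_fderiv hT.smooth)).clm_apply (eventually_hasFDerivAt hf.smooth).self_of_nhds
  have e2 : fderiv ℝ (fderiv ℝ fun x => T x (f x)) z = _ :=
    ((e3.add e4).congr_of_eventuallyEq e1).fderiv
  refine ⟨hT.smooth.clm_apply hf.smooth, ?_, ?_, ?_⟩
  · refine (ContinuousLinearMap.le_opNorm _ _).trans ?_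
    calc _ ≤ a * b := mul_le_mul hT.norm_le hf.norm_le (norm_nonneg _) ha
      _ ≤ _ := by linarith
  · rw [e1.self_of_nhds]
    refine ContinuousLinearMap.opNorm_le_bound _ (by positivity) fun u => ?_
    simp only [_root_.add_apply, ContinuousLinearMap.comp_apply, ContinuousLinearMap.flip_apply]
    have h1 : ‖T z (fderiv ℝ f z u)‖ ≤ a * (b * ‖u‖) :=
      (ContinuousLinearMap.le_of_opNorm_le _ hT.norm_le _).trans
        (by gcongr; exact ContinuousLinearMap.le_of_opNorm_le _ hf.norm_fderiv_le u)
    have h2 : ‖fderiv ℝ T z u (f z)‖ ≤ a * ‖u‖ * b :=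
      (ContinuousLinearMap.le_of_opNorm_le_of_le _
        (ContinuousLinearMap.le_of_opNorm_le _ hT.norm_fderiv_le u) hf.norm_le)
    refine (norm_add_le_of_le h1 h2).trans ?_
    nlinarith [mul_nonneg hab (norm_nonneg u)]
  · rw [e2]
    refine ContinuousLinearMap.opNorm_le_bound₂ _ (by positivity) fun u v => ?_
    simp only [_root_.add_apply, ContinuousLinearMap.comp_apply, ContinuousLinearMap.flip_apply,
      ContinuousLinearMap.compL_apply]
    have k1 : ‖T z (fderiv ℝ (fderiv ℝ f) z u v)‖ ≤ a * (b * ‖u‖ * ‖v‖) :=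
      ContinuousLinearMap.le_of_opNorm_le_of_le _ hT.norm_le
        (ContinuousLinearMap.le_of_opNorm_le _
          (ContinuousLinearMap.le_of_opNorm_le _ hf.norm_fderiv_fderiv_le u) v)
    have k2 : ‖fderiv ℝ T z u (fderiv ℝ f z v)‖ ≤ a * ‖u‖ * (b * ‖v‖) :=
      ContinuousLinearMap.le_of_opNorm_le_of_le _
        (ContinuousLinearMap.le_of_opNorm_le _ hT.norm_fderiv_le u)
        (ContinuousLinearMap.le_of_opNorm_le _ hf.norm_fderiv_le v)
    have k3 : ‖fderiv ℝ T z v (fderiv ℝ f z u)‖ ≤ a * ‖v‖ * (b * ‖u‖) :=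
      ContinuousLinearMap.le_of_opNorm_le_of_le _
        (ContinuousLinearMap.le_of_opNorm_le _ hT.norm_fderiv_le v)
        (ContinuousLinearMap.le_of_opNorm_le _ hf.norm_fderiv_le u)
    have k4 : ‖fderiv ℝ (fderiv ℝ T) z u v (f z)‖ ≤ a * ‖u‖ * ‖v‖ * b :=
      ContinuousLinearMap.le_of_opNorm_le_of_le _
        (ContinuousLinearMap.le_of_opNorm_le _
          (ContinuousLinearMap.le_of_opNorm_le _ hT.norm_fderiv_fderiv_le u) v) hf.norm_le
    refine (norm_add_le_of_le (norm_add_le_of_le k1 k2) (norm_add_le_of_le k3 k4)).trans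
      (le_of_eq (by ring))

end C2Le

theorem exists_C2Le {K : Set E} (hK : IsCompact K) {f : E → F}
    (hf : ∀ z ∈ K, ContDiffAt ℝ ∞ f z) : ∃ c, 1 ≤ c ∧ ∀ z ∈ K, C2Le f z c := by
  obtain ⟨a, ha⟩ := hK.exists_bound_of_continuousOn (f := f)
    fun z hz => (hf z hz).continuousAt.continuousWithinAt
  obtain ⟨b, hb⟩ := hK.exists_bound_of_continuousOn (f := fderiv ℝ f)
    fun z hz => ((hf z hz).fderiv_right (m := ∞) (by simp)).continuousAt.continuousWithinAt
  obtain ⟨c, hc⟩ := hK.exists_bound_of_continuousOn (f := fderiv ℝ (fderiv ℝ f))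
    fun z hz => (((hf z hz).fderiv_right (m := ∞) (by simp)).fderiv_right
      (m := ∞) (by simp)).continuousAt.continuousWithinAt
  refine ⟨max 1 (max a (max b c)), le_max_left _ _, fun z hz => ⟨(hf z hz).of_le (by
    simpa using ENat.LEInfty.out), ?_, ?_, ?_⟩⟩
  · exact (ha z hz).trans (by simp)
  · exact (hb z hz).trans (by simp)
  · exact (hc z hz).trans (by simp)

theorem fderiv_fderiv_comp_smul (f : E → F) (c : ℝ) (z : E) :
    fderiv ℝ (fderiv ℝ fun x => f (c • x)) z = (c * c) • fderiv ℝ (fderiv ℝ f) (c • z) := by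
  have h : (fderiv ℝ fun x => f (c • x)) = fun x => c • fderiv ℝ f (c • x) := by
    funext x; exact fderiv_comp_smul c
  have h2 := congrFun (fderiv_const_smul_field (𝕜 := ℝ) c (f := fun x => fderiv ℝ f (c • x))) z
  have h3 : fderiv ℝ (fun x => fderiv ℝ f (c • x)) z = _ := fderiv_comp_smul c
  rw [Pi.smul_apply, h3, smul_smul] at h2
  rw [h, ← h2]
  rfl

theorem C2Le.congr {f g : E → F} {z : E} {c : ℝ} (h : C2Le f z c) (hg : g =ᶠ[𝓝 z] f) :
    C2Le g z c :=
  ⟨h.smooth.congr_of_eventuallyEq hg, by rw [hg.self_of_nhds]; exact h.norm_le,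
    by rw [hg.fderiv_eq]; exact h.norm_fderiv_le,
    by rw [hg.fderiv.fderiv_eq]; exact h.norm_fderiv_fderiv_le⟩

theorem C2Le.norm_comp_smul_le {f : E → F} {z : E} {c d : ℝ} (h : C2Le f (c • z) d) :
    ‖fderiv ℝ (fun x => f (c • x)) z‖ ≤ |c| * d ∧
      ‖fderiv ℝ (fderiv ℝ fun x => f (c • x)) z‖ ≤ c ^ 2 * d := by
  constructor
  · have h1 : fderiv ℝ (fun x => f (c • x)) z = c • fderiv ℝ f (c • z) := fderiv_comp_smul c
    rw [h1, norm_smul, Real.norm_eq_abs]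
    exact mul_le_mul_of_nonneg_left h.norm_fderiv_le (abs_nonneg _)
  · rw [fderiv_fderiv_comp_smul, norm_smul, ← sq, Real.norm_of_nonneg (sq_nonneg _)]
    exact mul_le_mul_of_nonneg_left h.norm_fderiv_fderiv_le (sq_nonneg _)

end SecondOrder

/-! ### The approximate solution in neck coordinates -/

section NeckForm

set_option maxSynthPendingDepth 3

open ConnectedSum

variable {n : ℕ}

/-- The function `p` for which `u_ε = u₁ (1 + ε^{2w} p)` on the first half of the neck; it does not
depend on `ε`. -/
noncomputable def neckFactor (w : ℝ) (χ₀ : ℝ → ℝ) (z : Eucl n) : ℝ :=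
  χ₀ (Real.log ‖z‖) * radialPow w z

/-- The metric `G` in the inverted coordinates, rescaled so as to be close to the flat metric. -/
noncomputable def invPull (ε : ℝ) (G : Eucl n → BilinForm n) (z : Eucl n) : BilinForm n :=
  (‖z‖ ^ 4 / ε ^ 4) • pullMetric (invert ε) G z

/-- The metric `|z|² (g_cyl + η a⁽¹⁾ + (1 - η) a⁽²⁾)`, conformal to the approximate solution. -/
noncomputable def neckBase (η : ℝ → ℝ) (ε : ℝ) (G₁ G₂ : Eucl n → BilinForm n) (z : Eucl n) :
    BilinForm n :=
  η (neckTime ε z) • G₁ z + (1 - η (neckTime ε z)) • invPull ε G₂ z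

theorem weight_pos {k : ℕ} (hk : 1 ≤ k) (hkn : 2 * k < n) : 0 < weight n k := by
  have h1 : (1 : ℝ) ≤ k := by exact_mod_cast hk
  have h2 : 2 * (k : ℝ) < n := by exact_mod_cast hkn
  unfold weight
  exact div_pos (by linarith) (by linarith)

theorem confExp_eq {k : ℕ} (hk : 1 ≤ k) (hkn : 2 * k < n) : confExp n k = 2 / weight n k := by
  have h1 : (1 : ℝ) ≤ k := by exact_mod_cast hk
  have h2 : 2 * (k : ℝ) < n := by exact_mod_cast hkn
  have h3 : (n : ℝ) - 2 * k ≠ 0 := by linarith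
  unfold confExp weight
  field_simp
  norm_num

/-- On the first half of the neck `χ = 1`, and the approximate solution is the conformal multiple
`(1 + ε^{2w} p)^{2/w}` of `neckBase`: `u₁^{2/w} = |z|²` and `u₂ / u₁ = ε^{2w} |z|^{-2w}`. -/
theorem neckForm_eq {k : ℕ} (hk : 1 ≤ k) (hkn : 2 * k < n) {η χ₀ : ℝ → ℝ} (hχ : IsCutoff χ₀ 0)
    {ε : ℝ} (hε : 0 < ε) (G₁ G₂ : Eucl n → BilinForm n) {z : Eucl n} (hz : z ≠ 0)
    (ht : neckTime ε z + Real.log ε ≤ -1) :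
    neckForm k η χ₀ ε G₁ G₂ z =
      confMetric (logFactor (weight n k) (ε ^ (2 * weight n k)) (neckFactor (weight n k) χ₀))
        (neckBase η ε G₁ G₂) z := by
  have hw := weight_pos hk hkn
  rw [neckForm, remainder₁, remainder₂, confExp_eq hk hkn, confMetric, neckBase, invPull, cylForm]
  set w := weight n k with hwdef
  have hr : 0 < ‖z‖ := norm_pos_iff.2 hz
  set r := ‖z‖ with hrdef
  have hu1 : u₁ n k ε (neckTime ε z) = r ^ w := by
    rw [u₁, Real.rpow_def_of_pos hε, Real.rpow_def_of_pos hr, ← Real.exp_add, neckTime]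
    congr 1; rw [← hwdef, ← hrdef]; ring
  have hu2 : u₂ n k ε (neckTime ε z) = ε ^ (2 * w) * r ^ (-w) := by
    rw [u₂, Real.rpow_def_of_pos hε, Real.rpow_def_of_pos hε, Real.rpow_def_of_pos hr,
      ← Real.exp_add, ← Real.exp_add, neckTime]
    congr 1; rw [← hwdef, ← hrdef]; ring
  have hu1' : u₁ n k ε (neckTime ε z) ^ (2 / w) = r ^ 2 := by
    rw [hu1, ← Real.rpow_mul hr.le, mul_div_cancel₀ _ hw.ne', Real.rpow_two]
  have hu2' : u₂ n k ε (neckTime ε z) ^ (2 / w) = ε ^ 4 / r ^ 2 := by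
    rw [hu2, Real.mul_rpow (by positivity) (by positivity), ← Real.rpow_mul hε.le,
      ← Real.rpow_mul hr.le, show 2 * w * (2 / w) = (4 : ℕ) by field_simp; norm_num,
      show -w * (2 / w) = -((2 : ℕ) : ℝ) by field_simp; norm_num, Real.rpow_neg hr.le,
      Real.rpow_natCast, Real.rpow_natCast]
    rfl
  have hp : radialPow w z = r ^ (-w) * r ^ (-w) := by
    rw [radialPow, ← Real.rpow_add hr, ← hrdef, ← Real.rpow_natCast, ← Real.rpow_mul hr.le]
    congr 1; push_cast; ring
  have hpp : 0 ≤ ε ^ (2 * w) * neckFactor w χ₀ z := by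
    have := (hχ.2.2.1 (Real.log ‖z‖)).1
    have h2 := radialPow_pos (w := w) hz
    unfold neckFactor
    positivity
  have hrr : r ^ w * r ^ (-w) = 1 := by
    rw [← Real.rpow_add hr, add_neg_cancel, Real.rpow_zero]
  have hu : uApprox n k χ₀ ε (neckTime ε z) =
      r ^ w * (1 + ε ^ (2 * w) * neckFactor w χ₀ z) := by
    have h1 : cutChi χ₀ ε (neckTime ε z) = 1 := hχ.2.2.2.1 _ ht
    have h2 : cutChi χ₀ ε (-neckTime ε z) = χ₀ (Real.log ‖z‖) := by
      rw [cutChi, neckTime]; congr 1; ring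
    rw [uApprox, h1, h2, hu1, hu2, neckFactor, hp, one_mul]
    linear_combination (-(χ₀ (Real.log ‖z‖) * (ε ^ (2 * w) * r ^ (-w)))) * hrr
  have hu' : uApprox n k χ₀ ε (neckTime ε z) ^ (2 / w) =
      r ^ 2 * Real.exp (-2 * logFactor w (ε ^ (2 * w)) (neckFactor w χ₀) z) := by
    rw [hu, Real.mul_rpow (by positivity) (by linarith), ← Real.rpow_mul hr.le,
      mul_div_cancel₀ _ hw.ne', Real.rpow_two,
      Real.rpow_def_of_pos (show 0 < 1 + ε ^ (2 * w) * neckFactor w χ₀ z by linarith), logFactor]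
    congr 2
    ring
  rw [hu', hu1', hu2', mul_comm, mul_smul]
  congr 1
  ext u v
  simp only [pullMetric, _root_.smul_apply, _root_.add_apply, _root_.sub_apply, smul_eq_mul]
  field_simp
  ring

theorem fderiv_invert {ε : ℝ} {z : Eucl n} (hz : z ≠ 0) :
    fderiv ℝ (invert ε) z = (ε / ‖z‖) ^ 2 • ((ℝ ∙ z)ᗮ.reflection : Eucl n →L[ℝ] Eucl n) := by
  have := (EuclideanGeometry.hasFDerivAt_inversion (R := ε) hz).fderiv
  rw [sub_zero, dist_zero_right, ← invert_eq] at this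
  exact this

theorem localDiffeo_invert {ε : ℝ} (hε : ε ≠ 0) {z : Eucl n} (hz : z ≠ 0) :
    LocalDiffeo (invert ε) z := by
  constructor
  · filter_upwards [isOpen_ne.mem_nhds hz] with z' hz'
    exact contDiffAt_invert ε hz'
  · have hc : (ε / ‖z‖) ^ 2 ≠ 0 := pow_ne_zero _ (div_ne_zero hε (norm_ne_zero_iff.2 hz))
    rw [fderiv_invert hz]
    refine ContinuousLinearMap.IsInvertible.of_inverse
      (g := ((ε / ‖z‖) ^ 2)⁻¹ • ((ℝ ∙ z)ᗮ.reflection : Eucl n →L[ℝ] Eucl n)) ?_ ?_ <;>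
    · ext1 v
      simp [smul_smul, hc]

/-- The pull-back of bilinear forms by a linear map, as a linear map of forms. -/
noncomputable def pullCLM (L : Eucl n →L[ℝ] Eucl n) : BilinForm n →L[ℝ] BilinForm n :=
  (ContinuousLinearMap.compL ℝ (Eucl n) (Eucl n →L[ℝ] ℝ) (Eucl n →L[ℝ] ℝ)
    ((ContinuousLinearMap.compL ℝ (Eucl n) (Eucl n) ℝ).flip L)) ∘L
    ((ContinuousLinearMap.compL ℝ (Eucl n) (Eucl n) (Eucl n →L[ℝ] ℝ)).flip L)

theorem pullCLM_apply (L : Eucl n →L[ℝ] Eucl n) (B : BilinForm n) (u v : Eucl n) :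
    pullCLM L B u v = B (L u) (L v) := rfl

theorem contDiff_pullCLM : ContDiff ℝ ∞ (pullCLM : (Eucl n →L[ℝ] Eucl n) → _) := by
  have h1 : ContDiff ℝ ∞ fun L : Eucl n →L[ℝ] Eucl n =>
      ContinuousLinearMap.compL ℝ (Eucl n) (Eucl n →L[ℝ] ℝ) (Eucl n →L[ℝ] ℝ)
        ((ContinuousLinearMap.compL ℝ (Eucl n) (Eucl n) ℝ).flip L) :=
    (ContinuousLinearMap.contDiff _).comp (ContinuousLinearMap.contDiff _)
  have h2 : ContDiff ℝ ∞ fun L : Eucl n →L[ℝ] Eucl n =>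
      (ContinuousLinearMap.compL ℝ (Eucl n) (Eucl n) (Eucl n →L[ℝ] ℝ)).flip L :=
    ContinuousLinearMap.contDiff _
  exact h1.clm_comp h2

end NeckForm

/-! ### Metrics with bounded geometry on the unit ball, and their gluing -/

section NeckBase

set_option maxSynthPendingDepth 3

open ConnectedSum

variable {n : ℕ}

theorem MetricNear.congr {G G' : Eucl n → BilinForm n} {z : Eucl n} (h : MetricNear G z)
    (hG : G =ᶠ[𝓝 z] G') : MetricNear G' z := by
  constructor
  · filter_upwards [h.smooth_nhds, hG.eventuallyEq_nhds] with z' h1 h2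
    exact h1.congr_of_eventuallyEq h2.symm
  · filter_upwards [h.inner, hG] with z' h1 h2
    rwa [← h2]

/-- A metric on the closed unit ball with bounded geometry and vanishing first order terms at the
origin. -/
structure UnitBallMetric (m : ℕ) (Λ δ : ℝ) (G : Eucl n → BilinForm n) : Prop where
  near : ∀ z, ‖z‖ ≤ 1 → MetricNear G z
  jet : ∀ z, ‖z‖ ≤ 1 → metricJet G z ∈ boundedJets n Λ
  zero : G 0 = euclForm n
  fderiv_zero : fderiv ℝ G 0 = 0
  sigma : ∀ z, ‖z‖ ≤ 1 → ∀ j, 1 ≤ j → j ≤ m → δ ≤ sigmaCoord G j z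

namespace UnitBallMetric

variable {m : ℕ} {Λ δ : ℝ} {G : Eucl n → BilinForm n}

/-- The first derivative vanishes at the origin. -/
theorem norm_fderiv_le (h : UnitBallMetric m Λ δ G) {z : Eucl n} (hz : ‖z‖ ≤ 1) :
    ‖fderiv ℝ G z‖ ≤ Λ * ‖z‖ := by
  have := (convex_closedBall (0 : Eucl n) 1).norm_image_sub_le_of_norm_fderiv_le (𝕜 := ℝ)
    (f := fderiv ℝ G) (C := Λ) (x := 0) (y := z)
    (fun x hx => (h.near x (by simpa using hx)).smooth_fderiv.differentiableAt (by simp))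
    (fun x hx => (h.jet x (by simpa using hx)).2.2.2.2) (by simp) (by simpa using hz)
  simpa [h.fderiv_zero] using this

theorem nonneg (h : UnitBallMetric m Λ δ G) : 0 ≤ Λ :=
  (norm_nonneg _).trans (h.jet 0 (by simp)).2.2.1

theorem norm_sub_le (h : UnitBallMetric m Λ δ G) {z : Eucl n} (hz : ‖z‖ ≤ 1) :
    ‖G z - euclForm n‖ ≤ Λ * ‖z‖ ^ 2 := by
  have := (convex_closedBall (0 : Eucl n) ‖z‖).norm_image_sub_le_of_norm_fderiv_le (𝕜 := ℝ)
    (f := G) (C := Λ * ‖z‖) (x := 0) (y := z)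
    (fun x hx => (h.near x ((by simpa using hx : ‖x‖ ≤ ‖z‖).trans hz)).differentiableAt)
    (fun x hx => (h.norm_fderiv_le ((by simpa using hx : ‖x‖ ≤ ‖z‖).trans hz)).trans
      (mul_le_mul_of_nonneg_left (by simpa using hx) h.nonneg)) (by simp) (by simp)
  rw [h.zero, sub_zero] at this
  linarith

theorem norm_fderiv_fderiv_le (h : UnitBallMetric m Λ δ G) {z : Eucl n} (hz : ‖z‖ ≤ 1) :
    ‖fderiv ℝ (fderiv ℝ G) z‖ ≤ Λ := (h.jet z hz).2.2.2.2

/-- On the scale `ε`, the metric is `ε²`-close to the flat one. -/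
theorem c2Le_scaled (h : UnitBallMetric m Λ δ G) {ε R : ℝ} (hε : 0 < ε) (hR : 1 ≤ R)
    (hεR : ε * R ≤ 1) {ζ : Eucl n} (hζ : ‖ζ‖ ≤ R) :
    C2Le (fun ζ => G (ε • ζ) - euclForm n) ζ (Λ * R ^ 2 * ε ^ 2) := by
  have hz : ‖ε • ζ‖ = ε * ‖ζ‖ := by rw [norm_smul, Real.norm_of_nonneg hε.le]
  have hz1 : ‖ε • ζ‖ ≤ 1 := by rw [hz]; exact (by gcongr : ε * ‖ζ‖ ≤ ε * R).trans hεR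
  have hΛ := h.nonneg
  have hf : fderiv ℝ (fun z => G z - euclForm n) = fderiv ℝ G := by
    funext z; exact fderiv_sub_const _
  have hd1 : fderiv ℝ (fun ζ => G (ε • ζ) - euclForm n) ζ = ε • fderiv ℝ G (ε • ζ) := by
    rw [← hf]; exact fderiv_comp_smul (f := fun z => G z - euclForm n) ε
  have hd2 := fderiv_fderiv_comp_smul (fun z => G z - euclForm n) ε ζ
  rw [hf] at hd2
  refine ⟨?_, ?_, ?_, ?_⟩
  · have h1 : ContDiffAt ℝ 2 (fun ζ : Eucl n => ε • ζ) ζ := contDiffAt_id.const_smul ε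
    have h2 : ContDiffAt ℝ 2 G (ε • ζ) :=
      (h.near _ hz1).smooth.of_le (by simpa using ENat.LEInfty.out)
    exact (ContDiffAt.comp ζ h2 h1).sub contDiffAt_const
  · refine (h.norm_sub_le hz1).trans ?_
    rw [hz]
    calc Λ * (ε * ‖ζ‖) ^ 2 ≤ Λ * (ε * R) ^ 2 := by gcongr
      _ = _ := by ring
  · rw [hd1, norm_smul, Real.norm_of_nonneg hε.le]
    calc ε * ‖fderiv ℝ G (ε • ζ)‖ ≤ ε * (Λ * ‖ε • ζ‖) := by
          gcongr; exact h.norm_fderiv_le hz1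
      _ = Λ * ε ^ 2 * ‖ζ‖ := by rw [hz]; ring
      _ ≤ Λ * ε ^ 2 * R ^ 2 := by gcongr; nlinarith
      _ = _ := by ring
  · rw [hd2, norm_smul, Real.norm_of_nonneg (by positivity)]
    calc ε * ε * ‖fderiv ℝ (fderiv ℝ G) (ε • ζ)‖ ≤ ε * ε * Λ := by
          gcongr; exact h.norm_fderiv_fderiv_le hz1
      _ = Λ * 1 * ε ^ 2 := by ring
      _ ≤ _ := by gcongr; exact one_le_pow₀ hR

end UnitBallMetric

variable {η : ℝ → ℝ} {ε : ℝ}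

theorem neckTime_smul (hε : 0 < ε) {ζ : Eucl n} (hζ : ζ ≠ 0) :
    neckTime ε (ε • ζ) = -Real.log ‖ζ‖ := by
  rw [neckTime, norm_smul, Real.norm_of_nonneg hε.le,
    Real.log_mul hε.ne' (norm_ne_zero_iff.2 hζ)]
  ring

theorem invert_smul (hε : 0 < ε) (ζ : Eucl n) : invert ε (ε • ζ) = ε • invert 1 ζ := by
  rw [invert, invert, norm_smul, Real.norm_of_nonneg hε.le, smul_smul, smul_smul]
  congr 1
  rcases eq_or_ne ‖ζ‖ 0 with h | h
  · simp [h]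
  · field_simp

theorem fderiv_invert_smul (hε : 0 < ε) (ζ : Eucl n) :
    fderiv ℝ (invert ε) (ε • ζ) = fderiv ℝ (invert 1) ζ := by
  have h1 : (invert ε : Eucl n → Eucl n) = fun z => ε • invert 1 (ε⁻¹ • z) := by
    funext z
    rw [← invert_smul hε, smul_inv_smul₀ hε.ne']
  have h2 := congrFun (fderiv_const_smul_field (𝕜 := ℝ) ε
    (f := fun z : Eucl n => invert 1 (ε⁻¹ • z))) (ε • ζ)
  have h3 : fderiv ℝ (fun z : Eucl n => invert 1 (ε⁻¹ • z)) (ε • ζ) = _ := fderiv_comp_smul ε⁻¹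
  rw [Pi.smul_apply, h3, inv_smul_smul₀ hε.ne', smul_inv_smul₀ hε.ne'] at h2
  rw [h1, ← h2]
  rfl

/-- The pull-back of forms by the inversion, normalized to preserve the Euclidean form. -/
noncomputable def inversionPull (ζ : Eucl n) : BilinForm n →L[ℝ] BilinForm n :=
  ‖ζ‖ ^ 4 • pullCLM (fderiv ℝ (invert 1) ζ)

theorem inversionPull_euclForm {ζ : Eucl n} (hζ : ζ ≠ 0) :
    inversionPull ζ (euclForm n) = euclForm n := by
  ext u v
  have : ‖ζ‖ ≠ 0 := norm_ne_zero_iff.2 hζ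
  rw [inversionPull, _root_.smul_apply, _root_.smul_apply, _root_.smul_apply, pullCLM_apply,
    fderiv_invert hζ, euclForm_apply, euclForm_apply]
  simp only [_root_.smul_apply, real_inner_smul_left, real_inner_smul_right, smul_eq_mul]
  have h2 := LinearIsometryEquiv.inner_map_map (ℝ ∙ ζ)ᗮ.reflection u v
  have h3 : (inner ℝ (((ℝ ∙ ζ)ᗮ.reflection : Eucl n →L[ℝ] Eucl n) u)
      (((ℝ ∙ ζ)ᗮ.reflection : Eucl n →L[ℝ] Eucl n) v) : ℝ) = inner ℝ u v := h2
  rw [h3]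
  field_simp

/-- On the scale `ε`, the deviation of `neckBase` from the flat metric is obtained from those of the two
metrics by operations that do not depend on `ε`. -/
theorem neckBase_smul (hε : 0 < ε) {ζ : Eucl n} (hζ : ζ ≠ 0) (G₁ G₂ : Eucl n → BilinForm n) :
    neckBase η ε G₁ G₂ (ε • ζ) - euclForm n =
      (η (-Real.log ‖ζ‖) • ContinuousLinearMap.id ℝ (BilinForm n)) (G₁ (ε • ζ) - euclForm n) +
      ((1 - η (-Real.log ‖ζ‖)) • inversionPull ζ) (G₂ (ε • invert 1 ζ) - euclForm n) := by
  have h1 : invPull ε G₂ (ε • ζ) = inversionPull ζ (G₂ (ε • invert 1 ζ)) := by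
    rw [invPull, inversionPull, pullMetric, invert_smul hε, fderiv_invert_smul hε, norm_smul,
      Real.norm_of_nonneg hε.le]
    ext u v
    simp only [_root_.smul_apply, ContinuousLinearMap.bilinearComp_apply, pullCLM_apply]
    congr 1
    field_simp
  rw [neckBase, neckTime_smul hε hζ, h1, _root_.smul_apply, _root_.smul_apply, map_sub, map_sub,
    inversionPull_euclForm hζ, ContinuousLinearMap.id_apply, ContinuousLinearMap.id_apply]
  module

theorem contDiffAt_invPull {G : Eucl n → BilinForm n} (hε : ε ≠ 0) {z : Eucl n} (hz : z ≠ 0)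
    (hG : MetricNear G (invert ε z)) : ContDiffAt ℝ ∞ (invPull ε G) z := by
  have h1 : ContDiffAt ℝ ∞ (fun z : Eucl n => ‖z‖) z := contDiffAt_norm ℝ hz
  exact ((h1.pow 4).div_const _).smul ((localDiffeo_invert hε hz).contDiffAt_pullMetric hG)

theorem contDiffAt_neckTime {z : Eucl n} (hz : z ≠ 0) : ContDiffAt ℝ ∞ (neckTime ε) z :=
  contDiffAt_const.sub ((contDiffAt_norm ℝ hz).log (norm_ne_zero_iff.2 hz))

theorem metricNear_neckBase {G₁ G₂ : Eucl n → BilinForm n} {b : ℝ} (hη : IsCutoff η b)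
    (hε : 0 < ε) {z : Eucl n} (hz : z ≠ 0) (h1 : MetricNear G₁ z)
    (h2 : MetricNear G₂ (invert ε z)) : MetricNear (neckBase η ε G₁ G₂) z := by
  have h2' := (contDiffAt_invert ε hz).continuousAt.eventually h2.eventually
  constructor
  · filter_upwards [h1.eventually, h2', isOpen_ne.mem_nhds hz] with z' k1 k2 k3
    have ht : ContDiffAt ℝ ∞ (fun z => η (neckTime ε z)) z' :=
      hη.1.contDiffAt.comp z' (contDiffAt_neckTime k3)
    exact (ht.smul k1.smooth).add ((contDiffAt_const.sub ht).smul (contDiffAt_invPull hε.ne' k3 k2))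
  · filter_upwards [h1.eventually, h2', isOpen_ne.mem_nhds hz] with z' k1 k2 k3
    have hP := (localDiffeo_invert hε.ne' k3).inner_pullMetric k2
    obtain ⟨ht0, ht1⟩ := hη.2.2.1 (neckTime ε z')
    have hc : 0 < ‖z'‖ ^ 4 / ε ^ 4 := by positivity
    refine ⟨fun u v => ?_, fun v hv => ?_⟩
    · simp only [neckBase, invPull, _root_.add_apply, _root_.smul_apply, k1.self.symm u v,
        hP.symm u v]
    · simp only [neckBase, invPull, _root_.add_apply, _root_.smul_apply, smul_eq_mul]
      have p1 := k1.self.pos v hv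
      have p2 := mul_pos hc (hP.pos v hv)
      rcases ht0.eq_or_lt with h0 | h0
      · rw [← h0]; linarith
      · nlinarith [mul_pos h0 p1, mul_nonneg (sub_nonneg.2 ht1) p2.le]

/-- In the middle of the neck, at the scale `ε`, the metric `neckBase` is `ε²`-close to the flat
one. -/
theorem exists_neckBase_scaled (n m : ℕ) {b : ℝ} (hη : IsCutoff η b) (Λ δ : ℝ) :
    ∃ C : ℝ, 0 < C ∧ ∀ G₁ G₂ : Eucl n → BilinForm n, UnitBallMetric m Λ δ G₁ →
      UnitBallMetric m Λ δ G₂ → ∀ ε : ℝ, 0 < ε → ε * Real.exp 1 ≤ 1 → ∀ ζ : Eucl n,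
      Real.exp (-1) ≤ ‖ζ‖ → ‖ζ‖ ≤ Real.exp 1 →
      C2Le (fun ζ => neckBase η ε G₁ G₂ (ε • ζ) - euclForm n) ζ (C * ε ^ 2) := by
  set K : Set (Eucl n) := {ζ | Real.exp (-1) ≤ ‖ζ‖ ∧ ‖ζ‖ ≤ Real.exp 1} with hK
  have hK0 : ∀ ζ ∈ K, ζ ≠ 0 := fun ζ hζ => norm_pos_iff.1 ((Real.exp_pos _).trans_le hζ.1)
  have hKc : IsCompact K := by
    refine (isCompact_closedBall (0 : Eucl n) (Real.exp 1)).of_isClosed_subset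
      ((isClosed_le continuous_const continuous_norm).inter
        (isClosed_le continuous_norm continuous_const)) fun ζ hζ => by simpa using hζ.2
  have hψ : ∀ ζ ∈ K, ContDiffAt ℝ ∞ (fun ζ : Eucl n => η (-Real.log ‖ζ‖)) ζ := fun ζ hζ =>
    hη.1.contDiffAt.comp ζ ((contDiffAt_norm ℝ (hK0 ζ hζ)).log
      (norm_ne_zero_iff.2 (hK0 ζ hζ))).neg
  obtain ⟨a, ha1, ha⟩ := exists_C2Le hKc (f := fun ζ : Eucl n =>
    η (-Real.log ‖ζ‖) • ContinuousLinearMap.id ℝ (BilinForm n))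
    fun ζ hζ => (hψ ζ hζ).smul contDiffAt_const
  obtain ⟨b, hb1, hb⟩ := exists_C2Le hKc (f := fun ζ : Eucl n =>
    (1 - η (-Real.log ‖ζ‖)) • inversionPull ζ) fun ζ hζ =>
      (contDiffAt_const.sub (hψ ζ hζ)).smul (((contDiffAt_norm ℝ (hK0 ζ hζ)).pow 4).smul
        (contDiff_pullCLM.contDiffAt.comp ζ ((contDiffAt_invert 1 (hK0 ζ hζ)).fderiv_right
          (m := ∞) (by simp))))
  obtain ⟨d, hd1, hd⟩ := exists_C2Le hKc (f := (invert 1 : Eucl n → Eucl n)) fun ζ hζ =>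
    contDiffAt_invert 1 (hK0 ζ hζ)
  refine ⟨4 * (a * (|Λ| * Real.exp 1 ^ 2)) + 4 * (b * (2 * (|Λ| * Real.exp 1 ^ 2) * d ^ 2)) + 1,
    by positivity, fun G₁ G₂ h1 h2 ε hε hεe ζ hζ1 hζ2 => ?_⟩
  have hζ : ζ ∈ K := ⟨hζ1, hζ2⟩
  have hR : 1 ≤ Real.exp 1 := Real.one_le_exp (by norm_num)
  have hinv : ‖invert 1 ζ‖ ≤ Real.exp 1 := by
    rw [norm_invert, one_pow, one_div, ← inv_inv (Real.exp 1), ← Real.exp_neg]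
    exact inv_anti₀ (Real.exp_pos _) hζ1
  have e1 := (ha ζ hζ).clm_apply (h1.c2Le_scaled hε hR hεe hζ2)
  have e2 := (hb ζ hζ).clm_apply ((h2.c2Le_scaled hε hR hεe hinv).comp hd1 (hd ζ hζ))
  have e3 := e1.add e2
  have hΛ : |Λ| = Λ := abs_of_nonneg h1.nonneg
  have hle : 4 * (a * (Λ * Real.exp 1 ^ 2 * ε ^ 2)) +
      4 * (b * (2 * (Λ * Real.exp 1 ^ 2 * ε ^ 2) * d ^ 2)) ≤
      (4 * (a * (|Λ| * Real.exp 1 ^ 2)) + 4 * (b * (2 * (|Λ| * Real.exp 1 ^ 2) * d ^ 2)) + 1)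
        * ε ^ 2 := by
    rw [hΛ]; nlinarith [sq_nonneg ε]
  refine (e3.mono hle).congr ?_
  filter_upwards [isOpen_ne.mem_nhds (hK0 ζ hζ)] with ζ' h'
  exact neckBase_smul hε h' G₁ G₂

/-- The estimates of `exists_neckBase_scaled`, scaled back. The second derivatives are bounded only, since
the gluing takes place on the scale `ε`. -/
theorem exists_neckBase_bound (n m : ℕ) {b : ℝ} (hη : IsCutoff η b) (Λ δ : ℝ) :
    ∃ C : ℝ, 0 < C ∧ ∀ G₁ G₂ : Eucl n → BilinForm n, UnitBallMetric m Λ δ G₁ →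
      UnitBallMetric m Λ δ G₂ → ∀ ε : ℝ, 0 < ε → ε * Real.exp 1 ≤ 1 → ∀ z : Eucl n,
      ε * Real.exp (-1) ≤ ‖z‖ → ‖z‖ ≤ ε * Real.exp 1 →
      ‖neckBase η ε G₁ G₂ z - euclForm n‖ ≤ C * ε ^ 2 ∧
      ‖fderiv ℝ (neckBase η ε G₁ G₂) z‖ ≤ C * ε ∧
      ‖fderiv ℝ (fderiv ℝ (neckBase η ε G₁ G₂)) z‖ ≤ C := by
  obtain ⟨C, hC, h⟩ := exists_neckBase_scaled n m hη Λ δ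
  refine ⟨C, hC, fun G₁ G₂ h1 h2 ε hε hεe z hz1 hz2 => ?_⟩
  have hnorm : ‖ε⁻¹ • z‖ = ‖z‖ / ε := by
    rw [norm_smul, norm_inv, Real.norm_of_nonneg hε.le]; ring
  have key := h G₁ G₂ h1 h2 ε hε hεe (ε⁻¹ • z)
    (by rw [hnorm, le_div_iff₀ hε]; linarith) (by rw [hnorm, div_le_iff₀ hε]; linarith)
  set F := fun ζ => neckBase η ε G₁ G₂ (ε • ζ) - euclForm n with hF
  have hFz : ∀ z, F (ε⁻¹ • z) = neckBase η ε G₁ G₂ z - euclForm n := fun z => by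
    rw [hF]; simp only [smul_inv_smul₀ hε.ne']
  have hf : fderiv ℝ (neckBase η ε G₁ G₂) = fderiv ℝ (fun z => F (ε⁻¹ • z)) := by
    simp only [hFz]
    funext z; exact (fderiv_sub_const _).symm
  refine ⟨?_, ?_, ?_⟩
  · rw [← hFz]; exact key.norm_le
  · rw [hf]
    refine key.norm_comp_smul_le.1.trans (le_of_eq ?_)
    rw [abs_inv, abs_of_pos hε]
    field_simp
  · rw [hf]
    refine key.norm_comp_smul_le.2.trans (le_of_eq ?_)
    field_simp

end NeckBase

/-! ### Positivity on the first half of the neck -/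

section NeckPositivity

set_option maxSynthPendingDepth 3

open ConnectedSum

variable {n : ℕ}

/-- The quantity `ρ = (ε / |z|)^{2w}`, which is small on the `M₁` side of the neck and of order one in its
middle. -/
theorem mul_radialPow {w ε : ℝ} (hε : 0 < ε) {z : Eucl n} (hz : z ≠ 0) :
    ε ^ (2 * w) * radialPow w z = (ε / ‖z‖) ^ (2 * w) := by
  have hr : 0 < ‖z‖ := norm_pos_iff.2 hz
  rw [radialPow, Real.div_rpow hε.le hr.le, ← Real.rpow_natCast, ← Real.rpow_mul hr.le,
    div_eq_mul_inv, ← Real.rpow_neg hr.le]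
  congr 2
  push_cast; ring

theorem mul_radialPow_le {w ε : ℝ} (hw : 0 < w) (hε : 0 < ε) {z : Eucl n}
    (hz : ε * Real.exp (-1) ≤ ‖z‖) : ε ^ (2 * w) * radialPow w z ≤ Real.exp (2 * w) := by
  have hr : 0 < ‖z‖ := (by positivity : 0 < ε * Real.exp (-1)).trans_le hz
  rw [mul_radialPow hε (norm_pos_iff.1 hr)]
  calc (ε / ‖z‖) ^ (2 * w) ≤ (Real.exp 1) ^ (2 * w) := by
        refine Real.rpow_le_rpow (by positivity) ?_ (by positivity)
        rw [div_le_iff₀ hr]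
        rw [Real.exp_neg, ← div_eq_mul_inv, div_le_iff₀ (Real.exp_pos 1)] at hz
        linarith
    _ = _ := by rw [← Real.exp_mul]; ring_nf

theorem le_mul_radialPow {w ε : ℝ} (hw : 0 < w) (hε : 0 < ε) {z : Eucl n} (hz0 : z ≠ 0)
    (hz : ‖z‖ ≤ ε * Real.exp 1) : Real.exp (-(2 * w)) ≤ ε ^ (2 * w) * radialPow w z := by
  have hr : 0 < ‖z‖ := norm_pos_iff.2 hz0
  rw [mul_radialPow hε hz0]
  calc Real.exp (-(2 * w)) = (Real.exp (-1)) ^ (2 * w) := by rw [← Real.exp_mul]; ring_nf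
    _ ≤ _ := by
        refine Real.rpow_le_rpow (Real.exp_pos _).le ?_ (by positivity)
        rw [le_div_iff₀ hr, Real.exp_neg, inv_mul_le_iff₀ (Real.exp_pos 1)]
        linarith

theorem abs_apply_sub_le {B : BilinForm n} {c : ℝ} (h : ‖B - euclForm n‖ ≤ c) (v : Eucl n) :
    |B v v - ‖v‖ ^ 2| ≤ c * ‖v‖ ^ 2 := by
  have h1 : B v v - ‖v‖ ^ 2 = (B - euclForm n) v v := by
    rw [_root_.sub_apply, _root_.sub_apply, euclForm_apply, real_inner_self_eq_norm_sq]
  rw [h1]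
  calc |(B - euclForm n) v v| ≤ ‖B - euclForm n‖ * ‖v‖ * ‖v‖ := (B - euclForm n).le_opNorm₂ v v
    _ ≤ c * ‖v‖ * ‖v‖ := by gcongr
    _ = _ := by ring

theorem contDiffAt_neckFactor {w : ℝ} {χ₀ : ℝ → ℝ} (hχ : IsCutoff χ₀ 0) {z : Eucl n} (hz : z ≠ 0) :
    ContDiffAt ℝ ∞ (neckFactor w χ₀) z :=
  (hχ.1.contDiffAt.comp z ((contDiffAt_norm ℝ hz).log (norm_ne_zero_iff.2 hz))).mul
    (contDiffAt_radialPow hz)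

theorem neckFactor_nonneg {w : ℝ} {χ₀ : ℝ → ℝ} (hχ : IsCutoff χ₀ 0) (z : Eucl n) :
    0 ≤ neckFactor w χ₀ z :=
  mul_nonneg (hχ.2.2.1 _).1 (Real.rpow_nonneg (by positivity) _)

/-- The cut-off `χ(-t)` is constant for `|z| < e⁻¹`. -/
theorem neckFactor_eventuallyEq {w : ℝ} {χ₀ : ℝ → ℝ} (hχ : IsCutoff χ₀ 0) {z : Eucl n} (hz : z ≠ 0)
    (hz2 : ‖z‖ < Real.exp (-1)) : neckFactor w χ₀ =ᶠ[𝓝 z] radialPow w := by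
  filter_upwards [isOpen_ne.mem_nhds hz,
    (isOpen_lt continuous_norm continuous_const).mem_nhds hz2] with z' h1 h2
  have h3 : Real.log ‖z'‖ ≤ -1 := by
    rw [← Real.log_exp (-1)]
    exact Real.log_le_log (norm_pos_iff.2 h1) (le_of_lt h2)
  rw [neckFactor, hχ.2.2.2.1 _ h3, one_mul]

theorem confMetric_congr {f f' : Eucl n → ℝ} {G G' : Eucl n → BilinForm n} {z : Eucl n}
    (hf : f =ᶠ[𝓝 z] f') (hG : G =ᶠ[𝓝 z] G') : confMetric f G =ᶠ[𝓝 z] confMetric f' G' := by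
  filter_upwards [hf, hG] with z' h1 h2
  rw [confMetric, confMetric, h1, h2]

theorem logFactor_congr {w σ : ℝ} {p p' : Eucl n → ℝ} {z : Eucl n} (h : p =ᶠ[𝓝 z] p') :
    logFactor w σ p =ᶠ[𝓝 z] logFactor w σ p' := by
  filter_upwards [h] with z' h1
  rw [logFactor, logFactor, h1]

/-- The metrics are glued only where `-1 ≤ t ≤ 1`, that is `ε e⁻¹ ≤ |z| ≤ ε e`. -/
theorem neckBase_eventuallyEq {η : ℝ → ℝ} {b : ℝ} (hη : IsCutoff η b) {ε : ℝ} (hε : 0 < ε)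
    (G₁ G₂ : Eucl n → BilinForm n) {z : Eucl n} (hz : ε * Real.exp 1 < ‖z‖) :
    neckBase η ε G₁ G₂ =ᶠ[𝓝 z] G₁ := by
  filter_upwards [(isOpen_lt continuous_const continuous_norm).mem_nhds hz] with z' h1
  have h2 : neckTime ε z' ≤ -1 := by
    have := Real.log_le_log (by positivity) (le_of_lt h1)
    rw [Real.log_mul hε.ne' (Real.exp_pos 1).ne', Real.log_exp] at this
    rw [neckTime]; linarith
  rw [neckBase, hη.2.2.2.1 _ h2]
  simp

/-- The estimates on the size of `ε` used on the first half of the neck. -/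
theorem eventually_small {w : ℝ} (hw : 0 < w) {r₀ A c B b : ℝ} (hr₀ : 0 < r₀) (hc : 0 < c)
    (hb : 0 < b) : ∀ᶠ ε : ℝ in 𝓝[>] 0, ε ≤ Real.exp (-4) ∧ ε * Real.exp 1 ≤ r₀ ∧
      ε ^ (2 * w) ≤ 1 ∧ ε ^ (2 * w) * A ≤ c ∧ B * ε ^ 2 ≤ b := by
  have h0 : Tendsto (fun ε : ℝ => ε) (𝓝[>] 0) (𝓝 0) := nhdsWithin_le_nhds
  have h1 : Tendsto (fun ε : ℝ => ε ^ (2 * w)) (𝓝[>] 0) (𝓝 0) := by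
    have := (Real.continuousAt_rpow_const 0 (2 * w) (Or.inr (by positivity))).tendsto
    rw [Real.zero_rpow (by positivity)] at this
    exact this.comp h0
  have h2 := h0.mul_const (Real.exp 1)
  have h3 := h1.mul_const A
  have h4 := (h0.pow 2).const_mul B
  rw [zero_mul] at h2 h3
  rw [zero_pow two_ne_zero, mul_zero] at h4
  filter_upwards [h0.eventually_le_const (Real.exp_pos (-4)), h2.eventually_le_const hr₀,
    h1.eventually_le_const one_pos, h3.eventually_le_const hc, h4.eventually_le_const hb]
    with ε a1 a2 a3 a4 a5
  exact ⟨a1, a2, a3, a4, a5⟩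

theorem norm_fderiv_logFactor_le {w σ : ℝ} (hw : 0 < w) (hσ : 0 ≤ σ) (hσ1 : σ ≤ 1)
    {p : Eucl n → ℝ} {z : Eucl n} (hp : ∀ᶠ z' in 𝓝 z, ContDiffAt ℝ ∞ p z') (hp0 : 0 ≤ p z)
    {D : ℝ} (hD : C2Le p z D) :
    ‖fderiv ℝ (logFactor w σ p) z‖ ≤ σ * ((D + D ^ 2) / w) ∧
      ‖fderiv ℝ (fderiv ℝ (logFactor w σ p)) z‖ ≤ σ * ((D + D ^ 2) / w) := by
  have hD0 := hD.nonneg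
  have h1 : 1 ≤ 1 + σ * p z := by have := mul_nonneg hσ hp0; linarith
  have h1' : 0 < 1 + σ * p z := by linarith
  have hinv : (1 + σ * p z)⁻¹ ≤ 1 := inv_le_one_of_one_le₀ h1
  have hinv0 : 0 ≤ (1 + σ * p z)⁻¹ := inv_nonneg.2 h1'.le
  constructor
  · rw [fderiv_logFactor hp.self_of_nhds h1', norm_smul, norm_mul, norm_neg,
      Real.norm_of_nonneg (by positivity), Real.norm_of_nonneg hinv0]
    calc σ / w * (1 + σ * p z)⁻¹ * ‖fderiv ℝ p z‖ ≤ σ / w * 1 * D := by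
          gcongr; exact hD.norm_fderiv_le
      _ ≤ σ / w * 1 * (D + D ^ 2) := by gcongr; nlinarith
      _ = _ := by ring
  · refine ContinuousLinearMap.opNorm_le_bound₂ _ (by positivity) fun u v => ?_
    rw [fderiv_fderiv_logFactor hp h1', norm_mul, norm_neg, Real.norm_of_nonneg (by positivity)]
    have e1 : ‖fderiv ℝ (fderiv ℝ p) z u v‖ ≤ D * ‖u‖ * ‖v‖ :=
      ContinuousLinearMap.le_of_opNorm_le _
        (ContinuousLinearMap.le_of_opNorm_le _ hD.norm_fderiv_fderiv_le u) v
    have e2 : ∀ u, ‖fderiv ℝ p z u‖ ≤ D * ‖u‖ := fun u =>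
      ContinuousLinearMap.le_of_opNorm_le _ hD.norm_fderiv_le u
    have e3 : ‖(1 + σ * p z)⁻¹ * fderiv ℝ (fderiv ℝ p) z u v
        - σ * ((1 + σ * p z)⁻¹) ^ 2 * (fderiv ℝ p z u * fderiv ℝ p z v)‖ ≤
        1 * (D * ‖u‖ * ‖v‖) + 1 * 1 ^ 2 * ((D * ‖u‖) * (D * ‖v‖)) := by
      refine norm_sub_le_of_le ?_ ?_
      · rw [norm_mul, Real.norm_of_nonneg hinv0]
        gcongr
      · rw [norm_mul, norm_mul, norm_mul, Real.norm_of_nonneg hσ,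
          Real.norm_of_nonneg (by positivity)]
        have := e2 u
        have := e2 v
        gcongr
    calc _ ≤ σ / w * (1 * (D * ‖u‖ * ‖v‖) + 1 * 1 ^ 2 * ((D * ‖u‖) * (D * ‖v‖))) := by gcongr
      _ = _ := by ring

theorem mem_boundedJets_of_nearly_flat {G : Eucl n → BilinForm n} {z : Eucl n} {C : ℝ} (hC : 0 ≤ C)
    (h : IsInner (G z)) (h0 : ‖G z - euclForm n‖ ≤ 1 / 2) (h1 : ‖fderiv ℝ G z‖ ≤ C)
    (h2 : ‖fderiv ℝ (fderiv ℝ G) z‖ ≤ C) : metricJet G z ∈ boundedJets n (2 + C) := by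
  refine ⟨h.symm, fun v => ?_, ?_, h1.trans (by linarith), h2.trans (by linarith)⟩
  · have h3 := (abs_le.1 (abs_apply_sub_le h0 v)).1
    have h5 := mul_nonneg hC (h.nonneg v)
    change ‖v‖ ^ 2 ≤ (2 + C) * G z v v
    linarith
  · change ‖G z‖ ≤ 2 + C
    have h3 : ‖euclForm n‖ ≤ 1 := norm_innerSL_le ℝ
    have h4 := norm_add_le_of_le h0 h3
    rw [sub_add_cancel] at h4
    linarith

variable {k : ℕ} {η χ₀ : ℝ → ℝ}

set_option maxHeartbeats 800000 in
/-- The approximate solution on the first half of the neck and slightly beyond its middle. There are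
three regions. For `r₀ ≤ |z| ≤ 1` the conformal factor is `C²`-close to `1`. For `ε e < |z| ≤ r₀` the
metric `g₁` is nearly flat and multiplied by the radial factor. For `|z| ≤ ε e` the two metrics are
glued; the Schouten tensor of the result has no sign, but it is bounded, while the coefficient `s` of
the radial factor is of order `ε⁻²`. -/
theorem exists_neckForm_pos (hk : 1 ≤ k) (hkn : 2 * k < n) (hη : IsCutoff η 1)
    (hχ : IsCutoff χ₀ 0) {Λ δ : ℝ} (hΛ : 0 < Λ) (hδ : 0 < δ) :
    ∀ᶠ ε : ℝ in 𝓝[>] 0, ∀ G₁ G₂ : Eucl n → BilinForm n, UnitBallMetric (k - 1) Λ δ G₁ →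
      UnitBallMetric (k - 1) Λ δ G₂ → ∀ z : Eucl n, ‖z‖ ≤ 1 → ε * Real.exp (-1) ≤ ‖z‖ →
      MetricNear (neckForm k η χ₀ ε G₁ G₂) z ∧
        ∀ j, 1 ≤ j → j ≤ k - 1 → 0 < sigmaCoord (neckForm k η χ₀ ε G₁ G₂) j z := by
  have hn : 3 ≤ n := by omega
  set m := k - 1 with hmdef
  have hm : m ≤ n := by omega
  have hw := weight_pos hk hkn
  have hwm : n / ((m : ℝ) + 1) = 2 * weight n k + 2 := by
    have h1 : (1 : ℝ) ≤ k := by exact_mod_cast hk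
    have h2 : (m : ℝ) + 1 = k := by rw [hmdef, Nat.cast_sub hk]; ring
    rw [h2, weight]
    field_simp
    ring
  set w := weight n k with hwdef
  obtain ⟨CG, hCG, hbase⟩ := exists_neckBase_bound n m hη Λ δ
  obtain ⟨c₀, hc₀, hpert⟩ := exists_conf_perturb hn hm hΛ hδ
  obtain ⟨C₀, hC₀, hschouten⟩ := exists_schouten_bound n (show 0 < 2 + CG by positivity)
  set N : ℝ := 1 / (16 * ((m : ℝ) + 1)) with hN
  have hN0 : 0 < N := by positivity
  have hN1 : N ≤ 1 / 16 := one_div_le_one_div_of_le (by norm_num) (by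
    have : (0 : ℝ) ≤ m := Nat.cast_nonneg m
    linarith)
  -- The constants: `C` measures the deviation from the flat metric, by `C |z|²`; `Kρ` bounds `1 + ρ`;
  -- `r₀` is the radius below which the metric is nearly flat and the cut-off `χ(-t)` is constant.
  set C : ℝ := Λ + CG * Real.exp 1 ^ 2 with hC
  have hC0 : 0 < C := by positivity
  set Kρ : ℝ := 1 + Real.exp (2 * w) with hKρ
  have hKρ0 : 1 < Kρ := by have := Real.exp_pos (2 * w); linarith
  set r₀ : ℝ := min (Real.exp (-2)) (N / (7 * C * Kρ)) with hr₀
  have hr₀0 : 0 < r₀ := lt_min (Real.exp_pos _) (by positivity)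
  have hr₀1 : r₀ ≤ 1 := (min_le_left _ _).trans (Real.exp_le_one_iff.2 (by norm_num))
  have hr₀N : 7 * C * r₀ ^ 2 * Kρ ≤ N := by
    have h1 : r₀ ≤ N / (7 * C * Kρ) := min_le_right _ _
    rw [le_div_iff₀ (by positivity)] at h1
    calc 7 * C * r₀ ^ 2 * Kρ = r₀ * (r₀ * (7 * C * Kρ)) := by ring
      _ ≤ 1 * N := by gcongr
      _ = N := one_mul N
  have hKc : IsCompact {z : Eucl n | r₀ ≤ ‖z‖ ∧ ‖z‖ ≤ 1} :=
    (isCompact_closedBall (0 : Eucl n) 1).of_isClosed_subset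
      ((isClosed_le continuous_const continuous_norm).inter
        (isClosed_le continuous_norm continuous_const)) fun ζ hζ => by simpa using hζ.2
  obtain ⟨D, hD1, hD⟩ := exists_C2Le hKc (f := neckFactor (n := n) w χ₀) fun z hz =>
    contDiffAt_neckFactor hχ (norm_pos_iff.1 (hr₀0.trans_le hz.1))
  set b₀ : ℝ := 2 * Real.exp (-(2 * w)) / Kρ ^ 2 * N with hb₀
  have hb₀0 : 0 < b₀ := by positivity
  filter_upwards [self_mem_nhdsWithin, eventually_small hw (A := (D + D ^ 2) / w)
    (B := C₀ * Real.exp 1 ^ 2 + CG * 2) hr₀0 hc₀ (show 0 < min b₀ 1 by positivity)]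
    with ε (hε : 0 < ε) ⟨hε4, hεr, hσ1, hσc, hεb⟩ G₁ G₂ h1 h2 z hz1 hz2
  have hεe : ε * Real.exp 1 ≤ 1 := hεr.trans hr₀1
  have hz0 : 0 < ‖z‖ := (by positivity : 0 < ε * Real.exp (-1)).trans_le hz2
  have hz : z ≠ 0 := norm_pos_iff.1 hz0
  set σ : ℝ := ε ^ (2 * w) with hσ
  have hσ0 : 0 < σ := by positivity
  have hlogε : Real.log ε ≤ -4 := by
    rw [← Real.log_exp (-4)]; exact Real.log_le_log hε hε4
  have htime : neckTime ε z ≤ 1 := by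
    have := Real.log_le_log (by positivity) hz2
    rw [Real.log_mul hε.ne' (Real.exp_pos _).ne', Real.log_exp] at this
    rw [neckTime]; linarith
  have hform : neckForm k η χ₀ ε G₁ G₂ =ᶠ[𝓝 z]
      confMetric (logFactor w σ (neckFactor w χ₀)) (neckBase η ε G₁ G₂) := by
    have hc : ContinuousAt (fun z => neckTime ε z + Real.log ε) z :=
      (contDiffAt_neckTime hz).continuousAt.add continuousAt_const
    filter_upwards [isOpen_ne.mem_nhds hz,
      hc.eventually_lt_const (show neckTime ε z + Real.log ε < -1 by linarith)] with z' k1 k2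
    exact neckForm_eq hk hkn hχ hε G₁ G₂ k1 k2.le
  have hpe : ∀ᶠ z' in 𝓝 z, ContDiffAt ℝ ∞ (neckFactor (n := n) w χ₀) z' := by
    filter_upwards [isOpen_ne.mem_nhds hz] with z' hz'
    exact contDiffAt_neckFactor hχ hz'
  have hfe : ∀ᶠ z' in 𝓝 z, ContDiffAt ℝ ∞ (logFactor w σ (neckFactor (n := n) w χ₀)) z' := by
    filter_upwards [hpe] with z' hz'
    exact contDiffAt_logFactor hz' (by
      have := mul_nonneg hσ0.le (neckFactor_nonneg (w := w) hχ z'); linarith)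
  have hρ : 1 + σ * radialPow w z ≤ Kρ := by
    have := mul_radialPow_le hw hε hz2
    linarith
  have hρ0 : 0 < σ * radialPow w z := mul_pos hσ0 (radialPow_pos hz)
  have hsmall : ‖z‖ ≤ r₀ → 7 * C * ‖z‖ ^ 2 * (1 + σ * radialPow w z) ≤ N := fun h => by
    refine le_trans ?_ hr₀N
    gcongr
  have hradial : ‖z‖ ≤ r₀ →
      logFactor w σ (neckFactor w χ₀) =ᶠ[𝓝 z] logFactor w σ (radialPow w) := fun h =>
    logFactor_congr (neckFactor_eventuallyEq hχ hz
      ((h.trans (min_le_left _ _)).trans_lt (Real.exp_lt_exp.2 (by norm_num))))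
  rcases lt_or_ge (ε * Real.exp 1) ‖z‖ with hcase | hcase
  · -- Away from the middle of the neck only `G₁` is involved.
    have hG := neckBase_eventuallyEq hη hε G₁ G₂ hcase
    have hform1 := hform.trans (confMetric_congr (EventuallyEq.refl _ _) hG)
    refine ⟨((h1.near z hz1).conf hfe).congr hform1.symm, fun j hj1 hj => ?_⟩
    rcases le_total r₀ ‖z‖ with hr | hr
    · rw [sigmaCoord_congr hform1]
      have hbd := norm_fderiv_logFactor_le hw hσ0.le hσ1 hpe (neckFactor_nonneg hχ z)
        (hD z ⟨hr, hz1⟩)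
      exact hpert G₁ z _ (h1.near z hz1) (h1.jet z hz1) (h1.sigma z hz1) hfe (hbd.1.trans hσc)
        (hbd.2.trans hσc) j hj1 hj
    · rw [sigmaCoord_congr (hform1.trans (confMetric_congr (hradial hr) (EventuallyEq.refl _ _)))]
      refine (h1.near z hz1).sigmaCoord_neck_pos hn (hj1.trans hj) hm hz hw hwm hσ0 hC0.le
        (hsmall hr) (fun v => ?_) ?_ (Or.inl fun j hj1 hj => hδ.trans_le (h1.sigma z hz1 j hj1 hj))
        hj1 hj
      · exact abs_apply_sub_le ((h1.norm_sub_le hz1).trans (by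
          gcongr; rw [hC]; linarith [mul_pos hCG (pow_pos (Real.exp_pos 1) 2)])) v
      · exact (h1.norm_fderiv_le hz1).trans (by
          gcongr; rw [hC]; linarith [mul_pos hCG (pow_pos (Real.exp_pos 1) 2)])
  · -- In the middle of the neck, `|z|` is comparable with `ε`.
    have hr : ‖z‖ ≤ r₀ := hcase.trans hεr
    have hinv : ‖invert ε z‖ ≤ 1 := by
      rw [norm_invert, div_le_one hz0]
      rw [Real.exp_neg, ← div_eq_mul_inv, div_le_iff₀ (Real.exp_pos 1)] at hz2
      nlinarith
    have hnear := metricNear_neckBase hη hε hz (h1.near z hz1) (h2.near _ hinv)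
    refine ⟨(hnear.conf hfe).congr hform.symm, fun j hj1 hj => ?_⟩
    rw [sigmaCoord_congr (hform.trans (confMetric_congr (hradial hr) (EventuallyEq.refl _ _)))]
    obtain ⟨b1, b2, b3⟩ := hbase G₁ G₂ h1 h2 ε hε hεe z hz2 hcase
    have hεz : ε ≤ Real.exp 1 * ‖z‖ := by
      rw [Real.exp_neg, ← div_eq_mul_inv, div_le_iff₀ (Real.exp_pos 1)] at hz2
      linarith
    have hexp : 1 ≤ Real.exp 1 := Real.one_le_exp (by norm_num)
    have hεb1 : C₀ * Real.exp 1 ^ 2 * ε ^ 2 ≤ b₀ := by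
      have h3 : 0 ≤ CG * 2 * ε ^ 2 := by positivity
      have h4 := hεb.trans (min_le_left _ _)
      linarith
    have hεb2 : CG * ε ^ 2 ≤ 1 / 2 := by
      have h3 : 0 ≤ C₀ * Real.exp 1 ^ 2 * ε ^ 2 := by positivity
      have h4 := hεb.trans (min_le_right _ _)
      linarith
    have hε1 : ε ≤ 1 := hε4.trans (Real.exp_le_one_iff.2 (by norm_num))
    have hjet := mem_boundedJets_of_nearly_flat hCG.le hnear.self (b1.trans hεb2)
      (b2.trans (mul_le_of_le_one_right hCG.le hε1)) b3
    refine hnear.sigmaCoord_neck_pos hn (hj1.trans hj) hm hz hw hwm hσ0 hC0.le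
      (hsmall hr) (fun v => ?_) ?_ (Or.inr ⟨C₀, ?_, ?_⟩) hj1 hj
    · refine abs_apply_sub_le (b1.trans ?_) v
      calc CG * ε ^ 2 ≤ CG * (Real.exp 1 * ‖z‖) ^ 2 := by gcongr
        _ = CG * Real.exp 1 ^ 2 * ‖z‖ ^ 2 := by ring
        _ ≤ C * ‖z‖ ^ 2 := by gcongr; rw [hC]; linarith
    · refine b2.trans ?_
      calc CG * ε ≤ CG * (Real.exp 1 * ‖z‖) := by gcongr
        _ ≤ CG * (Real.exp 1 ^ 2 * ‖z‖) := by gcongr; nlinarith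
        _ = CG * Real.exp 1 ^ 2 * ‖z‖ := by ring
        _ ≤ C * ‖z‖ := by gcongr; rw [hC]; linarith
    · intro x
      have := hschouten _ hjet x
      rwa [hnear.schouten_metricJet] at this
    · have hlow : 2 * Real.exp (-(2 * w)) / ((ε * Real.exp 1) ^ 2 * Kρ ^ 2) ≤ neckCoeff w σ z := by
        unfold neckCoeff
        have := le_mul_radialPow hw hε hz hcase
        gcongr
      calc C₀ ≤ 2 * Real.exp (-(2 * w)) / ((ε * Real.exp 1) ^ 2 * Kρ ^ 2) * N := by
            have h3 : 2 * Real.exp (-(2 * w)) / ((ε * Real.exp 1) ^ 2 * Kρ ^ 2) * N =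
                b₀ / (Real.exp 1 ^ 2 * ε ^ 2) := by
              rw [hb₀]; field_simp
            rw [h3, le_div_iff₀ (by positivity)]
            linarith
        _ ≤ neckCoeff w σ z * N := by gcongr
        _ = _ := by rw [hN]; ring

end NeckPositivity

/-! ### Tensor fields on manifolds in coordinates -/

section Tensor

set_option maxSynthPendingDepth 3

variable {n : ℕ} {M : Type*} [TopologicalSpace M] [ChartedSpace (Eucl n) M]
  {N : Type*} [TopologicalSpace N] [ChartedSpace (Eucl n) N]

/-- The value of a tensor field at a point, as a bilinear form on `ℝⁿ`: tangent spaces are `ℝⁿ` by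
definition, and this forgets the base point. -/
noncomputable def formAt (g : TensorField n M) (q : M) : BilinForm n := g q

/-- The derivative of a map between manifolds, in the preferred charts at the two points, as a linear
map of `ℝⁿ`. -/
noncomputable def derivAt (f : N → M) (c : N) : Eucl n →L[ℝ] Eucl n :=
  mfderiv (𝓡 n) (𝓡 n) f c

theorem formAt_pullbackForm (f : N → M) (g : TensorField n M) (c : N) :
    formAt (pullbackForm f g) c =
      (formAt g (f c)).bilinearComp (derivAt f c) (derivAt f c) := rfl

theorem coordForm_eq (g : TensorField n M) (e : OpenPartialHomeomorph M (Eucl n)) (z : Eucl n) :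
    coordForm g e z =
      (formAt g (e.symm z)).bilinearComp (derivAt e.symm z) (derivAt e.symm z) := rfl

theorem derivAt_congr {f f' : N → M} {c : N} (h : f =ᶠ[𝓝 c] f') :
    derivAt (n := n) f c = derivAt f' c := h.mfderiv_eq

theorem derivAt_comp {P : Type*} [TopologicalSpace P] [ChartedSpace (Eucl n) P] {f : N → M}
    {f' : P → N} {c : P} (hf : MDifferentiableAt (𝓡 n) (𝓡 n) f (f' c))
    (hf' : MDifferentiableAt (𝓡 n) (𝓡 n) f' c) :
    derivAt (n := n) (f ∘ f') c = (derivAt f (f' c)).comp (derivAt f' c) :=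
  mfderiv_comp c hf hf'

theorem derivAt_eucl (φ : Eucl n → Eucl n) (z : Eucl n) : derivAt φ z = fderiv ℝ φ z :=
  mfderiv_eq_fderiv

theorem formAt_pullbackForm_congr {f f' : N → M} {c : N} (h : f =ᶠ[𝓝 c] f')
    (g : TensorField n M) : formAt (pullbackForm f g) c = formAt (pullbackForm f' g) c := by
  rw [formAt_pullbackForm, formAt_pullbackForm, derivAt_congr h, h.self_of_nhds]

theorem formAt_pullbackForm_comp {P : Type*} [TopologicalSpace P] [ChartedSpace (Eucl n) P]
    {f : N → M} {f' : P → N} {c : P} (hf : MDifferentiableAt (𝓡 n) (𝓡 n) f (f' c))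
    (hf' : MDifferentiableAt (𝓡 n) (𝓡 n) f' c) (g : TensorField n M) :
    formAt (pullbackForm (f ∘ f') g) c =
      (formAt (pullbackForm f g) (f' c)).bilinearComp (derivAt f' c) (derivAt f' c) := by
  rw [formAt_pullbackForm, formAt_pullbackForm, derivAt_comp hf hf']
  rfl

variable [NeZero n] [IsManifold (𝓡 n) ∞ M] [IsManifold (𝓡 n) ∞ N]

theorem mdifferentiableAt_chart {e : OpenPartialHomeomorph M (Eucl n)}
    (he : e ∈ IsManifold.maximalAtlas (𝓡 n) ∞ M) {q : M} (hq : q ∈ e.source) :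
    MDifferentiableAt (𝓡 n) (𝓡 n) e q :=
  (contMDiffAt_of_mem_maximalAtlas he hq).mdifferentiableAt (by simp)

theorem mdifferentiableAt_chart_symm {e : OpenPartialHomeomorph M (Eucl n)}
    (he : e ∈ IsManifold.maximalAtlas (𝓡 n) ∞ M) {z : Eucl n} (hz : z ∈ e.target) :
    MDifferentiableAt (𝓡 n) (𝓡 n) e.symm z :=
  (contMDiffAt_symm_of_mem_maximalAtlas he hz).mdifferentiableAt (by simp)

/-- Pulling back by `f` and expressing the result in a chart amounts to pulling back by the
coordinate expression of `f`. -/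
theorem coordForm_pullback {e : OpenPartialHomeomorph N (Eucl n)}
    (he : e ∈ IsManifold.maximalAtlas (𝓡 n) ∞ N) {z : Eucl n} (hz : z ∈ e.target) {f : N → M}
    {F : Eucl n → M} (hF : MDifferentiableAt (𝓡 n) (𝓡 n) F z)
    (hf : ∀ᶠ z' in 𝓝 z, f (e.symm z') = F z') {h : TensorField n N} {g : TensorField n M}
    (hh : formAt h (e.symm z) = formAt (pullbackForm f g) (e.symm z)) :
    coordForm h e z = formAt (pullbackForm F g) z := by
  have hq : e.symm z ∈ e.source := e.map_target hz
  have hfe : f =ᶠ[𝓝 (e.symm z)] F ∘ e := by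
    have h1 : Tendsto e (𝓝 (e.symm z)) (𝓝 z) := by
      have := e.continuousAt hq
      rwa [ContinuousAt, e.right_inv hz] at this
    filter_upwards [h1.eventually hf, e.open_source.mem_nhds hq] with q h2 h3
    rwa [e.left_inv h3] at h2
  have hFe : MDifferentiableAt (𝓡 n) (𝓡 n) (F ∘ e) (e.symm z) := by
    refine MDifferentiableAt.comp (I' := 𝓡 n) _ ?_ (mdifferentiableAt_chart he hq)
    rwa [e.right_inv hz]
  have hmf : MDifferentiableAt (𝓡 n) (𝓡 n) f (e.symm z) := hFe.congr_of_eventuallyEq hfe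
  rw [coordForm_eq, hh, ← formAt_pullbackForm_comp hmf (mdifferentiableAt_chart_symm he hz)]
  exact formAt_pullbackForm_congr hf g

variable {e e' : OpenPartialHomeomorph M (Eucl n)}

/-- The change of charts, for tensor fields. -/
theorem coordForm_transition (he : e ∈ IsManifold.maximalAtlas (𝓡 n) ∞ M)
    (he' : e' ∈ IsManifold.maximalAtlas (𝓡 n) ∞ M) {z : Eucl n} (hz : z ∈ e.target)
    (hz' : e.symm z ∈ e'.source) (g : TensorField n M) :
    coordForm g e z = pullMetric (e' ∘ e.symm) (coordForm g e') z := by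
  have h1 : MDifferentiableAt (𝓡 n) (𝓡 n) (e' ∘ e.symm) z :=
    (mdifferentiableAt_chart he' hz').comp _ (mdifferentiableAt_chart_symm he hz)
  have h2 : MDifferentiableAt (𝓡 n) (𝓡 n) e'.symm ((e' ∘ e.symm) z) :=
    mdifferentiableAt_chart_symm he' (e'.map_source hz')
  have h3 : ∀ᶠ z' in 𝓝 z, e.symm z' ∈ e'.source :=
    (e.continuousAt_symm hz).eventually (e'.open_source.mem_nhds hz')
  have h4 : (e.symm : Eucl n → M) =ᶠ[𝓝 z] e'.symm ∘ (e' ∘ e.symm) := by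
    filter_upwards [h3] with z' h4
    exact (e'.left_inv h4).symm
  have h5 : coordForm g e z = formAt (pullbackForm e.symm g) z := rfl
  rw [h5, formAt_pullbackForm_congr h4, formAt_pullbackForm_comp h2 h1, derivAt_eucl]
  rfl

theorem contDiffAt_transition' (he : e ∈ IsManifold.maximalAtlas (𝓡 n) ∞ M)
    (he' : e' ∈ IsManifold.maximalAtlas (𝓡 n) ∞ M) {z : Eucl n} (hz : z ∈ e.target)
    (hz' : e.symm z ∈ e'.source) : ContDiffAt ℝ ∞ (e' ∘ e.symm) z := by
  have := ConnectedSum.contDiffAt_transition he he' (e.map_target hz) hz'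
  rwa [e.right_inv hz] at this

theorem eventually_mem_transition {z : Eucl n} (hz : z ∈ e.target) (hz' : e.symm z ∈ e'.source) :
    ∀ᶠ z' in 𝓝 z, z' ∈ e.target ∧ e.symm z' ∈ e'.source :=
  (e.open_target.mem_nhds hz |> fun h => (show ∀ᶠ z' in 𝓝 z, z' ∈ e.target from h)).and
    ((e.continuousAt_symm hz).eventually (e'.open_source.mem_nhds hz'))

theorem localDiffeo_transition (he : e ∈ IsManifold.maximalAtlas (𝓡 n) ∞ M)
    (he' : e' ∈ IsManifold.maximalAtlas (𝓡 n) ∞ M) {z : Eucl n} (hz : z ∈ e.target)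
    (hz' : e.symm z ∈ e'.source) : LocalDiffeo (e' ∘ e.symm) z := by
  constructor
  · filter_upwards [eventually_mem_transition hz hz'] with z' h
    exact contDiffAt_transition' he he' h.1 h.2
  · have hw : (e' ∘ e.symm) z ∈ e'.target := e'.map_source hz'
    have hw' : e'.symm ((e' ∘ e.symm) z) ∈ e.source := by
      simp only [Function.comp]; rw [e'.left_inv hz']; exact e.map_target hz
    have hzz : (e ∘ e'.symm) ((e' ∘ e.symm) z) = z := by
      simp only [Function.comp]; rw [e'.left_inv hz', e.right_inv hz]
    have d1 := ((contDiffAt_transition' he he' hz hz').differentiableAt (by simp)).hasFDerivAt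
    have d2 := ((contDiffAt_transition' he' he hw hw').differentiableAt (by simp)).hasFDerivAt
    have k1 : (e ∘ e'.symm) ∘ (e' ∘ e.symm) =ᶠ[𝓝 z] id := by
      filter_upwards [eventually_mem_transition hz hz'] with z' h
      simp only [Function.comp, id]; rw [e'.left_inv h.2, e.right_inv h.1]
    have k2 : (e' ∘ e.symm) ∘ (e ∘ e'.symm) =ᶠ[𝓝 ((e' ∘ e.symm) z)] id := by
      filter_upwards [eventually_mem_transition hw hw'] with z' h
      simp only [Function.comp, id]; rw [e.left_inv h.2, e'.right_inv h.1]
    have c1 := (d2.comp z d1).unique ((hasFDerivAt_id z).congr_of_eventuallyEq k1)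
    have d1' : HasFDerivAt (e' ∘ e.symm) (fderiv ℝ (e' ∘ e.symm) z)
        ((e ∘ e'.symm) ((e' ∘ e.symm) z)) := by rw [hzz]; exact d1
    have c2 := (d1'.comp _ d2).unique ((hasFDerivAt_id _).congr_of_eventuallyEq k2)
    exact ContinuousLinearMap.IsInvertible.of_inverse c2 c1

theorem contDiffAt_pullMetric_of_contDiffAt {φ : Eucl n → Eucl n} {H : Eucl n → BilinForm n}
    {z : Eucl n} (hφ : ContDiffAt ℝ ∞ φ z) (hH : ContDiffAt ℝ ∞ H (φ z)) :
    ContDiffAt ℝ ∞ (pullMetric φ H) z := by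
  rw [pullMetric_eq]
  have h1 : ContDiffAt ℝ ∞ (fderiv ℝ φ) z := hφ.fderiv_right (by simp)
  exact ((ContinuousLinearMap.contDiff _).contDiffAt.comp z h1).clm_comp
    ((ContDiffAt.comp z hH hφ).clm_comp h1)

open Bundle in
/-- The coordinate expression by which Mathlib defines the smoothness of a section is `coordForm`. -/
theorem inCoordinates_eq_coordForm (h : TensorField n M) {c q : M}
    (hq : q ∈ (chartAt (Eucl n) c).source) :
    ContinuousLinearMap.inCoordinates (Eucl n) (TangentSpace (𝓡 n) : M → Type _)
      (Eucl n →L[ℝ] ℝ) (fun q : M => TangentSpace (𝓡 n) q →L[ℝ] ℝ) c q c q (h q) =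
      coordForm h (chartAt (Eucl n) c) (chartAt (Eucl n) c q) := by
  have hb : q ∈ (trivializationAt (Eucl n) (TangentSpace (𝓡 n) : M → Type _) c).baseSet := by
    simpa using hq
  have hs := TangentBundle.symmL_trivializationAt (I := 𝓡 n) hq
  simp only [modelWithCornersSelf_coe, range_id, mfderivWithin_univ, mfld_simps] at hs
  have hs' : ∀ v : Eucl n,
      (trivializationAt (Eucl n) (TangentSpace (𝓡 n) : M → Type _) c).symm q v =
      (mfderiv (𝓡 n) (𝓡 n) (chartAt (Eucl n) c).symm (chartAt (Eucl n) c q) :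
        Eucl n →L[ℝ] Eucl n) v := by
    intro v
    rw [← Bundle.Trivialization.symmL_apply (R := ℝ) _ hb]
    exact congrArg (fun L : Eucl n →L[ℝ] Eucl n => L v) hs
  refine ContinuousLinearMap.ext fun u => ContinuousLinearMap.ext fun v => ?_
  rw [inCoordinates_apply_eq₂ hb hb (mem_univ _), hs', hs']
  have hl : (chartAt (Eucl n) c).symm (chartAt (Eucl n) c q) = q := (chartAt (Eucl n) c).left_inv hq
  have h1 : formAt h ((chartAt (Eucl n) c).symm (chartAt (Eucl n) c q)) = formAt h q := by rw [hl]
  rw [coordForm_eq, h1]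
  simp
  rfl

open Bundle in
/-- Smoothness of a section of the bundle of bilinear forms, in coordinates. -/
theorem contMDiffAt_section_iff (h : TensorField n M) (c : M) :
    ContMDiffAt (𝓡 n) ((𝓡 n).prod 𝓘(ℝ, Eucl n →L[ℝ] Eucl n →L[ℝ] ℝ)) ∞
      (fun b => TotalSpace.mk' (Eucl n →L[ℝ] Eucl n →L[ℝ] ℝ)
        (E := fun b : M => TangentSpace (𝓡 n) b →L[ℝ] TangentSpace (𝓡 n) b →L[ℝ] ℝ) b (h b)) c ↔
      ContDiffAt ℝ ∞ (coordForm h (chartAt (Eucl n) c)) (chartAt (Eucl n) c c) := by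
  have hc := mem_chart_source (Eucl n) c
  have he := IsManifold.chart_mem_maximalAtlas (I := 𝓡 n) (n := ∞) c
  rw [contMDiffAt_hom_bundle]
  have h1 : (fun q => ContinuousLinearMap.inCoordinates (Eucl n) (TangentSpace (𝓡 n) : M → Type _)
      (Eucl n →L[ℝ] ℝ) (fun q : M => TangentSpace (𝓡 n) q →L[ℝ] ℝ) c q c q (h q)) =ᶠ[𝓝 c]
      coordForm h (chartAt (Eucl n) c) ∘ chartAt (Eucl n) c := by
    filter_upwards [(chartAt (Eucl n) c).open_source.mem_nhds hc] with q hq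
    exact inCoordinates_eq_coordForm h hq
  constructor
  · rintro ⟨-, h2⟩
    have h3 : ContMDiffAt (𝓡 n) 𝓘(ℝ, Eucl n →L[ℝ] Eucl n →L[ℝ] ℝ) ∞
      (coordForm h (chartAt (Eucl n) c) ∘ chartAt (Eucl n) c) c := h2.congr_of_eventuallyEq h1.symm
    rw [← contMDiffAt_iff_contDiffAt]
    have h4 : ContMDiffAt (𝓡 n) (𝓡 n) ∞ (chartAt (Eucl n) c).symm (chartAt (Eucl n) c c) :=
      contMDiffAt_symm_of_mem_maximalAtlas he (mem_chart_target _ _)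
    have h5 := ContMDiffAt.comp (I' := 𝓡 n) (chartAt (Eucl n) c c)
      (by rwa [(chartAt (Eucl n) c).left_inv hc]) h4
    refine h5.congr_of_eventuallyEq ?_
    filter_upwards [(chartAt (Eucl n) c).open_target.mem_nhds (mem_chart_target _ c)] with z hz
    simp only [Function.comp]
    rw [(chartAt (Eucl n) c).right_inv hz]
  · intro h2
    refine ⟨contMDiffAt_id, ?_⟩
    refine ContMDiffAt.congr_of_eventuallyEq ?_ h1
    exact h2.contMDiffAt.comp c (contMDiffAt_of_mem_maximalAtlas he hc)

theorem injective_derivAt_symm (he : e ∈ IsManifold.maximalAtlas (𝓡 n) ∞ M) {z : Eucl n}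
    (hz : z ∈ e.target) : Function.Injective (derivAt (n := n) e.symm z) := by
  have h1 := mdifferentiableAt_chart_symm he hz
  have h2 := mdifferentiableAt_chart he (e.map_target hz)
  have h3 : (e ∘ e.symm) =ᶠ[𝓝 z] id := by
    filter_upwards [e.open_target.mem_nhds hz] with w hw
    exact e.right_inv hw
  have h4 := derivAt_comp (n := n) (N := M) (M := Eucl n) (P := Eucl n) (f := e) (f' := e.symm)
    (c := z) h2 h1
  rw [derivAt_congr h3, derivAt_eucl, fderiv_id] at h4
  intro u v huv
  have := congrArg (fun L : Eucl n →L[ℝ] Eucl n => L u - L v) h4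
  simp only [ContinuousLinearMap.comp_apply, huv, sub_self] at this
  exact sub_eq_zero.1 this

theorem contDiffAt_coordForm (g : SmoothMetric n M) (he : e ∈ IsManifold.maximalAtlas (𝓡 n) ∞ M)
    {z : Eucl n} (hz : z ∈ e.target) : ContDiffAt ℝ ∞ (coordForm g.inner e) z := by
  set q := e.symm z with hq
  have h1 : ContDiffAt ℝ ∞ (coordForm g.inner (chartAt (Eucl n) q)) (chartAt (Eucl n) q q) :=
    (contMDiffAt_section_iff g.inner q).1 (g.contMDiff q)
  have h0 := IsManifold.chart_mem_maximalAtlas (I := 𝓡 n) (n := ∞) q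
  have h2 := contDiffAt_transition' he h0 hz (mem_chart_source _ q)
  refine (contDiffAt_pullMetric_of_contDiffAt h2 h1).congr_of_eventuallyEq ?_
  filter_upwards [eventually_mem_transition hz (mem_chart_source (Eucl n) q)] with w hw
  exact coordForm_transition he h0 hw.1 hw.2 _

/-- The coordinate expression of a smooth metric is a smooth field of inner products. -/
theorem metricNear_coordForm (g : SmoothMetric n M) (he : e ∈ IsManifold.maximalAtlas (𝓡 n) ∞ M)
    {z : Eucl n} (hz : z ∈ e.target) : MetricNear (coordForm g.inner e) z := by
  constructor
  · filter_upwards [e.open_target.mem_nhds hz] with w hw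
    exact contDiffAt_coordForm g he hw
  · filter_upwards [e.open_target.mem_nhds hz] with w hw
    constructor
    · intro u v
      exact g.symm (e.symm w) _ _
    · intro v hv
      refine g.pos (e.symm w) _ fun h0 => hv ?_
      have h1 : derivAt e.symm w v = derivAt e.symm w 0 := by
        rw [map_zero]; exact h0
      exact injective_derivAt_symm he hw h1

/-- The curvature functions may be computed in any chart. -/
theorem sigmaCoord_coordForm (g : SmoothMetric n M) (he : e ∈ IsManifold.maximalAtlas (𝓡 n) ∞ M)
    {q : M} (hq : q ∈ e.source) (j : ℕ) :
    sigmaCoord (coordForm g.inner e) j (e q) = sigmaCurvature g j q := by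
  have h0 := IsManifold.chart_mem_maximalAtlas (I := 𝓡 n) (n := ∞) q
  have hz := e.map_source hq
  have hz' : e.symm (e q) ∈ (chartAt (Eucl n) q).source := by
    rw [e.left_inv hq]; exact mem_chart_source _ _
  have h1 : coordForm g.inner e =ᶠ[𝓝 (e q)]
      pullMetric (chartAt (Eucl n) q ∘ e.symm) (coordForm g.inner (chartAt (Eucl n) q)) := by
    filter_upwards [eventually_mem_transition hz hz'] with w hw
    exact coordForm_transition he h0 hw.1 hw.2 _
  have h2 : (chartAt (Eucl n) q ∘ e.symm) (e q) = chartAt (Eucl n) q q := by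
    simp only [Function.comp]; rw [e.left_inv hq]
  rw [sigmaCoord_congr h1, (localDiffeo_transition he h0 hz hz').sigmaCoord_pullMetric, h2]
  · rfl
  · rw [h2]
    exact metricNear_coordForm g h0 (mem_chart_target _ q)

theorem IsInner.exists_elliptic {B : BilinForm n} (hB : IsInner B) :
    ∃ c, 0 < c ∧ ∀ v, c * ‖v‖ ^ 2 ≤ B v v := by
  have hcont : Continuous fun v : Eucl n => B v v := by fun_prop
  obtain ⟨v₀, hv₀, hmin⟩ := (isCompact_sphere (0 : Eucl n) 1).exists_isMinOn
    ⟨EuclideanSpace.single (0 : Fin n) (1 : ℝ), by simp⟩ hcont.continuousOn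
  have h0 : v₀ ≠ 0 := by
    rintro rfl
    simp at hv₀
  refine ⟨B v₀ v₀, hB.pos _ h0, fun v => ?_⟩
  rcases eq_or_ne v 0 with rfl | hv
  · simp
  have hn : 0 < ‖v‖ := norm_pos_iff.2 hv
  have h1 : B v₀ v₀ ≤ B (‖v‖⁻¹ • v) (‖v‖⁻¹ • v) :=
    hmin (show ‖v‖⁻¹ • v ∈ Metric.sphere (0 : Eucl n) 1 by simp [norm_smul, hn.ne'])
  simp only [map_smul, _root_.smul_apply, smul_eq_mul] at h1
  calc B v₀ v₀ * ‖v‖ ^ 2 ≤ ‖v‖⁻¹ * (‖v‖⁻¹ * B v v) * ‖v‖ ^ 2 := by gcongr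
    _ = B v v := by field_simp

theorem IsInner.isVonNBounded {B : BilinForm n} (hB : IsInner B) :
    Bornology.IsVonNBounded ℝ {v : Eucl n | B v v < 1} := by
  obtain ⟨c, hc, h⟩ := hB.exists_elliptic
  rw [NormedSpace.isVonNBounded_iff]
  refine (Metric.isBounded_closedBall (x := (0 : Eucl n)) (r := 1 + c⁻¹)).subset fun v hv => ?_
  have hv : B v v < 1 := hv
  have h1 : ‖v‖ ^ 2 ≤ c⁻¹ := by
    rw [← one_div, le_div_iff₀ hc]
    nlinarith [h v]
  have h2 : 0 < c⁻¹ := inv_pos.2 hc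
  rw [mem_closedBall_zero_iff]
  nlinarith [norm_nonneg v]

/-- A field of bilinear forms which is smooth and positive definite in coordinates is a smooth
metric. -/
theorem exists_smoothMetric (h : TensorField n M)
    (hh : ∀ c, MetricNear (coordForm h (chartAt (Eucl n) c)) (chartAt (Eucl n) c c)) :
    ∃ g : SmoothMetric n M, ∀ c, g.inner c = h c := by
  -- The derivative of the inverse of a chart is bijective, so `h c` inherits positivity from its
  -- coordinate expression.
  have key : ∀ c, IsInner (formAt h c) := by
    intro c
    have he := IsManifold.chart_mem_maximalAtlas (I := 𝓡 n) (n := ∞) c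
    have hz := mem_chart_target (Eucl n) c
    have h1 := (hh c).inner.self_of_nhds
    rw [coordForm_eq, (chartAt (Eucl n) c).left_inv (mem_chart_source _ c)] at h1
    have hinj := injective_derivAt_symm he hz
    have hsurj := LinearMap.surjective_of_injective
      (f := (derivAt (chartAt (Eucl n) c).symm (chartAt (Eucl n) c c)).toLinearMap) hinj
    constructor
    · intro u v
      obtain ⟨u, rfl⟩ := hsurj u
      obtain ⟨v, rfl⟩ := hsurj v
      exact h1.symm u v
    · intro v hv
      obtain ⟨v, rfl⟩ := hsurj v
      exact h1.pos v fun h0 => hv (by rw [h0, map_zero])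
  exact ⟨{  inner := h
            symm := fun c => (key c).symm
            pos := fun c => (key c).pos
            isVonNBounded := fun c => (key c).isVonNBounded
            contMDiff := fun c => (contMDiffAt_section_iff h c).2 (hh c).smooth }, fun c => rfl⟩

end Tensor

/-! ### The symmetry of the neck -/

section Mirror

set_option maxSynthPendingDepth 3

open ConnectedSum

variable {n k : ℕ} {η χ₀ : ℝ → ℝ} {ε : ℝ}

/-- The cut-off function `t ↦ 1 - η (-t)`, which plays the role of `η` after exchanging the two
sides of the neck. -/
noncomputable def mirrorCut (η : ℝ → ℝ) (t : ℝ) : ℝ := 1 - η (-t)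

theorem IsCutoff.mirrorCut (hη : IsCutoff η 1) : IsCutoff (mirrorCut η) 1 := by
  obtain ⟨h1, h2, h3, h4, h5⟩ := hη
  refine ⟨contDiff_const.sub (h1.comp contDiff_neg), fun s t hst => ?_, fun t => ?_, fun t ht => ?_,
    fun t ht => ?_⟩
  · have := h2 (neg_le_neg hst)
    simp only [_root_.mirrorCut]
    linarith
  · have := h3 (-t)
    simp only [_root_.mirrorCut, mem_Icc] at this ⊢
    constructor <;> linarith
  · simp only [_root_.mirrorCut, h5 (-t) (by linarith), sub_zero]
  · simp only [_root_.mirrorCut, h4 (-t) (by linarith), sub_self]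

theorem neckTime_invert (hε : 0 < ε) {z : Eucl n} (hz : z ≠ 0) :
    neckTime ε (invert ε z) = -neckTime ε z := by
  have h1 : ‖z‖ ≠ 0 := norm_ne_zero_iff.2 hz
  rw [neckTime, neckTime, norm_invert, Real.log_div (by positivity) h1, Real.log_pow]
  push_cast
  ring

theorem invert_ne_zero (hε : 0 < ε) {z : Eucl n} (hz : z ≠ 0) : invert ε z ≠ 0 := by
  have h1 : 0 < ‖z‖ := norm_pos_iff.2 hz
  rw [← norm_pos_iff, norm_invert]
  positivity

theorem u₁_neg (t : ℝ) : u₁ n k ε (-t) = u₂ n k ε t := by simp [u₁, u₂]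

theorem u₂_neg (t : ℝ) : u₂ n k ε (-t) = u₁ n k ε t := by simp [u₁, u₂]

theorem uApprox_neg (t : ℝ) : uApprox n k χ₀ ε (-t) = uApprox n k χ₀ ε t := by
  rw [uApprox, uApprox, u₁_neg, u₂_neg, neg_neg, add_comm]

theorem cylForm_invert (hε : 0 < ε) {z : Eucl n} (hz : z ≠ 0) :
    pullMetric (invert ε) cylForm z = cylForm z := by
  have h1 : 0 < ‖z‖ := norm_pos_iff.2 hz
  ext u v
  rw [pullMetric_apply, fderiv_invert hz]
  simp only [cylForm, _root_.smul_apply, euclForm_apply, norm_invert, smul_eq_mul,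
    ContinuousLinearEquiv.coe_coe, LinearIsometryEquiv.coe_toContinuousLinearEquiv,
    real_inner_smul_left, real_inner_smul_right, LinearIsometryEquiv.inner_map_map]
  field_simp

theorem pullMetric_invert_invert (hε : 0 < ε) (G : Eucl n → BilinForm n) {z : Eucl n} (hz : z ≠ 0) :
    pullMetric (invert ε) (pullMetric (invert ε) G) z = G z := by
  have h1 : (invert ε ∘ invert ε : Eucl n → Eucl n) = id := funext fun w => invert_invert hε.ne' w
  have d1 := (contDiffAt_invert ε hz).differentiableAt (by simp)
  have d2 := (contDiffAt_invert ε (invert_ne_zero hε hz)).differentiableAt (by simp)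
  have h2 := fderiv_comp z d2 d1
  rw [h1, fderiv_id] at h2
  ext u v
  have h3 : ∀ u, fderiv ℝ (invert ε) (invert ε z) (fderiv ℝ (invert ε) z u) = u := fun u =>
    (congrArg (fun L : Eucl n →L[ℝ] Eucl n => L u) h2).symm
  rw [pullMetric_apply, pullMetric_apply, h3, h3, invert_invert hε.ne']

theorem pullMetric_remainder₁ (hε : 0 < ε) (G : Eucl n → BilinForm n) {z : Eucl n} (hz : z ≠ 0) :
    pullMetric (invert ε) (remainder₁ k ε G) z = remainder₂ k ε G z := by
  have h1 : pullMetric (invert ε) (remainder₁ k ε G) z =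
      (u₁ n k ε (neckTime ε (invert ε z)) ^ confExp n k)⁻¹ • pullMetric (invert ε) G z -
        pullMetric (invert ε) cylForm z := rfl
  rw [h1, cylForm_invert hε hz, neckTime_invert hε hz, u₁_neg]
  rfl

theorem pullMetric_remainder₂ (hε : 0 < ε) (G : Eucl n → BilinForm n) {z : Eucl n} (hz : z ≠ 0) :
    pullMetric (invert ε) (remainder₂ k ε G) z = remainder₁ k ε G z := by
  have h1 : pullMetric (invert ε) (remainder₂ k ε G) z =
      (u₂ n k ε (neckTime ε (invert ε z)) ^ confExp n k)⁻¹ •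
        pullMetric (invert ε) (pullMetric (invert ε) G) z - pullMetric (invert ε) cylForm z := rfl
  rw [h1, cylForm_invert hε hz, neckTime_invert hε hz, u₂_neg, pullMetric_invert_invert hε G hz]
  rfl

/-- The inversion exchanges the two sides of the neck. -/
theorem neckForm_mirror (hε : 0 < ε) (G₁ G₂ : Eucl n → BilinForm n) {z : Eucl n} (hz : z ≠ 0) :
    pullMetric (invert ε) (neckForm k (mirrorCut η) χ₀ ε G₂ G₁) z = neckForm k η χ₀ ε G₁ G₂ z := by
  have h1 : pullMetric (invert ε) (neckForm k (mirrorCut η) χ₀ ε G₂ G₁) z =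
      uApprox n k χ₀ ε (neckTime ε (invert ε z)) ^ confExp n k •
        (pullMetric (invert ε) cylForm z +
          mirrorCut η (neckTime ε (invert ε z)) • pullMetric (invert ε) (remainder₁ k ε G₂) z +
          (1 - mirrorCut η (neckTime ε (invert ε z))) •
            pullMetric (invert ε) (remainder₂ k ε G₁) z) := rfl
  rw [h1, cylForm_invert hε hz, neckTime_invert hε hz, uApprox_neg, pullMetric_remainder₁ hε _ hz,
    pullMetric_remainder₂ hε _ hz, neckForm, mirrorCut, neg_neg]
  congr 1
  rw [sub_sub_cancel]
  abel

theorem mirrorCut_mirrorCut (η : ℝ → ℝ) : mirrorCut (mirrorCut η) = η := by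
  funext t
  simp [mirrorCut]

/-- Outside of the unit ball, the formula defining the approximate solution gives back the
metric. -/
theorem neckForm_of_one_le (hη : IsCutoff η 1) (hχ : IsCutoff χ₀ 0) (hε : 0 < ε)
    (hε1 : ε ≤ Real.exp (-1)) (G₁ G₂ : Eucl n → BilinForm n) {z : Eucl n} (hz : 1 ≤ ‖z‖) :
    neckForm k η χ₀ ε G₁ G₂ z = G₁ z := by
  have hl : Real.log ε ≤ -1 := by
    rw [← Real.log_exp (-1)]
    exact Real.log_le_log hε hε1
  have hl' : 0 ≤ Real.log ‖z‖ := Real.log_nonneg hz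
  have ht : neckTime ε z ≤ -1 := by rw [neckTime]; linarith
  have h1 : cutChi χ₀ ε (neckTime ε z) = 1 := hχ.2.2.2.1 _ (by linarith)
  have h2 : cutChi χ₀ ε (-neckTime ε z) = 0 := hχ.2.2.2.2 _ (by rw [neckTime]; linarith)
  have h3 : 0 < u₁ n k ε (neckTime ε z) := by
    rw [u₁]
    exact mul_pos (Real.rpow_pos_of_pos hε _) (Real.exp_pos _)
  have h4 : u₁ n k ε (neckTime ε z) ^ confExp n k ≠ 0 := (Real.rpow_pos_of_pos h3 _).ne'
  rw [neckForm, uApprox, h1, h2, hη.2.2.2.1 _ ht, remainder₁, one_mul, zero_mul, add_zero, one_smul,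
    sub_self, zero_smul, add_zero, add_sub_cancel, smul_smul, mul_inv_cancel₀ h4, one_smul]

/-- The approximate solution is a smooth admissible metric on the whole neck, for small `ε`. -/
theorem exists_neckForm_pos_of_sq_le (hk : 1 ≤ k) (hkn : 2 * k < n) (hη : IsCutoff η 1)
    (hχ : IsCutoff χ₀ 0) {Λ δ : ℝ} (hΛ : 0 < Λ) (hδ : 0 < δ) :
    ∀ᶠ ε : ℝ in 𝓝[>] 0, ∀ G₁ G₂ : Eucl n → BilinForm n, UnitBallMetric (k - 1) Λ δ G₁ →
      UnitBallMetric (k - 1) Λ δ G₂ → ∀ z : Eucl n, ‖z‖ ≤ 1 → ε ^ 2 ≤ ‖z‖ →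
      MetricNear (neckForm k η χ₀ ε G₁ G₂) z ∧
        ∀ j, 1 ≤ j → j ≤ k - 1 → 0 < sigmaCoord (neckForm k η χ₀ ε G₁ G₂) j z := by
  filter_upwards [exists_neckForm_pos hk hkn hη hχ hΛ hδ,
    exists_neckForm_pos hk hkn hη.mirrorCut hχ hΛ hδ, self_mem_nhdsWithin] with ε k1 k2 hε
  have hε : 0 < ε := hε
  intro G₁ G₂ h1 h2 z hz hz'
  have hexp : Real.exp (-1) ≤ 1 := Real.exp_le_one_iff.2 (by norm_num)
  have hz0 : 0 < ‖z‖ := lt_of_lt_of_le (by positivity) hz'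
  have hzne : z ≠ 0 := norm_pos_iff.1 hz0
  rcases le_total ε ‖z‖ with h | h
  · exact k1 G₁ G₂ h1 h2 z hz ((mul_le_of_le_one_right hε.le hexp).trans h)
  · have hn : ‖invert ε z‖ ≤ 1 := by
      rw [norm_invert, div_le_one hz0]
      exact hz'
    have hn' : ε * Real.exp (-1) ≤ ‖invert ε z‖ := by
      refine (mul_le_of_le_one_right hε.le hexp).trans ?_
      rw [norm_invert, le_div_iff₀ hz0]
      nlinarith
    obtain ⟨k3, k4⟩ := k2 G₂ G₁ h2 h1 _ hn hn'
    have hd := localDiffeo_invert hε.ne' hzne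
    have heq : pullMetric (invert ε) (neckForm k (mirrorCut η) χ₀ ε G₂ G₁) =ᶠ[𝓝 z]
        neckForm k η χ₀ ε G₁ G₂ := by
      filter_upwards [isOpen_ne.mem_nhds hzne] with w hw
      exact neckForm_mirror hε G₁ G₂ hw
    refine ⟨(hd.metricNear k3).congr heq, fun j hj hj' => ?_⟩
    rw [← sigmaCoord_congr heq, hd.sigmaCoord_pullMetric k3]
    exact k4 j hj hj'

end Mirror

/-! ### Metrics in gluing charts -/

section GluingChart

set_option maxSynthPendingDepth 3

variable {n : ℕ} {G : Eucl n → BilinForm n}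

theorem IsNormalForm.apply_zero (h : IsNormalForm G) : G 0 = euclForm n := h.1

/-- In normal coordinates the first derivatives of the metric vanish at the centre: the Christoffel
symbols vanish there by polarization. -/
theorem IsNormalForm.fderiv_zero (h : IsNormalForm G) (hG : MetricNear G 0) :
    fderiv ℝ G 0 = 0 := by
  have h1 : ∀ v : Eucl n, ‖v‖ = 1 → ∀ w, 2 * fderiv ℝ G 0 v v w = fderiv ℝ G 0 w v v := by
    intro v hv w
    have h2 := h.2 v hv 0 (by simp)
    rw [zero_smul] at h2
    have h3 := hG.apply_christoffel v v w
    rw [h2, map_zero, _root_.zero_apply] at h3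
    linarith
  have h2 : ∀ v w : Eucl n, 2 * fderiv ℝ G 0 v v w = fderiv ℝ G 0 w v v := by
    intro v w
    rcases eq_or_ne v 0 with rfl | hv
    · simp
    · have hn : ‖v‖ ≠ 0 := norm_ne_zero_iff.2 hv
      have h3 := h1 (‖v‖⁻¹ • v) (by simp [norm_smul, hn]) w
      simp only [map_smul, _root_.smul_apply, smul_eq_mul] at h3
      field_simp at h3
      exact h3
  -- Polarization; the three cyclic versions of this identity force the derivative to vanish.
  have h3 : ∀ u v w : Eucl n, fderiv ℝ G 0 u v w + fderiv ℝ G 0 v u w = fderiv ℝ G 0 w u v := by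
    intro u v w
    have h4 := h2 (u + v) w
    simp only [map_add, _root_.add_apply] at h4
    have h5 := hG.fderiv_symm w u v
    linarith [h2 u w, h2 v w]
  ext u v w
  have k1 := h3 u v w
  have k2 := h3 v w u
  have k3 := h3 u w v
  have s1 := hG.fderiv_symm u v w
  have s2 := hG.fderiv_symm v u w
  have s3 := hG.fderiv_symm w u v
  simp only [_root_.zero_apply]
  linarith

theorem IsConformallyFlatForm.apply_zero (h : IsConformallyFlatForm G) : G 0 = euclForm n := by
  obtain ⟨c, h1, h2⟩ := h
  have h3 : c 0 = 0 := by
    obtain ⟨C, hC⟩ := h2.bound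
    have := hC.self_of_nhds
    simpa using this
  rw [h1 0 (by simp), h3, add_zero, one_smul]

/-- A function which is `O(|z|²)` has vanishing derivative at the origin. -/
theorem IsConformallyFlatForm.fderiv_zero (h : IsConformallyFlatForm G) : fderiv ℝ G 0 = 0 := by
  obtain ⟨c, h1, h2⟩ := h
  have h3 : HasFDerivAt c (0 : Eucl n →L[ℝ] ℝ) 0 := by
    refine Asymptotics.IsBigO.hasFDerivAt (n := 2) ?_ (by norm_num)
    simpa using h2
  have h4 : HasFDerivAt (fun z => (1 + c z) • euclForm n) (0 : Eucl n →L[ℝ] BilinForm n) 0 := by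
    have := (h3.const_add 1).smul_const (euclForm n)
    convert! this using 1
    ext
    simp
  refine (h4.congr_of_eventuallyEq ?_).fderiv
  filter_upwards [Metric.closedBall_mem_nhds (0 : Eucl n) one_pos] with z hz
  exact h1 z hz

theorem norm_iteratedFDeriv_two (z : Eucl n) :
    ‖iteratedFDeriv ℝ 2 G z‖ = ‖fderiv ℝ (fderiv ℝ G) z‖ := by
  rw [← norm_iteratedFDeriv_fderiv, norm_iteratedFDeriv_one]

variable {M : Type*} [TopologicalSpace M] [ChartedSpace (Eucl n) M] [IsManifold (𝓡 n) ∞ M]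
  [NeZero n] {g : SmoothMetric n M} {x : UnitBallChart n M}

theorem UnitBallChart.metricNear (g : SmoothMetric n M) (x : UnitBallChart n M) {z : Eucl n}
    (hz : ‖z‖ ≤ 1) : MetricNear (coordForm g.inner x.chart) z :=
  metricNear_coordForm g x.mem_maximalAtlas (x.mem_target hz)

/-- All that is used of a gluing chart, and of the bounds on the geometry. -/
theorem IsGluingChart.unitBallMetric (hx : IsGluingChart g x) {m : ℕ} {Λ δ : ℝ}
    (h : GeometryBound m g x Λ δ) : UnitBallMetric m Λ δ (coordForm g.inner x.chart) where
  near z hz := x.metricNear g hz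
  jet z hz := by
    have hz' : z ∈ Metric.closedBall (0 : Eucl n) 1 := by simpa using hz
    refine ⟨(x.metricNear g hz).self.symm, h.elliptic z hz', ?_, ?_, ?_⟩
    · have := h.norm_le 0 (by norm_num) z hz'
      rwa [norm_iteratedFDeriv_zero] at this
    · have := h.norm_le 1 (by norm_num) z hz'
      rwa [norm_iteratedFDeriv_one] at this
    · have := h.norm_le 2 le_rfl z hz'
      rwa [norm_iteratedFDeriv_two] at this
  zero := hx.elim IsNormalForm.apply_zero IsConformallyFlatForm.apply_zero
  fderiv_zero := hx.elim (fun h => h.fderiv_zero (x.metricNear g (by simp)))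
    IsConformallyFlatForm.fderiv_zero
  sigma z hz j hj hjm := by
    have ht := x.mem_target hz
    have h1 := h.sigma_ge j hj hjm (x.chart.symm z)
      ⟨x.chart.map_target ht, by rw [x.chart.right_inv ht]; exact hz⟩
    rwa [← sigmaCoord_coordForm g x.mem_maximalAtlas (x.chart.map_target ht),
      x.chart.right_inv ht] at h1

theorem exists_pos_le_of_isCompact {X : Type*} [TopologicalSpace X] {K : Set X} (hK : IsCompact K)
    {f : X → ℝ} (hf : ContinuousOn f K) (hpos : ∀ p ∈ K, 0 < f p) :
    ∃ c, 0 < c ∧ ∀ p ∈ K, c ≤ f p := by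
  rcases K.eq_empty_or_nonempty with rfl | hne
  · exact ⟨1, one_pos, by simp⟩
  · obtain ⟨p, hp, hmin⟩ := hK.exists_isMinOn hne hf
    exact ⟨f p, hpos p hp, fun q hq => hmin hq⟩

/-- By compactness of the closed unit ball, every admissible metric has bounded geometry there. -/
theorem exists_geometryBound {m : ℕ} (hm : m ≤ n) (hg : IsAdmissible m g)
    (x : UnitBallChart n M) :
    ∃ Λ₀ δ₀ : ℝ, 0 < δ₀ ∧ ∀ Λ δ, Λ₀ ≤ Λ → δ ≤ δ₀ → GeometryBound m g x Λ δ := by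
  set G := coordForm g.inner x.chart with hGdef
  have hnear : ∀ z ∈ Metric.closedBall (0 : Eucl n) 1, MetricNear G z := fun z hz =>
    x.metricNear g (by simpa using hz)
  have hK := isCompact_closedBall (0 : Eucl n) 1
  obtain ⟨C, hC⟩ := hK.exists_bound_of_continuousOn (f := metricJet G)
    fun z hz => (hnear z hz).continuousAt_metricJet.continuousWithinAt
  -- Ellipticity, by compactness of the unit sphere bundle over the ball.
  obtain ⟨c, hc, hc'⟩ := exists_pos_le_of_isCompact
    (hK.prod (isCompact_sphere (0 : Eucl n) 1)) (f := fun p => G p.1 p.2 p.2)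
    (fun p hp => by
      have h1 : ContinuousAt (fun p : Eucl n × Eucl n => G p.1) p :=
        ContinuousAt.comp (g := G) (hnear p.1 hp.1).smooth.continuousAt continuousAt_fst
      exact ((h1.clm_apply continuousAt_snd).clm_apply continuousAt_snd).continuousWithinAt)
    (fun p hp => (hnear p.1 hp.1).self.pos p.2 (by
      intro h0
      have := hp.2
      rw [h0] at this
      simp at this))
  have hσ : ∀ j, ∃ d, 0 < d ∧ (1 ≤ j → j ≤ m → ∀ z ∈ Metric.closedBall (0 : Eucl n) 1,
      d ≤ sigmaCoord G j z) := by
    intro j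
    by_cases hj : 1 ≤ j ∧ j ≤ m
    · obtain ⟨d, hd, hd'⟩ := exists_pos_le_of_isCompact hK (f := sigmaCoord G j)
        (fun z hz => ((hnear z hz).continuousAt_sigmaCoord (hj.2.trans hm)).continuousWithinAt)
        (fun z hz => by
          have ht := x.mem_target (z := z) (by simpa using hz)
          have := hg j hj.1 hj.2 (x.chart.symm z)
          rwa [← sigmaCoord_coordForm g x.mem_maximalAtlas (x.chart.map_target ht),
            x.chart.right_inv ht] at this)
      exact ⟨d, hd, fun _ _ => hd'⟩
    · exact ⟨1, one_pos, fun h1 h2 => absurd ⟨h1, h2⟩ hj⟩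
  choose d hd hd' using hσ
  obtain ⟨δ₀, hδ₀, hδ₀'⟩ := ((Finset.eventually_all (Finset.range (m + 1))).2 fun j _ =>
    (eventually_le_nhds (hd j)).filter_mono nhdsWithin_le_nhds).and
      (self_mem_nhdsWithin : ∀ᶠ t : ℝ in 𝓝[>] 0, t ∈ Ioi 0) |>.exists
  refine ⟨max C c⁻¹, δ₀, hδ₀', fun Λ δ hΛ hδ => ⟨?_, ?_, ?_⟩⟩
  · intro i hi z hz
    have hJ := (hC z hz).trans ((le_max_left _ _).trans hΛ)
    have h1 : ‖G z‖ ≤ Λ := (norm_fst_le (metricJet G z)).trans hJ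
    have h2 : ‖fderiv ℝ G z‖ ≤ Λ :=
      (norm_fst_le (metricJet G z).2).trans ((norm_snd_le (metricJet G z)).trans hJ)
    have h3 : ‖fderiv ℝ (fderiv ℝ G) z‖ ≤ Λ :=
      (norm_snd_le (metricJet G z).2).trans ((norm_snd_le (metricJet G z)).trans hJ)
    interval_cases i
    · rwa [norm_iteratedFDeriv_zero]
    · rwa [norm_iteratedFDeriv_one]
    · rwa [norm_iteratedFDeriv_two]
  · intro z hz v
    rcases eq_or_ne v 0 with rfl | hv
    · simp
    have hn : 0 < ‖v‖ := norm_pos_iff.2 hv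
    have h1 : c ≤ G z (‖v‖⁻¹ • v) (‖v‖⁻¹ • v) :=
      hc' (z, ‖v‖⁻¹ • v) ⟨hz, by simp [norm_smul, hn.ne']⟩
    simp only [map_smul, _root_.smul_apply, smul_eq_mul] at h1
    have h2 : c * ‖v‖ ^ 2 ≤ G z v v := by
      calc c * ‖v‖ ^ 2 ≤ ‖v‖⁻¹ * (‖v‖⁻¹ * G z v v) * ‖v‖ ^ 2 := by gcongr
        _ = G z v v := by field_simp
    have h3 : 0 ≤ G z v v := (hnear z hz).self.nonneg v
    calc ‖v‖ ^ 2 = c⁻¹ * (c * ‖v‖ ^ 2) := by field_simp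
      _ ≤ c⁻¹ * G z v v := by gcongr
      _ ≤ Λ * G z v v := by
        gcongr
        exact (le_max_right _ _).trans hΛ
  · intro j hj hjm q hq
    rw [← sigmaCoord_coordForm g x.mem_maximalAtlas hq.1]
    refine hδ.trans ((hδ₀ j (Finset.mem_range.2 (by omega))).trans (hd' j hj hjm _ ?_))
    simpa using hq.2

end GluingChart

/-! ### The approximate solution in the charts of the connected sum -/

section Charts

set_option maxSynthPendingDepth 3

open ConnectedSum

variable {n : ℕ} [NeZero n]

theorem formAt_pullbackForm_eucl (ψ : Eucl n → Eucl n) (H : Eucl n → BilinForm n) (z : Eucl n) :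
    formAt (pullbackForm (M := Eucl n) ψ H) z = pullMetric ψ H z := by
  change (H (ψ z)).bilinearComp (derivAt ψ z) (derivAt ψ z) = _
  rw [derivAt_eucl, pullMetric]

theorem pullMetric_id (H : Eucl n → BilinForm n) (z : Eucl n) : pullMetric id H z = H z := by
  ext u v
  rw [pullMetric_apply, fderiv_id]
  rfl

theorem pullMetric_comp {φ ψ : Eucl n → Eucl n} {z : Eucl n} (hφ : DifferentiableAt ℝ φ (ψ z))
    (hψ : DifferentiableAt ℝ ψ z) (H : Eucl n → BilinForm n) :
    pullMetric (φ ∘ ψ) H z = pullMetric ψ (pullMetric φ H) z := by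
  ext u v
  simp only [pullMetric_apply, fderiv_comp z hφ hψ]
  rfl

theorem pullMetric_congr_apply {ψ : Eucl n → Eucl n} {H H' : Eucl n → BilinForm n} {z : Eucl n}
    (h : H (ψ z) = H' (ψ z)) : pullMetric ψ H z = pullMetric ψ H' z := by
  rw [pullMetric, h, pullMetric]

section Side

variable {M : Type*} [TopologicalSpace M] [T2Space M] [ChartedSpace (Eucl n) M]
  [IsManifold (𝓡 n) ∞ M] {g : SmoothMetric n M} {x : UnitBallChart n M}

/-- A tensor `T` which is `g` outside of the unit ball, and on the unit ball is the pullback of a tensor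
continuing the coefficients of `g`, is a smooth metric along the unit sphere and outside. -/
theorem metricNear_and_sigmaCoord_pos {m : ℕ} (hg : IsAdmissible m g)
    {φ : OpenPartialHomeomorph M (Eucl n)} (hφ : φ ∈ IsManifold.maximalAtlas (𝓡 n) ∞ M) {q : M}
    (hq : q ∈ φ.source) (hqb : q ∉ x.ball 1) {H T : Eucl n → BilinForm n}
    (hH : ∀ z, ‖z‖ = 1 → MetricNear H z ∧ ∀ j, 1 ≤ j → j ≤ m → 0 < sigmaCoord H j z)
    (hHg : ∀ z, 1 ≤ ‖z‖ → H z = coordForm g.inner x.chart z)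
    (hT : ∀ᶠ z in 𝓝 (φ q), φ.symm z ∈ x.ball 1 → T z = pullMetric (x.chart ∘ φ.symm) H z)
    (hT' : ∀ᶠ z in 𝓝 (φ q), φ.symm z ∉ x.ball 1 → T z = coordForm g.inner φ z) :
    MetricNear T (φ q) ∧ ∀ j, 1 ≤ j → j ≤ m → 0 < sigmaCoord T j (φ q) := by
  have hz := φ.map_source hq
  have hqs : φ.symm (φ q) = q := φ.left_inv hq
  -- On the unit sphere both formulas are in force nearby, and the second one agrees with the first by
  -- `hHg`; farther away only the second one is.
  by_cases hqc : q ∈ x.closedBall 1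
  · have hn : ‖x.chart q‖ = 1 := le_antisymm hqc.2 (not_lt.1 fun h => hqb ⟨hqc.1, h⟩)
    have hz' : φ.symm (φ q) ∈ x.chart.source := by rw [hqs]; exact hqc.1
    have hd := localDiffeo_transition hφ x.mem_maximalAtlas hz hz'
    have hpt : (x.chart ∘ φ.symm) (φ q) = x.chart q := by simp only [Function.comp, hqs]
    have hH' := hH _ (hpt ▸ hn)
    have heq : pullMetric (x.chart ∘ φ.symm) H =ᶠ[𝓝 (φ q)] T := by
      filter_upwards [hT, hT', eventually_mem_transition hz hz'] with w h1 h2 h3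
      by_cases h4 : φ.symm w ∈ x.ball 1
      · exact (h1 h4).symm
      · rw [h2 h4, coordForm_transition hφ x.mem_maximalAtlas h3.1 h3.2]
        exact pullMetric_congr_apply (hHg _ (not_lt.1 fun h => h4 ⟨h3.2, h⟩))
    refine ⟨(hd.metricNear hH'.1).congr heq, fun j hj hjm => ?_⟩
    rw [← sigmaCoord_congr heq, hd.sigmaCoord_pullMetric hH'.1]
    exact hH'.2 j hj hjm
  · have heq : coordForm g.inner φ =ᶠ[𝓝 (φ q)] T := by
      have ho : (x.closedBall 1)ᶜ ∈ 𝓝 (φ.symm (φ q)) :=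
        (x.isClosed_closedBall le_rfl).isOpen_compl.mem_nhds (by rw [hqs]; exact hqc)
      filter_upwards [hT', (φ.continuousAt_symm hz).eventually ho] with w h2 h3
      exact (h2 fun h => h3 (x.ball_subset_closedBall _ h)).symm
    refine ⟨(metricNear_coordForm g hφ hz).congr heq, fun j hj hjm => ?_⟩
    rw [← sigmaCoord_congr heq, sigmaCoord_coordForm g hφ hq]
    exact hg j hj hjm q

theorem eventually_symm_notMem_closedBall (x : UnitBallChart n M) {r : ℝ} (hr : r ≤ 1)
    {φ : OpenPartialHomeomorph M (Eucl n)} {q : M} (hq : q ∈ φ.source) (hqc : q ∉ x.closedBall r) :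
    ∀ᶠ z in 𝓝 (φ q), z ∈ φ.target ∧ φ.symm z ∉ x.closedBall r := by
  have h1 : (x.closedBall r)ᶜ ∈ 𝓝 (φ.symm (φ q)) :=
    (x.isClosed_closedBall hr).isOpen_compl.mem_nhds (by rw [φ.left_inv hq]; exact hqc)
  filter_upwards [φ.open_target.mem_nhds (φ.map_source hq),
    (φ.continuousAt_symm (φ.map_source hq)).eventually h1] with z h2 h3
  exact ⟨h2, h3⟩

end Side

variable {M₁ M₂ : Type*}
  [TopologicalSpace M₁] [T2Space M₁] [ChartedSpace (Eucl n) M₁] [IsManifold (𝓡 n) ∞ M₁]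
  [TopologicalSpace M₂] [T2Space M₂] [ChartedSpace (Eucl n) M₂] [IsManifold (𝓡 n) ∞ M₂]
  {k : ℕ} {η χ₀ : ℝ → ℝ} {g₁ : SmoothMetric n M₁} {g₂ : SmoothMetric n M₂}
  {x : UnitBallChart n M₁} {y : UnitBallChart n M₂} {ε : Ioo (0 : ℝ) 1}

theorem isOpen_neckAnnulus (r : ℝ) : IsOpen (neckAnnulus n r) :=
  (isOpen_lt continuous_const continuous_norm).inter (isOpen_lt continuous_norm continuous_const)

theorem formAt_approxSolution_neck {c : ConnectedSum x y ε} (hc : c ∈ neck x y ε) :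
    formAt (approxSolution k η χ₀ g₁ g₂ x y ε) c =
      formAt (pullbackForm (M := Eucl n) (neckCoord x y ε)
        (neckForm k η χ₀ ε (coordForm g₁.inner x.chart) (coordForm g₂.inner y.chart))) c := by
  simp only [formAt, approxSolution, if_pos hc]
  rfl

theorem formAt_approxSolution_inl {c : ConnectedSum x y ε} (hc : c ∉ neck x y ε)
    (hc' : c ∈ range (inl x y ε)) :
    formAt (approxSolution k η χ₀ g₁ g₂ x y ε) c =
      formAt (pullbackForm (projLeft x y ε) g₁.inner) c := by
  simp only [formAt, approxSolution, if_neg hc, if_pos hc']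
  rfl

theorem formAt_approxSolution_inr {c : ConnectedSum x y ε} (hc : c ∉ neck x y ε)
    (hc' : c ∉ range (inl x y ε)) :
    formAt (approxSolution k η χ₀ g₁ g₂ x y ε) c =
      formAt (pullbackForm (projRight x y ε) g₂.inner) c := by
  simp only [formAt, approxSolution, if_neg hc, if_neg hc']
  rfl

theorem inr_notMem_range_inl {q : y.Excised ε} (hq : q.1 ∉ y.closedBall ε) :
    inr x y ε q ∉ range (inl x y ε) := by
  rintro ⟨q', h⟩
  have h2 := congrArg (projRight x y ε) h
  rw [projRight_inr x y ε hq, projRight_inl] at h2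
  exact q.2 (h2 ▸ y.center_mem ε.2.1)

/-- In the neck chart, the approximate solution is given by the formula defining it. -/
theorem coordForm_approxSolution_neck {e : OpenPartialHomeomorph (ConnectedSum x y ε) (Eucl n)}
    (he : e ∈ IsManifold.maximalAtlas (𝓡 n) ∞ (ConnectedSum x y ε))
    (h : e.toPartialEquiv = neckChart x y ε) {z : Eucl n} (hz : z ∈ neckAnnulus n (ε : ℝ)) :
    coordForm (approxSolution k η χ₀ g₁ g₂ x y ε) e z =
      neckForm k η χ₀ ε (coordForm g₁.inner x.chart) (coordForm g₂.inner y.chart) z := by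
  have hsymm : ∀ w, e.symm w = (neckChart x y ε).symm w := fun w => by rw [← h]; rfl
  have hmem : ∀ w ∈ neckAnnulus n (ε : ℝ), e.symm w ∈ neck x y ε := fun w hw => by
    rw [hsymm]; exact (neckChart x y ε).map_target hw
  have hright : ∀ w ∈ neckAnnulus n (ε : ℝ), neckCoord x y ε (e.symm w) = w := fun w hw => by
    rw [hsymm]; exact (neckChart x y ε).right_inv hw
  have htarget : z ∈ e.target := by
    have : e.toPartialEquiv.target = neckAnnulus n (ε : ℝ) := by rw [h]; rfl
    change z ∈ e.toPartialEquiv.target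
    rwa [this]
  rw [coordForm_pullback he htarget (f := neckCoord x y ε) (F := id) mdifferentiableAt_id
    (by filter_upwards [(isOpen_neckAnnulus _).mem_nhds hz] with w hw using hright w hw)
    (formAt_approxSolution_neck (hmem z hz)), formAt_pullbackForm_eucl, pullMetric_id]

section Left

variable {e : OpenPartialHomeomorph (ConnectedSum x y ε) (Eucl n)}
  {φ : OpenPartialHomeomorph M₁ (Eucl n)}

/-- For `z` the coordinate of a point outside of the excised ball, the point of the connected sum
with coordinate `z`. -/
theorem leftChart_symm (h : e.toPartialEquiv = leftChart x y ε φ) {z : Eucl n} (hz : z ∈ φ.target)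
    (hzc : φ.symm z ∉ x.closedBall ε) :
    z ∈ e.target ∧ ∃ q : x.Excised ε, q.1 = φ.symm z ∧ e.symm z = inl x y ε q := by
  have hr : φ.symm z ∉ x.ball ε := fun h => hzc (x.ball_subset_closedBall _ h)
  have h1 : inl x y ε ⟨φ.symm z, hr⟩ ∈ (leftChart x y ε φ).source :=
    ⟨⟨φ.symm z, hr⟩, hzc, φ.map_target hz, rfl⟩
  have h2 : leftChart x y ε φ (inl x y ε ⟨φ.symm z, hr⟩) = z := by
    rw [leftChart_inl φ (q := ⟨φ.symm z, hr⟩) hzc]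
    exact φ.right_inv hz
  refine ⟨?_, ⟨φ.symm z, hr⟩, rfl, ?_⟩
  · change _ ∈ e.toPartialEquiv.target
    rw [h, ← h2]
    exact (leftChart x y ε φ).map_source h1
  · change e.toPartialEquiv.symm _ = _
    rw [h]
    nth_rw 1 [← h2]
    exact (leftChart x y ε φ).left_inv h1

/-- The approximate solution in a chart of `M₁`, on the neck and outside of it. -/
theorem coordForm_approxSolution_left
    (he : e ∈ IsManifold.maximalAtlas (𝓡 n) ∞ (ConnectedSum x y ε))
    (h : e.toPartialEquiv = leftChart x y ε φ)
    (hφ : φ ∈ IsManifold.maximalAtlas (𝓡 n) ∞ M₁) {z : Eucl n} (hz : z ∈ φ.target)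
    (hzc : φ.symm z ∉ x.closedBall ε) :
    (φ.symm z ∈ x.ball 1 → coordForm (approxSolution k η χ₀ g₁ g₂ x y ε) e z =
      pullMetric (x.chart ∘ φ.symm) (neckForm k η χ₀ ε (coordForm g₁.inner x.chart)
        (coordForm g₂.inner y.chart)) z) ∧
    (φ.symm z ∉ x.ball 1 → coordForm (approxSolution k η χ₀ g₁ g₂ x y ε) e z =
      coordForm g₁.inner φ z) := by
  obtain ⟨hze, q, hq, hqe⟩ := leftChart_symm h hz hzc
  have hqc : q.1 ∉ x.closedBall ε := by rwa [hq]
  have hev : ∀ᶠ w in 𝓝 z, w ∈ φ.target ∧ φ.symm w ∉ x.closedBall ε := by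
    have := eventually_symm_notMem_closedBall x ε.2.2.le (φ.map_target hz) hzc
    rwa [φ.right_inv hz] at this
  constructor
  · intro hb
    have hcn : e.symm z ∈ neck x y ε := Or.inl ⟨q, by rwa [hq], hqe.symm⟩
    have hd := contDiffAt_transition' hφ x.mem_maximalAtlas hz hb.1
    rw [coordForm_pullback he hze (f := neckCoord x y ε) (F := x.chart ∘ φ.symm)
      (hd.differentiableAt (by simp)).mdifferentiableAt ?_ (formAt_approxSolution_neck hcn),
      formAt_pullbackForm_eucl]
    filter_upwards [hev] with w hw
    obtain ⟨-, r, hr, hre⟩ := leftChart_symm h hw.1 hw.2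
    rw [hre]
    exact congrArg x.chart hr
  · intro hb
    have hcn : e.symm z ∉ neck x y ε := fun hc => hb (by
      rw [hqe] at hc
      exact hq ▸ mem_neck_inl hqc hc)
    refine coordForm_pullback he hze (f := projLeft x y ε) (F := φ.symm)
      (mdifferentiableAt_chart_symm hφ hz) ?_ (formAt_approxSolution_inl hcn ⟨q, hqe.symm⟩)
    filter_upwards [hev] with w hw
    obtain ⟨-, r, hr, hre⟩ := leftChart_symm h hw.1 hw.2
    rw [hre, projLeft_inl x y ε (by rw [hr]; exact hw.2), hr]

end Left

section Right

variable {e : OpenPartialHomeomorph (ConnectedSum x y ε) (Eucl n)}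
  {φ : OpenPartialHomeomorph M₂ (Eucl n)}

/-- The analogue of `leftChart_symm` on the `M₂` side. -/
theorem rightChart_symm (h : e.toPartialEquiv = rightChart x y ε φ) {z : Eucl n}
    (hz : z ∈ φ.target) (hzc : φ.symm z ∉ y.closedBall ε) :
    z ∈ e.target ∧ ∃ q : y.Excised ε, q.1 = φ.symm z ∧ e.symm z = inr x y ε q := by
  have hr : φ.symm z ∉ y.ball ε := fun h => hzc (y.ball_subset_closedBall _ h)
  have h1 : inr x y ε ⟨φ.symm z, hr⟩ ∈ (rightChart x y ε φ).source :=
    ⟨⟨φ.symm z, hr⟩, hzc, φ.map_target hz, rfl⟩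
  have h2 : rightChart x y ε φ (inr x y ε ⟨φ.symm z, hr⟩) = z := by
    rw [rightChart_inr φ (q := ⟨φ.symm z, hr⟩) hzc]
    exact φ.right_inv hz
  refine ⟨?_, ⟨φ.symm z, hr⟩, rfl, ?_⟩
  · change _ ∈ e.toPartialEquiv.target
    rw [h, ← h2]
    exact (rightChart x y ε φ).map_source h1
  · change e.toPartialEquiv.symm _ = _
    rw [h]
    nth_rw 1 [← h2]
    exact (rightChart x y ε φ).left_inv h1

/-- The approximate solution in a chart of `M₂`. By `neckForm_mirror`, it has on the neck the same form as
on the `M₁` side, with the two manifolds exchanged. -/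
theorem coordForm_approxSolution_right
    (he : e ∈ IsManifold.maximalAtlas (𝓡 n) ∞ (ConnectedSum x y ε))
    (h : e.toPartialEquiv = rightChart x y ε φ)
    (hφ : φ ∈ IsManifold.maximalAtlas (𝓡 n) ∞ M₂) {z : Eucl n} (hz : z ∈ φ.target)
    (hzc : φ.symm z ∉ y.closedBall ε) :
    (φ.symm z ∈ y.ball 1 → coordForm (approxSolution k η χ₀ g₁ g₂ x y ε) e z =
      pullMetric (y.chart ∘ φ.symm) (neckForm k (mirrorCut η) χ₀ ε (coordForm g₂.inner y.chart)
        (coordForm g₁.inner x.chart)) z) ∧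
    (φ.symm z ∉ y.ball 1 → coordForm (approxSolution k η χ₀ g₁ g₂ x y ε) e z =
      coordForm g₂.inner φ z) := by
  obtain ⟨hze, q, hq, hqe⟩ := rightChart_symm h hz hzc
  have hqc : q.1 ∉ y.closedBall ε := by rwa [hq]
  have hev : ∀ᶠ w in 𝓝 z, w ∈ φ.target ∧ φ.symm w ∉ y.closedBall ε := by
    have := eventually_symm_notMem_closedBall y ε.2.2.le (φ.map_target hz) hzc
    rwa [φ.right_inv hz] at this
  constructor
  · intro hb
    have hcn : e.symm z ∈ neck x y ε := Or.inr ⟨q, by rwa [hq], hqe.symm⟩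
    have hd := (contDiffAt_transition' hφ y.mem_maximalAtlas hz hb.1).differentiableAt (by simp)
    have h0 : (y.chart ∘ φ.symm) z ≠ 0 :=
      norm_pos_iff.1 (ε.2.1.trans (norm_lt_of_notMem hb.1 hzc))
    have hd' := (contDiffAt_invert (ε : ℝ) h0).differentiableAt (by simp)
    rw [coordForm_pullback he hze (f := neckCoord x y ε) (F := invert ε ∘ (y.chart ∘ φ.symm))
      (hd'.comp z hd).mdifferentiableAt ?_ (formAt_approxSolution_neck hcn),
      formAt_pullbackForm_eucl, pullMetric_comp hd' hd]
    · refine pullMetric_congr_apply ?_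
      have := neckForm_mirror (k := k) (η := mirrorCut η) (χ₀ := χ₀) ε.2.1
        (coordForm g₂.inner y.chart) (coordForm g₁.inner x.chart) h0
      rwa [mirrorCut_mirrorCut] at this
    · filter_upwards [hev] with w hw
      obtain ⟨-, r, hr, hre⟩ := rightChart_symm h hw.1 hw.2
      rw [hre]
      exact congrArg (fun p => invert (ε : ℝ) (y.chart p)) hr
  · intro hb
    have hcn : e.symm z ∉ neck x y ε := fun hc => hb (by
      rw [hqe] at hc
      exact hq ▸ mem_neck_inr hqc hc)
    refine coordForm_pullback he hze (f := projRight x y ε) (F := φ.symm)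
      (mdifferentiableAt_chart_symm hφ hz) ?_
      (formAt_approxSolution_inr hcn (by rw [hqe]; exact inr_notMem_range_inl hqc))
    filter_upwards [hev] with w hw
    obtain ⟨-, r, hr, hre⟩ := rightChart_symm h hw.1 hw.2
    rw [hre, projRight_inr x y ε (by rw [hr]; exact hw.2), hr]

end Right

/-- If the formula on the neck defines an admissible metric, then so does the approximate
solution. -/
theorem approxSolution_metricNear {m : ℕ} (hη : IsCutoff η 1) (hχ : IsCutoff χ₀ 0)
    (hε : (ε : ℝ) ≤ Real.exp (-1)) (hg₁ : IsAdmissible m g₁) (hg₂ : IsAdmissible m g₂)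
    (h1 : ∀ z : Eucl n, ‖z‖ ≤ 1 → (ε : ℝ) ^ 2 ≤ ‖z‖ →
      MetricNear (neckForm k η χ₀ ε (coordForm g₁.inner x.chart) (coordForm g₂.inner y.chart)) z ∧
        ∀ j, 1 ≤ j → j ≤ m → 0 < sigmaCoord
          (neckForm k η χ₀ ε (coordForm g₁.inner x.chart) (coordForm g₂.inner y.chart)) j z)
    (h2 : ∀ z : Eucl n, ‖z‖ ≤ 1 → (ε : ℝ) ^ 2 ≤ ‖z‖ →
      MetricNear (neckForm k (mirrorCut η) χ₀ ε (coordForm g₂.inner y.chart)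
        (coordForm g₁.inner x.chart)) z ∧
        ∀ j, 1 ≤ j → j ≤ m → 0 < sigmaCoord (neckForm k (mirrorCut η) χ₀ ε
          (coordForm g₂.inner y.chart) (coordForm g₁.inner x.chart)) j z)
    (c : ConnectedSum x y ε) :
    MetricNear (coordForm (approxSolution k η χ₀ g₁ g₂ x y ε) (chartAt (Eucl n) c))
        (chartAt (Eucl n) c c) ∧
      ∀ j, 1 ≤ j → j ≤ m → 0 < sigmaCoord
        (coordForm (approxSolution k η χ₀ g₁ g₂ x y ε) (chartAt (Eucl n) c)) j
        (chartAt (Eucl n) c c) := by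
  have hεsq : (ε : ℝ) ^ 2 ≤ 1 := by nlinarith [ε.2.1, ε.2.2]
  have he := IsManifold.chart_mem_maximalAtlas (I := 𝓡 n) (n := ∞) c
  have hpe : (chartAt (Eucl n) c).toPartialEquiv = preferredChart x y ε c := rfl
  have hpc : chartAt (Eucl n) c c = preferredChart x y ε c c := rfl
  rw [hpc]
  by_cases hc : c ∈ neck x y ε
  · have hp : preferredChart x y ε c = neckChart x y ε := by rw [preferredChart, if_pos hc]
    have hz : neckCoord x y ε c ∈ neckAnnulus n (ε : ℝ) := (neckCoord_bijOn x y ε).mapsTo hc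
    have hzz : preferredChart x y ε c c = neckCoord x y ε c := by rw [hp]; rfl
    rw [hzz]
    have heq : neckForm k η χ₀ ε (coordForm g₁.inner x.chart) (coordForm g₂.inner y.chart)
        =ᶠ[𝓝 (neckCoord x y ε c)]
        coordForm (approxSolution k η χ₀ g₁ g₂ x y ε) (chartAt (Eucl n) c) := by
      filter_upwards [(isOpen_neckAnnulus _).mem_nhds hz] with w hw
      exact (coordForm_approxSolution_neck he (hpe.trans hp) hw).symm
    obtain ⟨h3, h4⟩ := h1 _ hz.2.le hz.1.le
    refine ⟨h3.congr heq, fun j hj hjm => ?_⟩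
    rw [← sigmaCoord_congr heq]
    exact h4 j hj hjm
  by_cases hr : c ∈ range (inl x y ε)
  · obtain ⟨q, rfl⟩ := hr
    have hqb : q.1 ∉ x.ball 1 := fun h => hc (Or.inl ⟨q, h, rfl⟩)
    have hqc : q.1 ∉ x.closedBall ε := fun h => hqb ⟨h.1, h.2.trans_lt ε.2.2⟩
    have hp : preferredChart x y ε (inl x y ε q) = leftChart x y ε (chartAt (Eucl n) q.1) := by
      rw [preferredChart, if_neg hc, if_pos ⟨q, rfl⟩, projLeft_inl x y ε hqc]
    have hφ := IsManifold.chart_mem_maximalAtlas (I := 𝓡 n) (n := ∞) q.1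
    have hq := mem_chart_source (Eucl n) q.1
    have hzz : preferredChart x y ε (inl x y ε q) (inl x y ε q) = chartAt (Eucl n) q.1 q.1 := by
      rw [hp, leftChart_inl _ hqc]
    rw [hzz]
    have hev := eventually_symm_notMem_closedBall x ε.2.2.le hq hqc
    exact metricNear_and_sigmaCoord_pos hg₁ hφ hq hqb
      (fun z hz => h1 z hz.le (by rw [hz]; exact hεsq))
      (fun z hz => neckForm_of_one_le hη hχ ε.2.1 hε _ _ hz)
      (hev.mono fun w hw => (coordForm_approxSolution_left he (hpe.trans hp) hφ hw.1 hw.2).1)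
      (hev.mono fun w hw => (coordForm_approxSolution_left he (hpe.trans hp) hφ hw.1 hw.2).2)
  · obtain ⟨q | q, rfl⟩ := Quot.exists_rep c
    · exact absurd ⟨q, rfl⟩ hr
    change inr x y ε q ∉ _ at hc hr
    have hqb : q.1 ∉ y.ball 1 := fun h => hc (Or.inr ⟨q, h, rfl⟩)
    have hqc : q.1 ∉ y.closedBall ε := fun h => hqb ⟨h.1, h.2.trans_lt ε.2.2⟩
    have hp : preferredChart x y ε (inr x y ε q) = rightChart x y ε (chartAt (Eucl n) q.1) := by
      rw [preferredChart, if_neg hc, if_neg hr, projRight_inr x y ε hqc]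
    have hφ := IsManifold.chart_mem_maximalAtlas (I := 𝓡 n) (n := ∞) q.1
    have hq := mem_chart_source (Eucl n) q.1
    have hzz : preferredChart x y ε (inr x y ε q) (inr x y ε q) = chartAt (Eucl n) q.1 q.1 := by
      rw [hp, rightChart_inr _ hqc]
    change MetricNear _ (preferredChart x y ε (inr x y ε q) (inr x y ε q)) ∧ ∀ j, _ → _ →
      0 < sigmaCoord _ j (preferredChart x y ε (inr x y ε q) (inr x y ε q))
    rw [hzz]
    have hev := eventually_symm_notMem_closedBall y ε.2.2.le hq hqc
    exact metricNear_and_sigmaCoord_pos hg₂ hφ hq hqb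
      (fun z hz => h2 z hz.le (by rw [hz]; exact hεsq))
      (fun z hz => neckForm_of_one_le hη.mirrorCut hχ ε.2.1 hε _ _ hz)
      (hev.mono fun w hw => (coordForm_approxSolution_right he (hpe.trans hp) hφ hw.1 hw.2).1)
      (hev.mono fun w hw => (coordForm_approxSolution_right he (hpe.trans hp) hφ hw.1 hw.2).2)

end Charts

theorem lemma3p1 (n k : ℕ) [NeZero n] (hk : 1 ≤ k) (hkn : 2 * k < n)
    (η χ₀ : ℝ → ℝ) (hη : IsCutoff η 1) (hχ₀ : IsCutoff χ₀ 0) :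
    ∃ ε₀ : ℝ → ℝ → ℝ, (∀ Λ δ, 0 < Λ → 0 < δ → 0 < ε₀ Λ δ ∧ ε₀ Λ δ < 1) ∧
      ∀ (M₁ M₂ : Type*)
        [TopologicalSpace M₁] [T2Space M₁] [CompactSpace M₁] [ChartedSpace (Eucl n) M₁]
        [IsManifold (𝓡 n) ∞ M₁]
        [TopologicalSpace M₂] [T2Space M₂] [CompactSpace M₂] [ChartedSpace (Eucl n) M₂]
        [IsManifold (𝓡 n) ∞ M₂]
        (g₁ : SmoothMetric n M₁) (g₂ : SmoothMetric n M₂)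
        (x : UnitBallChart n M₁) (y : UnitBallChart n M₂),
        IsGluingChart g₁ x → IsGluingChart g₂ y →
        IsAdmissible (k - 1) g₁ → IsAdmissible (k - 1) g₂ →
        (∃ Λ δ, 0 < Λ ∧ 0 < δ ∧
          GeometryBound (k - 1) g₁ x Λ δ ∧ GeometryBound (k - 1) g₂ y Λ δ) ∧
        ∀ Λ δ, 0 < Λ → 0 < δ →
          GeometryBound (k - 1) g₁ x Λ δ → GeometryBound (k - 1) g₂ y Λ δ →
          ∀ ε : Set.Ioo (0 : ℝ) 1, (ε : ℝ) ≤ ε₀ Λ δ →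
            ∃ g : SmoothMetric n (ConnectedSum x y ε),
              (∀ c, g.inner c = approxSolution k η χ₀ g₁ g₂ x y ε c) ∧
              IsAdmissible (k - 1) g := by

  -- The values of `ε` for which the formula on the neck gives an admissible metric, seen from either
  -- side; the bound `e⁻¹` makes the formula match `g_i` beyond the unit sphere.
  set P : ℝ → ℝ → ℝ → Prop := fun Λ δ r => r < 1 ∧ r ≤ Real.exp (-1) ∧
    ∀ G₁ G₂ : Eucl n → BilinForm n, UnitBallMetric (k - 1) Λ δ G₁ →
      UnitBallMetric (k - 1) Λ δ G₂ → ∀ z : Eucl n, ‖z‖ ≤ 1 → r ^ 2 ≤ ‖z‖ →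
      (MetricNear (neckForm k η χ₀ r G₁ G₂) z ∧
        ∀ j, 1 ≤ j → j ≤ k - 1 → 0 < sigmaCoord (neckForm k η χ₀ r G₁ G₂) j z) ∧
      MetricNear (neckForm k (mirrorCut η) χ₀ r G₂ G₁) z ∧
        ∀ j, 1 ≤ j → j ≤ k - 1 → 0 < sigmaCoord (neckForm k (mirrorCut η) χ₀ r G₂ G₁) j z
    with hP
  have hex : ∀ Λ δ : ℝ, ∃ r : ℝ, 0 < Λ → 0 < δ → 0 < r ∧ ∀ s ∈ Ioc 0 r, P Λ δ s := by
    intro Λ δ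
    by_cases h : 0 < Λ ∧ 0 < δ
    · have hev : ∀ᶠ r : ℝ in 𝓝[>] 0, P Λ δ r := by
        filter_upwards [exists_neckForm_pos_of_sq_le hk hkn hη hχ₀ h.1 h.2,
          exists_neckForm_pos_of_sq_le hk hkn hη.mirrorCut hχ₀ h.1 h.2,
          (eventually_lt_nhds (zero_lt_one' ℝ)).filter_mono nhdsWithin_le_nhds,
          (eventually_le_nhds (Real.exp_pos (-1))).filter_mono nhdsWithin_le_nhds]
          with r k1 k2 k3 k4
        exact ⟨k3, k4, fun G₁ G₂ h1 h2 z hz hz' => ⟨k1 G₁ G₂ h1 h2 z hz hz', k2 G₂ G₁ h2 h1 z hz hz'⟩⟩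
      obtain ⟨r, hr, hr'⟩ := mem_nhdsGT_iff_exists_Ioc_subset.1 hev
      exact ⟨r, fun _ _ => ⟨hr, hr'⟩⟩
    · exact ⟨0, fun h1 h2 => absurd ⟨h1, h2⟩ h⟩
  choose ε₀ hε₀ using hex
  refine ⟨ε₀, fun Λ δ hΛ hδ => ?_, ?_⟩
  · obtain ⟨h1, h2⟩ := hε₀ Λ δ hΛ hδ
    exact ⟨h1, (h2 _ ⟨h1, le_rfl⟩).1⟩
  intro M₁ M₂ _ _ _ _ _ _ _ _ _ _ g₁ g₂ x y hx hy hg₁ hg₂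
  constructor
  · obtain ⟨Λ₁, δ₁, h1, h1'⟩ := exists_geometryBound (by omega) hg₁ x
    obtain ⟨Λ₂, δ₂, h2, h2'⟩ := exists_geometryBound (by omega) hg₂ y
    exact ⟨max 1 (max Λ₁ Λ₂), min δ₁ δ₂, lt_max_of_lt_left one_pos, lt_min h1 h2,
      h1' _ _ ((le_max_left _ _).trans (le_max_right _ _)) (min_le_left _ _),
      h2' _ _ ((le_max_right _ _).trans (le_max_right _ _)) (min_le_right _ _)⟩
  · intro Λ δ hΛ hδ hb₁ hb₂ ε hε
    obtain ⟨-, hexp, hpos⟩ := (hε₀ Λ δ hΛ hδ).2 ε ⟨ε.2.1, hε⟩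
    have hU₁ := hx.unitBallMetric hb₁
    have hU₂ := hy.unitBallMetric hb₂
    have key := approxSolution_metricNear (x := x) (y := y) hη hχ₀ hexp hg₁ hg₂
      (fun z hz hz' => (hpos _ _ hU₁ hU₂ z hz hz').1) (fun z hz hz' => (hpos _ _ hU₁ hU₂ z hz hz').2)
    obtain ⟨g, hg⟩ := exists_smoothMetric _ fun c => (key c).1
    refine ⟨g, hg, fun j hj hjm c => ?_⟩
    have hg' : g.inner = approxSolution k η χ₀ g₁ g₂ x y ε := funext hg
    rw [sigmaCurvature, hg']
    exact (key c).2 j hj hjm
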